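/- **Model.** A channel alternates between ON and OFF periods. OFF periods are i.i.d. with the law of a real random variable $Y_{off}\ge 0$. ON periods are i.i.d. phase-type and independent of the OFF periods: during an ON period the phase evolves as a continuous-time Markov chain $X(t)$ on a finite set $\{0\}\cup\mathcal X_1$ with $0\notin\mathcal X_1$ absorbing and reachable from every state and $\mathcal X_1$ irreducible, started from a fixed distribution on $\mathcal X_1$; the ON period ends when $X$ hits $0$. Let $S(t)\in\mathcal X_1$ be the current phase if the channel is ON at time $t$, and $S(t)=0$ if it is OFF. A TCP flow makes transmission attempts at times $U_0=0$, $U_{k+1}=U_k+J_k$; put $S_k=S(U_k)$, and let $W_k,H_k$ be the window size and the slow start threshold (positive integers) at attempt $k$. Let $R>0$ be the round trip time, $T_{min}$ and $T_{max}$ the timeout bounds, $M=\max\{R,T_{min}\}\le T_{max}$, $W_{max}\ge 1$ the maximal window size and $p\in[0,1)$ the packet loss probability while the channel is ON. Then $J_k=R$ if $S_k\neq 0$; $J_k=M$ if $S_k=0$ and $S_{k-1}\ne 0$; $J_k=\min\{2J_{k-1},T_{max}\}$ if $S_k=S_{k-1}=0$. Write $h(w)=\max\{1,\lfloor w/2\rfloor\}$.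 If $S_k=0$ (timeout), $(W_{k+1},H_{k+1})=(1,h(W_k))$. If $S_k\ne0$ and at least one of the $W_k$ packets is lost (each independently with probability $p$), $(W_{k+1},H_{k+1})=(h(W_k),h(W_k))$. Otherwise $H_{k+1}=H_k$, and $W_{k+1}=\min\{2W_k,W_{max}\}$ if $W_k<H_k$, $W_{k+1}=\min\{W_k+1,W_{max}\}$ if $W_k\ge H_k$. An initial distribution is a law of the initial data $(S_0,J_0,W_0,H_0)$ and, if $S_0=0$, of the age $a\geq 0$ of the current OFF period, where $J_0=R$ if $S_0\ne0$, $J_0\in\{\min(2^nM,T_{max}):n\ge0\}$ if $S_0=0$, $1\le W_0,H_0\le W_{max}$, and $\mathbb P(Y_{off}>a)>0$; the residual OFF period then has the law of $Y_{off}-a$ given $Y_{off}>a$. **Proposition 3.** Fix $i_1\in\mathcal X_1$. Assume that there are constants $\epsilon_0,\epsilon_1>0$ with $$\mathbb P(s+M<Y_{off}<s+3M)\ge\epsilon_0\quad\text{for all } 0\le s\le R,$$ $$\mathbb P(Y_{off}\le s+2M\mid Y_{off}\ge s)\ge\epsilon_1\quad\text{for all } s\ge 0 \text{ with } \mathbb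 P(Y_{off}\ge s)>0 .$$ Start the process in the regeneration state $(S_0,J_0,W_0,H_0)=(i_1,R,1,1)$ and let $N$ be the first $k\ge1$ with $(S_k,J_k,W_k,H_k)=(i_1,R,1,1)$ (the number of attempts in a regeneration cycle). Then $N<\infty$ almost surely, $\mathbb E[N^\alpha]<\infty$ for all $\alpha>0$, $\mathbb E[e^{tN}]<\infty$ for all $t$ in a neighbourhood of $0$, and $N$ is aperiodic, that is, $\gcd\{n:\mathbb P(N=n)>0\}=1$. Moreover $$\pi(A)=\frac{\mathbb E\left[\sum_{k=0}^{N-1}\mathbf 1_A(S_k,J_k,W_k,H_k)\right]}{\mathbb E[N]}$$ (with the process started in the regeneration state) is the unique stationary distribution of the process $\{(S_k,J_k,W_k,H_k)\}$: there is an initial distribution for which the process is strictly stationary with marginal $\pi$, and $\pi$ is the common marginal law whenever, for some initial distribution, the law of $(S_k,J_k,W_k,H_k)$ does not depend on $k$. Finally, there are $C\ge 0$ and $0<\rho<1$ such that for every initial distribution, every $k\ge0$ and every measurable set $A$, $$\left|\mathbb P\big((S_k,J_k,W_k,H_k)\in A\big)-\pi(A)\right|\le C\rho^k .$$ -/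

import Mathlib

open MeasureTheory ProbabilityTheory Set

noncomputable section

/-- The discrete σ-algebra on the finite set of channel states. -/
instance optionMeasurableSpace (ι : Type*) : MeasurableSpace (Option ι) := ⊤

instance optionDiscreteMeasurableSpace (ι : Type*) : DiscreteMeasurableSpace (Option ι) :=
  ⟨fun _ ↦ trivial⟩

/-- State `b` is reachable from state `a` in the continuous-time Markov chain with generator `Q`:
there is a finite (possibly empty) chain of transitions of positive rate from `a` to `b`. -/
def Leads {κ : Type*} (Q : Matrix κ κ ℝ) (a b : κ) : Prop :=
  Relation.ReflTransGen (fun c d ↦ 0 < Q c d) a b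

/-- Parameters of a TCP flow over an ON-OFF channel with phase-type ON periods. The channel
states are `some i` (channel ON, in phase `i`) and `none` (channel OFF). -/
structure OnOffTCP (ι : Type*) [Fintype ι] where
  /-- generator of the phase process; `none` is absorbing (it ends the ON period) -/
  Q : Matrix (Option ι) (Option ι) ℝ
  rate_nonneg : ∀ a b, a ≠ b → 0 ≤ Q a b
  row_sum : ∀ a, ∑ b, Q a b = 0
  absorbing : ∀ b, Q none b = 0
  irreducible : ∀ i j : ι, Leads Q (some i) (some j)
  exits : ∀ i : ι, Leads Q (some i) none
  /-- distribution of the phase in which an ON period starts -/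
  α : PMF ι
  /-- distribution of the length of an OFF period -/
  ν : Measure ℝ
  isProb : IsProbabilityMeasure ν
  off_nonneg : ν (Iio 0) = 0
  /-- round trip time -/
  R : ℝ
  R_pos : 0 < R
  /-- least admissible timeout duration -/
  Tmin : ℝ
  /-- greatest admissible timeout duration -/
  Tmax : ℝ
  Tmax_ge : max R Tmin ≤ Tmax
  /-- maximal window size -/
  Wmax : ℕ
  Wmax_pos : 1 ≤ Wmax
  /-- probability that a packet sent while the channel is ON is lost -/
  p : unitInterval
  p_lt_one : p < 1

namespace OnOffTCP

variable {ι : Type*} [Fintype ι] (m : OnOffTCP ι)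

instance : IsProbabilityMeasure m.ν := m.isProb

/-- The first timeout duration. -/
def M : ℝ := max m.R m.Tmin

/-! ### The law of the channel -/

/-- Total rate at which phase `i` is left. -/
def rate (i : ι) : ℝ := -m.Q (some i) (some i)

theorem sum_rates [DecidableEq ι] (i : ι) :
    ∑ b ∈ Finset.univ.erase (some i), m.Q (some i) b = m.rate i := by
  have h := m.row_sum (some i)
  rw [← Finset.add_sum_erase _ _ (Finset.mem_univ (some i))] at h
  unfold rate
  linarith

theorem rate_pos (i : ι) : 0 < m.rate i := by
  classical
  rw [← m.sum_rates i]
  obtain h | ⟨b, hb, -⟩ := Relation.ReflTransGen.cases_head (m.exits i)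
  · exact absurd h (by simp)
  have hne : b ≠ some i := by
    rintro rfl
    have h1 := m.sum_rates i
    have h2 : 0 ≤ ∑ b ∈ Finset.univ.erase (some i), m.Q (some i) b :=
      Finset.sum_nonneg fun c hc ↦ m.rate_nonneg _ _ (Finset.ne_of_mem_erase hc).symm
    unfold rate at h1
    linarith
  exact Finset.sum_pos' (fun c hc ↦ m.rate_nonneg _ _ (Finset.ne_of_mem_erase hc).symm)
    ⟨b, Finset.mem_erase.2 ⟨hne, Finset.mem_univ _⟩, hb⟩

open Classical in
/-- Law of the state entered when phase `i` is left: `b ≠ some i` has probability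
`Q (some i) b / rate i`. -/
def phaseJump (i : ι) : PMF (Option ι) :=
  PMF.ofFintype (fun b ↦ if b = some i then 0 else ENNReal.ofReal (m.Q (some i) b / m.rate i)) (by
    rw [← Finset.add_sum_erase _ _ (Finset.mem_univ (some i)), if_pos rfl, zero_add,
      Finset.sum_congr rfl fun b hb ↦ if_neg (Finset.ne_of_mem_erase hb),
      ← ENNReal.ofReal_sum_of_nonneg fun b hb ↦ div_nonneg
        (m.rate_nonneg _ _ (Finset.ne_of_mem_erase hb).symm) (m.rate_pos i).le,
      ← Finset.sum_div, m.sum_rates i, div_self (m.rate_pos i).ne', ENNReal.ofReal_one])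

/-- Law of the next channel state. An OFF period is followed by a phase drawn from `α`. -/
def jumpLaw : Option ι → Measure (Option ι)
  | none => (m.α.map some).toMeasure
  | some i => (m.phaseJump i).toMeasure

instance (s : Option ι) : IsProbabilityMeasure (m.jumpLaw s) := by
  cases s <;> unfold jumpLaw <;> infer_instance

/-- Law of the time spent in a channel state: an OFF period has law `ν`, and the sojourn in
phase `i` is exponential. -/
def sojournLaw : Option ι → Measure ℝ
  | none => m.ν
  | some i => expMeasure (m.rate i)

instance (s : Option ι) : IsProbabilityMeasure (m.sojournLaw s) := by
  cases s with
  | none => exact m.isProb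
  | some i => exact isProbabilityMeasure_expMeasure (m.rate_pos i)

/-- Law of the residual time in a channel state, given that `a` time units have been spent there:
that of `Y - a` given `Y > a` for an OFF period `Y`; exponential phases have no memory. -/
def residualLaw : Option ι × ℝ → Measure ℝ
  | (none, a) => (m.ν[|Ioi a]).map (fun y ↦ y - a)
  | (some i, _) => m.sojournLaw (some i)

theorem measurable_residualLaw : Measurable m.residualLaw := by
  refine measurable_from_prod_countable_right fun s ↦ ?_
  cases s with
  | some i => exact measurable_const
  | none =>
    refine Measure.measurable_of_measurable_coe _ fun B hB ↦ ?_
    have e : ∀ a : ℝ, m.residualLaw (none, a) B =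
        (m.ν (Prod.mk a ⁻¹' {z : ℝ × ℝ | z.1 < z.2}))⁻¹ *
          m.ν (Prod.mk a ⁻¹' {z : ℝ × ℝ | z.1 < z.2 ∧ z.2 - z.1 ∈ B}) := by
      intro a
      have hf : Measurable fun y : ℝ ↦ y - a := measurable_id.sub_const a
      rw [residualLaw, Measure.map_apply hf hB, cond_apply measurableSet_Ioi]
      rfl
    simp only [e]
    have h1 : MeasurableSet {z : ℝ × ℝ | z.1 < z.2} :=
      measurableSet_lt measurable_fst measurable_snd
    have h2 : MeasurableSet {z : ℝ × ℝ | z.1 < z.2 ∧ z.2 - z.1 ∈ B} :=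
      h1.inter ((measurable_snd.sub measurable_fst) hB)
    exact (measurable_measure_prodMk_left h1).inv.mul (measurable_measure_prodMk_left h2)

/-- The kernel sending (channel state, time already spent in it) to the residual time law. -/
def residualKernel : Kernel (Option ι × ℝ) ℝ where
  toFun := m.residualLaw
  measurable' := m.measurable_residualLaw

instance : IsFiniteKernel m.residualKernel := by
  refine ⟨1, ENNReal.one_lt_top, fun x ↦ ?_⟩
  change m.residualLaw x univ ≤ 1
  obtain ⟨_ | i, a⟩ := x
  · have hf : Measurable fun y : ℝ ↦ y - a := measurable_id.sub_const a
    rw [residualLaw, Measure.map_apply hf MeasurableSet.univ]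
    exact prob_le_one
  · exact (prob_le_one : m.sojournLaw (some i) univ ≤ 1)

/-! ### Sample paths -/

/-- Full description of the system at a transmission attempt: channel state, time already spent
in the current OFF period (irrelevant if the channel is ON), time until the next attempt, window
size, slow start threshold. -/
abbrev Full (ι : Type*) := Option ι × ℝ × ℝ × ℕ × ℕ

/-- The states `(S, J, W, H)`. -/
abbrev Obs (ι : Type*) := Option ι × ℝ × ℕ × ℕ

/-- Sample points: the full state at time `0`, the residual time in the channel state at time `0`,
for all `(n, s)` the sojourn time and the successor used if the `n`-th channel state visited
is `s`, and for all `(k, l)` whether packet `l` of the `k`-th window is lost when it is sent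
while the channel is ON. -/
abbrev Sample (ι : Type*) :=
  (Full ι × ℝ) × (ℕ × Option ι → ℝ × Option ι) × (ℕ × ℕ → Bool)

/-- The law of the sample point when the full state at time `0` has law `η`. -/
def law (η : Measure (Full ι)) : Measure (Sample ι) :=
  (η ⊗ₘ m.residualKernel.comap (fun x : Full ι ↦ (x.1, x.2.1)) (by fun_prop)).prod
    ((Measure.infinitePi fun q : ℕ × Option ι ↦ (m.sojournLaw q.2).prod (m.jumpLaw q.2)).prod
      (Measure.infinitePi fun _ : ℕ × ℕ ↦ bernoulliMeasure true false m.p))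

/-- The `n`-th channel state visited. -/
def visited (ω : Sample ι) : ℕ → Option ι
  | 0 => ω.1.1.1
  | n + 1 => (ω.2.1 (n, visited ω n)).2

/-- The time spent in the `n`-th channel state visited. -/
def sojourn (ω : Sample ι) : ℕ → ℝ
  | 0 => ω.1.2
  | n + 1 => (ω.2.1 (n + 1, visited ω (n + 1))).1

/-- The channel state `S(t)` at time `t ≥ 0`. -/
def channel (ω : Sample ι) (t : ℝ) : Option ι :=
  visited ω (sInf {n : ℕ | t < ∑ l ∈ Finset.range (n + 1), sojourn ω l})

/-- Some packet of the `k`-th window, of size `w`, would be lost on the ON channel. -/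
def Lost (ω : Sample ι) (k w : ℕ) : Prop := ∃ l < w, ω.2.2 (k, l) = true

/-- Half of a window, rounded down, but at least one packet. -/
def half (w : ℕ) : ℕ := max 1 (w / 2)

open Classical in
/-- Window and threshold after the `k`-th window was sent, the channel being in state `s`:
timeout if it is OFF, fast retransmit if it is ON and a packet is lost, and otherwise slow start
or congestion avoidance. -/
def nextWindow (ω : Sample ι) (k : ℕ) (s : Option ι) (w h : ℕ) : ℕ × ℕ :=
  if s = none then (1, half w)
  else if Lost ω k w then (half w, half w)
  else if w < h then (min (2 * w) m.Wmax, h)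
  else (min (w + 1) m.Wmax, h)

/-- Time from an attempt made in channel state `s'` to the next one, where the previous attempt
was made in channel state `s` and preceded it by `j`. -/
def nextGap (s s' : Option ι) (j : ℝ) : ℝ :=
  match s', s with
  | some _, _ => m.R
  | none, some _ => m.M
  | none, none => min (2 * j) m.Tmax

/-- The time `U k` of the `k`-th attempt, the time `J k` from there to the next one, and `W k`,
`H k` at that attempt. -/
def attempt (ω : Sample ι) : ℕ → ℝ × ℝ × ℕ × ℕ
  | 0 => (0, ω.1.1.2.2)
  | k + 1 =>
    let c := attempt ω k
    let u := c.1 + c.2.1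
    (u, m.nextGap (channel ω c.1) (channel ω u) c.2.1,
      m.nextWindow ω k (channel ω c.1) c.2.2.1 c.2.2.2)

/-- The process `(S k, J k, W k, H k)`. -/
def proc (k : ℕ) (ω : Sample ι) : Obs ι := (channel ω (m.attempt ω k).1, (m.attempt ω k).2)

/-! ### Initial distributions, regeneration and stationarity -/

/-- The full states that make sense at a transmission attempt. -/
def Admissible (x : Full ι) : Prop :=
  (match x.1 with
    | some _ => x.2.2.1 = m.R
    | none => 0 ≤ x.2.1 ∧ m.ν (Ioi x.2.1) ≠ 0 ∧ ∃ n : ℕ, x.2.2.1 = min (2 ^ n * m.M) m.Tmax) ∧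
  (1 ≤ x.2.2.2.1 ∧ x.2.2.2.1 ≤ m.Wmax) ∧ (1 ≤ x.2.2.2.2 ∧ x.2.2.2.2 ≤ m.Wmax)

/-- `η` is a probability measure on admissible full states. -/
def IsInitialLaw (η : Measure (Full ι)) : Prop :=
  IsProbabilityMeasure η ∧ ∀ᵐ x ∂η, m.Admissible x

/-- The regeneration state `(i₁, R, 1, 1)`. -/
def regState (i₁ : ι) : Obs ι := (some i₁, m.R, 1, 1)

/-- The law of the sample point when the process starts at a regeneration epoch. -/
def regLaw (i₁ : ι) : Measure (Sample ι) := m.law (Measure.dirac (some i₁, 0, m.R, 1, 1))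

/-- The number `N` of attempts in the cycle that starts at attempt `0`: the first `k ≥ 1` at
which the process is in the regeneration state (`⊤` if there is none). -/
def cycleLength (i₁ : ι) (ω : Sample ι) : ℕ∞ :=
  ⨅ (k : ℕ) (_ : 1 ≤ k ∧ m.proc k ω = m.regState i₁), (k : ℕ∞)

/-- With initial law `η`, the process `(S k, J k, W k, H k)` is strictly stationary. -/
def IsStationary (η : Measure (Full ι)) : Prop :=
  IdentDistrib (fun ω (k : ℕ) ↦ m.proc (k + 1) ω) (fun ω (k : ℕ) ↦ m.proc k ω) (m.law η) (m.law η)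

end OnOffTCP

end

/-!
The flow is made into a Markov chain on a path space. A `Run` records the channel (state, age,
residual time and the states to come with their sojourn times), the gap to the next attempt, window
and threshold, and the packet losses to come; `next` moves it to the next attempt. An exponential
sojourn has no memory and an OFF period of age `a` has the law of `Y_off` given `Y_off > a`, so the
channel has the Markov property at a fixed time (`lintegral_advance`), and the full states form a
Markov chain under `next` (`isMarkovShift`) from which the flow can be read off (`ae_proc_eq`).

Everything then follows from a Doeblin condition (`exists_minorization`): for some `n`, the
regeneration state is reached in exactly `n + 2` attempts with a probability bounded below,
uniformly over all admissible states. Three facts carry it.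

* From any admissible state one of the next two attempts finds the channel ON with a probability
  bounded below (`exists_le_on`): by the assumption on the residual OFF period, that period ends
  within `2 M` with probability at least `ε₁`, and the ON phase that follows may last longer than
  `Tmax`.
* There is an `n` such that from every ON phase and every window and threshold the regeneration
  state is reached in `n` attempts with positive probability (`exists_reach_ne_zero`). The path is
  the following: the channel is OFF at the next attempt, its age `s` being in any given subset of
  `(0, R)` of positive Lebesgue measure with positive probability; the OFF period lasts for one or
  two further attempts, at the ages `s + M` and `s + M + J₂` with `J₂ = min (2 M) Tmax`, so that
  window and threshold become `1`; and the channel is in phase `i₁` at the attempt after that. By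
  the assumption on `Y_off` one of the two variants is possible for a set of `s` of positive
  measure. The ON state ranges over a finite set, so the bound is uniform.
* An ON phase can be prolonged by one attempt, so that `n + 1` attempts serve as well as `n`. Hence
  both attempts of the first fact lead to a total of `n + 2`, and the cycle length is aperiodic.

A Doeblin condition gives a geometric tail of the cycle length (`measure_taboo_le`), hence all
moments, and a geometric decay of the oscillation of the transition probabilities
(`exists_bounds`), hence uniform convergence and uniqueness. The occupation measure of a cycle is
invariant (`lintegral_occupation_shift`).
-/

set_option linter.unusedSectionVars false

/-! ### Markov chains with a uniformly accessible state -/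

section MarkovShift

variable {E Ω : Type*} [MeasurableSpace E] [MeasurableSpace Ω]

/-- A Markov chain with values in `E`, given by the laws `P x` on the path space `Ω` of the chain
started in `x`, the shift `θ` of paths, and the initial state `X`. Only the states in `G`, which
the chain does not leave, are considered. -/
structure IsMarkovShift (P : Kernel E Ω) (θ : Ω → Ω) (X : Ω → E) (G : Set E) : Prop where
  measurable_shift : Measurable θ
  measurable_state : Measurable X
  measurableSet_states : MeasurableSet G
  apply_univ : ∀ x ∈ G, P x univ = 1
  ae_state : ∀ x ∈ G, ∀ᵐ ρ ∂P x, X ρ = x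
  ae_mem : ∀ x ∈ G, ∀ᵐ ρ ∂P x, X (θ ρ) ∈ G
  lintegral_shift : ∀ x ∈ G, ∀ F : Ω → ENNReal, Measurable F →
    ∫⁻ ρ, F (θ ρ) ∂P x = ∫⁻ ρ, ∫⁻ σ, F σ ∂P (X (θ ρ)) ∂P x

/-- The paths that are in `D i` at time `i + 1` for all `i < k`. -/
def pastEvent (θ : Ω → Ω) (X : Ω → E) (D : ℕ → Set E) (k : ℕ) : Set Ω :=
  {ρ | ∀ i < k, X (θ^[i + 1] ρ) ∈ D i}

/-- The paths that avoid `x₀` at the times `1, …, k`. -/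
def taboo (θ : Ω → Ω) (X : Ω → E) (x₀ : E) (k : ℕ) : Set Ω :=
  pastEvent θ X (fun _ ↦ {x₀}ᶜ) k

/-- The first time `k ≥ 1` at which the chain is in `x₀`. -/
noncomputable def returnTime (θ : Ω → Ω) (X : Ω → E) (x₀ : E) (ρ : Ω) : ℕ∞ :=
  ⨅ (k : ℕ) (_ : 1 ≤ k ∧ X (θ^[k] ρ) = x₀), (k : ℕ∞)

theorem mem_taboo_iff_lt_returnTime {θ : Ω → Ω} {X : Ω → E} {x₀ : E} {k : ℕ} {ρ : Ω} :
    ρ ∈ taboo θ X x₀ k ↔ (k : ℕ∞) < returnTime θ X x₀ ρ := by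
  have e : (k : ℕ∞) < returnTime θ X x₀ ρ ↔ ((k + 1 : ℕ) : ℕ∞) ≤ returnTime θ X x₀ ρ := by
    rw [Nat.cast_add, Nat.cast_one]
    exact (Order.add_one_le_iff_of_not_isMax (by simp)).symm
  rw [e, returnTime]
  simp only [le_iInf_iff, Nat.cast_le]
  constructor
  · intro h j hj
    by_contra! hlt
    have := h (j - 1) (by omega)
    rw [Nat.sub_add_cancel hj.1] at this
    exact this hj.2
  · intro h i hi hx
    have := h (i + 1) ⟨by omega, hx⟩
    omega

variable {P : Kernel E Ω} [IsFiniteKernel P] {θ : Ω → Ω} {X : Ω → E} {G : Set E}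

variable (P θ X) in
/-- The expected number of visits before the first return to `x₀`. -/
noncomputable def occupation (x₀ : E) : Measure E :=
  Measure.sum fun k ↦ ((P x₀).restrict (taboo θ X x₀ k)).map fun ρ ↦ X (θ^[k] ρ)

theorem pastEvent_succ (D : ℕ → Set E) (k : ℕ) (ρ : Ω) : ρ ∈ pastEvent θ X D (k + 1) ↔
    X (θ ρ) ∈ D 0 ∧ θ ρ ∈ pastEvent θ X (fun i ↦ D (i + 1)) k := by
  constructor
  · exact fun hρ ↦ ⟨hρ 0 (by omega), fun i hi ↦ hρ (i + 1) (by omega)⟩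
  · rintro ⟨h0, h1⟩ (_ | i) hi
    · exact h0
    · exact h1 i (by omega)

namespace IsMarkovShift

variable (h : IsMarkovShift P θ X G)
include h

theorem isProbabilityMeasure {x : E} (hx : x ∈ G) : IsProbabilityMeasure (P x) :=
  ⟨h.apply_univ x hx⟩

theorem measurable_iterate (k : ℕ) : Measurable fun ρ ↦ X (θ^[k] ρ) :=
  h.measurable_state.comp (h.measurable_shift.iterate k)

theorem measurableSet_pastEvent {D : ℕ → Set E} (hD : ∀ i, MeasurableSet (D i)) (k : ℕ) :
    MeasurableSet (pastEvent θ X D k) := by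
  have : pastEvent θ X D k = ⋂ i, ⋂ (_ : i < k), {ρ | X (θ^[i + 1] ρ) ∈ D i} := by
    ext ρ
    simp [pastEvent]
  rw [this]
  exact MeasurableSet.iInter fun i ↦ MeasurableSet.iInter fun _ ↦
    h.measurable_iterate (i + 1) (hD i)

theorem ae_iterate_mem (k : ℕ) : ∀ x ∈ G, ∀ᵐ ρ ∂P x, X (θ^[k] ρ) ∈ G := by
  induction k with
  | zero => exact fun x hx ↦ (h.ae_state x hx).mono fun ρ hρ ↦ by simpa [hρ] using hx
  | succ k ih =>
    intro x hx
    have hm : MeasurableSet {ρ | X (θ^[k] ρ) ∈ G} :=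
      h.measurable_iterate k h.measurableSet_states
    rw [ae_iff]
    have e : {ρ | ¬ X (θ^[k + 1] ρ) ∈ G} = θ ⁻¹' {ρ | X (θ^[k] ρ) ∈ G}ᶜ := rfl
    rw [e, ← lintegral_indicator_one (h.measurable_shift hm.compl)]
    change ∫⁻ ρ, {ρ | X (θ^[k] ρ) ∈ G}ᶜ.indicator 1 (θ ρ) ∂P x = 0
    rw [h.lintegral_shift x hx _ (measurable_one.indicator hm.compl)]
    refine (lintegral_congr_ae ((h.ae_mem x hx).mono fun ρ hρ ↦ ?_)).trans lintegral_zero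
    exact (lintegral_indicator_one hm.compl).trans (ae_iff.1 (ih _ hρ))

/-- The Markov property at time `k`, on an event that is determined by the states up to `k`. -/
theorem lintegral_pastEvent {F : Ω → ENNReal} (hF : Measurable F) (k : ℕ) :
    ∀ {D : ℕ → Set E}, (∀ i, MeasurableSet (D i)) → ∀ x ∈ G,
    ∫⁻ ρ, (pastEvent θ X D k).indicator (fun ρ ↦ F (θ^[k] ρ)) ρ ∂P x =
    ∫⁻ ρ, (pastEvent θ X D k).indicator (fun ρ ↦ ∫⁻ σ, F σ ∂P (X (θ^[k] ρ))) ρ ∂P x := by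
  have hPF : Measurable fun y ↦ ∫⁻ σ, F σ ∂P y := Measurable.lintegral_kernel hF
  induction k with
  | zero =>
    intro D _ x hx
    have e : pastEvent θ X D 0 = univ := eq_univ_of_forall fun ρ i hi ↦ absurd hi (by omega)
    rw [e]
    simp only [indicator_univ, Function.iterate_zero, id]
    rw [lintegral_congr_ae ((h.ae_state x hx).mono fun ρ hρ ↦ by simp only [hρ] :
      (fun ρ ↦ ∫⁻ σ, F σ ∂P (X ρ)) =ᵐ[P x] fun _ ↦ ∫⁻ σ, F σ ∂P x), lintegral_const,
      h.apply_univ x hx, mul_one]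
  | succ k ih =>
    intro D hD x hx
    have hA := h.measurableSet_pastEvent (fun i ↦ hD (i + 1)) k
    have hX0 : MeasurableSet {σ | X σ ∈ D 0} := h.measurable_state (hD 0)
    -- apply the Markov property at time `1`, and the induction hypothesis after it
    have step : ∀ f : Ω → ENNReal, Measurable f →
        ∫⁻ ρ, (pastEvent θ X D (k + 1)).indicator (fun ρ ↦ f (θ^[k + 1] ρ)) ρ ∂P x =
        ∫⁻ ρ, ∫⁻ σ, {σ | X σ ∈ D 0}.indicator ((pastEvent θ X (fun i ↦ D (i + 1)) k).indicator
          fun σ ↦ f (θ^[k] σ)) σ ∂P (X (θ ρ)) ∂P x := by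
      intro f hf
      refine Eq.trans (lintegral_congr fun ρ ↦ ?_) (h.lintegral_shift x hx _
        (((hf.comp (h.measurable_shift.iterate k)).indicator hA).indicator hX0))
      have hiff := pastEvent_succ (θ := θ) (X := X) D k ρ
      simp only [indicator, Function.iterate_succ_apply, mem_ofPred_eq]
      by_cases h0 : X (θ ρ) ∈ D 0 <;> by_cases h1 : θ ρ ∈ pastEvent θ X (fun i ↦ D (i + 1)) k <;>
        simp [hiff, h0, h1]
    rw [step F hF, step (fun ρ ↦ ∫⁻ σ, F σ ∂P (X ρ)) (hPF.comp h.measurable_state)]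
    refine lintegral_congr_ae ((h.ae_mem x hx).mono fun ρ hρ ↦ ?_)
    dsimp only
    by_cases h0 : X (θ ρ) ∈ D 0
    · have e : ∀ f : Ω → ENNReal, ∫⁻ σ, {σ | X σ ∈ D 0}.indicator f σ ∂P (X (θ ρ)) =
          ∫⁻ σ, f σ ∂P (X (θ ρ)) := fun f ↦
        lintegral_congr_ae ((h.ae_state _ hρ).mono fun σ hσ ↦
          indicator_of_mem (show σ ∈ {σ | X σ ∈ D 0} by rwa [← hσ] at h0) _)
      rw [e, e, ih (fun i ↦ hD (i + 1)) _ hρ]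
    · have e : ∀ f : Ω → ENNReal, ∫⁻ σ, {σ | X σ ∈ D 0}.indicator f σ ∂P (X (θ ρ)) = 0 := fun f ↦
        (lintegral_congr_ae ((h.ae_state _ hρ).mono fun σ hσ ↦
          indicator_of_notMem (show σ ∉ {σ | X σ ∈ D 0} by rwa [← hσ] at h0) _)).trans
            lintegral_zero
      rw [e, e]

/-- The Markov property at time `k` for events. -/
theorem measure_pastEvent_inter {D : ℕ → Set E} (hD : ∀ i, MeasurableSet (D i)) (k : ℕ)
    {B : Set Ω} (hB : MeasurableSet B) {x : E} (hx : x ∈ G) :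
    P x (pastEvent θ X D k ∩ θ^[k] ⁻¹' B) =
      ∫⁻ ρ, (pastEvent θ X D k).indicator (fun ρ ↦ P (X (θ^[k] ρ)) B) ρ ∂P x := by
  have hA := h.measurableSet_pastEvent hD k
  have := h.lintegral_pastEvent (measurable_one.indicator hB) k hD x hx
  simp only [lintegral_indicator_one hB] at this
  rw [← this, ← lintegral_indicator_one (hA.inter (h.measurable_shift.iterate k hB))]
  refine lintegral_congr fun ρ ↦ ?_
  rw [inter_indicator_one]
  simp only [Pi.mul_apply, indicator, mem_preimage]
  split_ifs <;> simp_all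

theorem measure_iterate_preimage (k : ℕ) {B : Set Ω} (hB : MeasurableSet B) {x : E} (hx : x ∈ G) :
    P x (θ^[k] ⁻¹' B) = ∫⁻ ρ, P (X (θ^[k] ρ)) B ∂P x := by
  have e : pastEvent θ X (fun _ ↦ univ) k = univ := eq_univ_of_forall fun ρ i _ ↦ mem_univ _
  have := h.measure_pastEvent_inter (fun _ ↦ MeasurableSet.univ) k hB hx
  simpa only [e, indicator_univ, univ_inter] using this

variable [MeasurableSingletonClass E] {x₀ : E}

theorem measurableSet_taboo (k : ℕ) : MeasurableSet (taboo θ X x₀ k) :=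
  h.measurableSet_pastEvent (fun _ ↦ (measurableSet_singleton x₀).compl) k

/-- If `x₀` is reached in `n` steps with probability at least `δ` from everywhere, then the
probability not to have returned to `x₀` decays geometrically. -/
theorem measure_taboo_le {n : ℕ} (hn : 1 ≤ n) {δ : ENNReal}
    (hmin : ∀ x ∈ G, δ ≤ P x {ρ | X (θ^[n] ρ) = x₀}) {x : E} (hx : x ∈ G) (j : ℕ) :
    P x (taboo θ X x₀ (j * n)) ≤ (1 - δ) ^ j := by
  induction j with
  | zero => exact (measure_mono (subset_univ _)).trans (by simp [h.apply_univ x hx])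
  | succ j ih =>
    have hB : MeasurableSet {ρ | X (θ^[n] ρ) = x₀} :=
      h.measurable_iterate n (measurableSet_singleton x₀)
    have hsub : taboo θ X x₀ ((j + 1) * n) ⊆
        taboo θ X x₀ (j * n) ∩ θ^[j * n] ⁻¹' {ρ | X (θ^[n] ρ) = x₀}ᶜ := by
      intro ρ hρ
      refine ⟨fun i hi ↦ hρ i (hi.trans_le (Nat.mul_le_mul_right n j.le_succ)), fun hcon ↦ ?_⟩
      refine hρ (j * n + n - 1) (by rw [add_mul]; omega) ?_
      rw [Nat.sub_add_cancel (by omega), add_comm, Function.iterate_add_apply]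
      exact hcon
    refine (measure_mono hsub).trans ?_
    rw [taboo, h.measure_pastEvent_inter (fun _ ↦ (measurableSet_singleton x₀).compl) _ hB.compl hx]
    calc _ ≤ ∫⁻ ρ, (taboo θ X x₀ (j * n)).indicator (fun _ ↦ 1 - δ) ρ ∂P x := by
          refine lintegral_mono_ae ((h.ae_iterate_mem (j * n) x hx).mono fun ρ hρ ↦ ?_)
          refine indicator_le_indicator ?_
          have := h.isProbabilityMeasure hρ
          rw [prob_compl_eq_one_sub hB]
          exact tsub_le_tsub_left (hmin _ hρ) 1
      _ = (1 - δ) * P x (taboo θ X x₀ (j * n)) :=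
          lintegral_indicator_const (h.measurableSet_taboo _) _
      _ ≤ (1 - δ) ^ (j + 1) := by
          rw [pow_succ']
          gcongr

/-- Every time at which `x₀` may be visited is a sum of possible return times. -/
theorem dvd_of_measure_ne_zero (hx₀ : x₀ ∈ G) {d : ℕ}
    (hd : ∀ n : ℕ, P x₀ {ρ | returnTime θ X x₀ ρ = n} ≠ 0 → d ∣ n) (n : ℕ)
    (hn : P x₀ {ρ | X (θ^[n] ρ) = x₀} ≠ 0) : d ∣ n := by
  induction n using Nat.strong_induction_on with
  | _ n ih =>
  rcases Nat.eq_zero_or_pos n with rfl | hn0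
  · exact dvd_zero d
  -- the first return takes place at some time `j + 1 ≤ n`
  let D : ℕ → ℕ → Set E := fun j i ↦ if i < j then {x₀}ᶜ else {x₀}
  have hD : ∀ j i, MeasurableSet (D j i) := fun j i ↦ by
    simp only [D]
    split_ifs
    exacts [(measurableSet_singleton x₀).compl, measurableSet_singleton x₀]
  have hfirst : ∀ j ρ, ρ ∈ pastEvent θ X (D j) (j + 1) ↔
      (∀ i < j, X (θ^[i + 1] ρ) ≠ x₀) ∧ X (θ^[j + 1] ρ) = x₀ := by
    intro j ρ
    constructor
    · intro hρ
      refine ⟨fun i hi ↦ ?_, ?_⟩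
      · have := hρ i (by omega)
        simp only [D, if_pos hi] at this
        exact this
      · have := hρ j (by omega)
        simp only [D, lt_irrefl, if_false] at this
        exact this
    · rintro ⟨h1, h2⟩ i hi
      simp only [D]
      split_ifs with hij
      · exact h1 i hij
      · obtain rfl : i = j := by omega
        exact h2
  have hcov : {ρ | X (θ^[n] ρ) = x₀} ⊆ ⋃ j ∈ Finset.range n,
      (pastEvent θ X (D j) (j + 1) ∩ {ρ | X (θ^[n] ρ) = x₀}) := by
    intro ρ hρ
    have hex : ∃ j, X (θ^[j + 1] ρ) = x₀ := ⟨n - 1, by rwa [Nat.sub_add_cancel hn0]⟩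
    classical
    have hle : Nat.find hex ≤ n - 1 := Nat.find_min' hex (by rwa [Nat.sub_add_cancel hn0])
    simp only [mem_iUnion, Finset.mem_range]
    exact ⟨Nat.find hex, by omega, (hfirst _ _).2 ⟨fun i hi ↦ Nat.find_min hex hi,
      Nat.find_spec hex⟩, hρ⟩
  obtain ⟨j, hj, hne⟩ : ∃ j < n,
      P x₀ (pastEvent θ X (D j) (j + 1) ∩ {ρ | X (θ^[n] ρ) = x₀}) ≠ 0 := by
    by_contra! hcon
    refine hn (measure_mono_null hcov ?_)
    exact (measure_biUnion_null_iff (Finset.countable_toSet (Finset.range n))).2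
      fun j hj ↦ hcon j (Finset.mem_range.1 hj)
  have hB : MeasurableSet {ρ | X (θ^[n - (j + 1)] ρ) = x₀} :=
    h.measurable_iterate _ (measurableSet_singleton x₀)
  have hsplit : {ρ | X (θ^[n] ρ) = x₀} = θ^[j + 1] ⁻¹' {ρ | X (θ^[n - (j + 1)] ρ) = x₀} := by
    ext ρ
    simp only [mem_preimage, mem_ofPred_eq]
    rw [← Function.iterate_add_apply, Nat.sub_add_cancel hj]
  rw [hsplit, h.measure_pastEvent_inter (hD j) (j + 1) hB hx₀] at hne
  have hconst : ∀ ρ, (pastEvent θ X (D j) (j + 1)).indicator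
      (fun ρ ↦ P (X (θ^[j + 1] ρ)) {ρ | X (θ^[n - (j + 1)] ρ) = x₀}) ρ =
      (pastEvent θ X (D j) (j + 1)).indicator
        (fun _ ↦ P x₀ {ρ | X (θ^[n - (j + 1)] ρ) = x₀}) ρ := by
    intro ρ
    by_cases hρ : ρ ∈ pastEvent θ X (D j) (j + 1)
    · rw [indicator_of_mem hρ, indicator_of_mem hρ, ((hfirst j ρ).1 hρ).2]
    · rw [indicator_of_notMem hρ, indicator_of_notMem hρ]
  rw [lintegral_congr hconst, lintegral_indicator_const (h.measurableSet_pastEvent (hD j) _)] at hne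
  have h1 : d ∣ j + 1 := by
    refine hd (j + 1) fun h0 ↦ right_ne_zero_of_mul hne (measure_mono_null (fun ρ hρ ↦ ?_) h0)
    obtain ⟨ha, hb⟩ := (hfirst j ρ).1 hρ
    refine le_antisymm (iInf₂_le (j + 1) ⟨by omega, hb⟩) ?_
    have : ρ ∈ taboo θ X x₀ j := fun i hi ↦ ha i hi
    rw [mem_taboo_iff_lt_returnTime] at this
    rw [Nat.cast_add, Nat.cast_one]
    exact Order.add_one_le_of_lt this
  have h2 : d ∣ n - (j + 1) := ih _ (by omega) (left_ne_zero_of_mul hne)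
  have := dvd_add h1 h2
  rwa [Nat.add_sub_cancel' hj] at this

/-! ### The stationary law -/

theorem lintegral_occupation {g : E → ENNReal} (hg : Measurable g) :
    ∫⁻ y, g y ∂occupation P θ X x₀ = ∑' k, ∫⁻ ρ in taboo θ X x₀ k, g (X (θ^[k] ρ)) ∂P x₀ := by
  rw [occupation, lintegral_sum_measure]
  exact tsum_congr fun k ↦ lintegral_map hg (h.measurable_iterate k)

/-- The occupation measure of a cycle is invariant. -/
theorem lintegral_occupation_shift (hx₀ : x₀ ∈ G)
    (hret : ∀ᵐ ρ ∂P x₀, returnTime θ X x₀ ρ ≠ ⊤) {g : E → ENNReal} (hg : Measurable g) :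
    ∫⁻ y, ∫⁻ ρ, g (X (θ ρ)) ∂P y ∂occupation P θ X x₀ = ∫⁻ y, g y ∂occupation P θ X x₀ := by
  have hT := fun k ↦ h.measurableSet_taboo (x₀ := x₀) k
  have hgθ : Measurable fun ρ ↦ g (X (θ ρ)) := hg.comp (h.measurable_iterate 1)
  rw [h.lintegral_occupation (Measurable.lintegral_kernel hgθ), h.lintegral_occupation hg]
  have hret1 : ∀ k, MeasurableSet {ρ | X (θ^[k + 1] ρ) = x₀} := fun k ↦
    h.measurable_iterate (k + 1) (measurableSet_singleton x₀)
  -- at time `k + 1` the chain has not returned yet, or it returns now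
  have hk : ∀ k, ∫⁻ ρ in taboo θ X x₀ k, ∫⁻ σ, g (X (θ σ)) ∂P (X (θ^[k] ρ)) ∂P x₀ =
      ∫⁻ ρ in taboo θ X x₀ (k + 1), g (X (θ^[k + 1] ρ)) ∂P x₀ +
        g x₀ * P x₀ (taboo θ X x₀ k ∩ {ρ | X (θ^[k + 1] ρ) = x₀}) := by
    intro k
    have h1 := h.lintegral_pastEvent hgθ k (fun _ ↦ (measurableSet_singleton x₀).compl) x₀ hx₀
    rw [← lintegral_indicator (hT k)]
    refine h1.symm.trans ?_
    change ∫⁻ ρ, (taboo θ X x₀ k).indicator _ ρ ∂P x₀ = _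
    rw [← lintegral_indicator (hT (k + 1)),
      ← lintegral_indicator_const ((hT k).inter (hret1 k))]
    refine Eq.trans (lintegral_congr fun ρ ↦ ?_) (lintegral_add_left
      ((hg.comp (h.measurable_iterate (k + 1))).indicator (hT (k + 1))) _)
    have ht : ρ ∈ taboo θ X x₀ (k + 1) ↔ ρ ∈ taboo θ X x₀ k ∧ X (θ^[k + 1] ρ) ≠ x₀ := by
      constructor
      · exact fun hρ ↦ ⟨fun i hi ↦ hρ i (by omega), hρ k (by omega)⟩
      · rintro ⟨ha, hb⟩ i hi
        rcases Nat.lt_succ_iff_lt_or_eq.1 hi with hi | rfl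
        exacts [ha i hi, hb]
    have hθ : θ (θ^[k] ρ) = θ^[k + 1] ρ := (Function.iterate_succ_apply' θ k ρ).symm
    by_cases ha : ρ ∈ taboo θ X x₀ k
    · by_cases hb : X (θ^[k + 1] ρ) = x₀
      · rw [indicator_of_mem ha, indicator_of_notMem (fun hc ↦ (ht.1 hc).2 hb),
          indicator_of_mem (show ρ ∈ taboo θ X x₀ k ∩ {ρ | X (θ^[k + 1] ρ) = x₀} from ⟨ha, hb⟩),
          zero_add, hθ, hb]
      · rw [indicator_of_mem ha, indicator_of_mem (ht.2 ⟨ha, hb⟩),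
          indicator_of_notMem (fun hc : ρ ∈ taboo θ X x₀ k ∩ {ρ | X (θ^[k + 1] ρ) = x₀} ↦ hb hc.2),
          add_zero, hθ]
        rfl
    · rw [indicator_of_notMem ha, indicator_of_notMem (fun hc ↦ ha (ht.1 hc).1),
        indicator_of_notMem (fun hc : ρ ∈ taboo θ X x₀ k ∩ {ρ | X (θ^[k + 1] ρ) = x₀} ↦ ha hc.1),
        add_zero]
  rw [tsum_congr hk, ENNReal.tsum_add, ENNReal.tsum_mul_left, add_comm]
  refine Eq.trans ?_ (tsum_eq_zero_add' (f := fun k ↦ ∫⁻ ρ in taboo θ X x₀ k, g (X (θ^[k] ρ)) ∂P x₀)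
    ENNReal.summable).symm
  congr 1
  have hone : ∑' k, P x₀ (taboo θ X x₀ k ∩ {ρ | X (θ^[k + 1] ρ) = x₀}) = 1 := by
    rw [← measure_iUnion _ fun k ↦ (hT k).inter (hret1 k)]
    · rw [← h.apply_univ x₀ hx₀]
      refine measure_congr (ae_eq_univ.2 (measure_mono_null (fun ρ hρ ↦ ?_) (ae_iff.1 hret)))
      intro hfin
      refine hρ ?_
      obtain ⟨N, hN⟩ := ENat.ne_top_iff_exists.1 hfin
      have hNpos : 1 ≤ N := by
        have : ρ ∈ taboo θ X x₀ 0 := fun i hi ↦ absurd hi (by omega)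
        rw [mem_taboo_iff_lt_returnTime, ← hN] at this
        exact_mod_cast this
      have h1 : ρ ∈ taboo θ X x₀ (N - 1) := by
        rw [mem_taboo_iff_lt_returnTime, ← hN, Nat.cast_lt]
        omega
      have h2 : ρ ∉ taboo θ X x₀ N := by
        rw [mem_taboo_iff_lt_returnTime, ← hN]
        exact lt_irrefl _
      refine mem_iUnion.2 ⟨N - 1, h1, ?_⟩
      by_contra hcon
      refine h2 fun i hi ↦ ?_
      rcases lt_or_eq_of_le (Nat.le_sub_one_of_lt hi) with hi' | rfl
      exacts [h1 i hi', hcon]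
    · have aux : ∀ i j, i < j → Disjoint (taboo θ X x₀ i ∩ {ρ | X (θ^[i + 1] ρ) = x₀})
          (taboo θ X x₀ j ∩ {ρ | X (θ^[j + 1] ρ) = x₀}) := fun i j hij ↦
        Set.disjoint_left.2 fun ρ h1 h2 ↦ h2.1 i hij h1.2
      intro i j hij
      rcases lt_or_gt_of_ne hij with hlt | hlt
      exacts [aux i j hlt, (aux j i hlt).symm]
  rw [hone, mul_one]
  have e : taboo θ X x₀ 0 = univ := eq_univ_of_forall fun ρ i hi ↦ absurd hi (by omega)
  rw [e, setLIntegral_univ, lintegral_congr_ae ((h.ae_state x₀ hx₀).mono fun ρ hρ ↦ by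
    simp [hρ] : (fun ρ ↦ g (X (θ^[0] ρ))) =ᵐ[P x₀] fun _ ↦ g x₀), lintegral_const,
    h.apply_univ x₀ hx₀, mul_one]

/-! ### Uniform convergence -/

/-- If `x₀` is reached in `n` steps with probability at least `δ` from everywhere, then the
oscillation of a transition probability decays geometrically. -/
theorem exists_bounds {n : ℕ} (hn : 1 ≤ n) (hx₀ : x₀ ∈ G) {δ : ℝ} (hδ1 : δ ≤ 1)
    (hmin : ∀ x ∈ G, δ ≤ (P x).real {ρ | X (θ^[n] ρ) = x₀}) {A : Set E} (hA : MeasurableSet A)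
    (k : ℕ) : ∃ lo hi : ℝ, hi - lo ≤ (1 - δ) ^ (k / n) ∧
      ∀ x ∈ G, lo ≤ (P x).real {ρ | X (θ^[k] ρ) ∈ A} ∧ (P x).real {ρ | X (θ^[k] ρ) ∈ A} ≤ hi := by
  induction k using Nat.strong_induction_on with
  | _ k ih =>
  rcases lt_or_ge k n with hk | hk
  · refine ⟨0, 1, by simp [Nat.div_eq_of_lt hk], fun x hx ↦ ?_⟩
    have := h.isProbabilityMeasure hx
    exact ⟨measureReal_nonneg, measureReal_le_one⟩
  obtain ⟨j, rfl⟩ := Nat.exists_eq_add_of_le' hk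
  obtain ⟨lo, hi, hosc, hb⟩ := ih j (by omega)
  have hB : MeasurableSet {ρ | X (θ^[j] ρ) ∈ A} := h.measurable_iterate j hA
  have hS : MeasurableSet {ρ | X (θ^[n] ρ) = x₀} :=
    h.measurable_iterate n (measurableSet_singleton x₀)
  let f : E → ℝ := fun x ↦ (P x).real {ρ | X (θ^[j] ρ) ∈ A}
  have hfm : Measurable f := (P.measurable_coe hB).ennreal_toReal
  have hfX : Measurable fun ρ ↦ f (X (θ^[n] ρ)) := hfm.comp (h.measurable_iterate n)
  refine ⟨lo + δ * (f x₀ - lo), hi - δ * (hi - f x₀), ?_, fun x hx ↦ ?_⟩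
  · rw [Nat.add_div_right _ hn, pow_succ]
    have : hi - δ * (hi - f x₀) - (lo + δ * (f x₀ - lo)) = (hi - lo) * (1 - δ) := by ring
    rw [this]
    exact mul_le_mul_of_nonneg_right hosc (by linarith)
  have := h.isProbabilityMeasure hx
  have hin := h.ae_iterate_mem n x hx
  have e : (P x).real {ρ | X (θ^[j + n] ρ) ∈ A} = ∫ ρ, f (X (θ^[n] ρ)) ∂P x := by
    have e1 : {ρ | X (θ^[j + n] ρ) ∈ A} = θ^[n] ⁻¹' {ρ | X (θ^[j] ρ) ∈ A} := by
      ext ρ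
      simp only [mem_preimage, mem_ofPred_eq, Function.iterate_add_apply]
    rw [e1, measureReal_def, h.measure_iterate_preimage n hB hx]
    refine (integral_toReal ?_ ?_).symm
    · exact ((P.measurable_coe hB).comp (h.measurable_iterate n)).aemeasurable
    · exact hin.mono fun ρ _ ↦ measure_lt_top _ _
  have hint : Integrable (fun ρ ↦ f (X (θ^[n] ρ))) (P x) := by
    refine Integrable.of_bound hfX.aestronglyMeasurable (max |lo| |hi|) (hin.mono fun ρ hρ ↦ ?_)
    exact abs_le_max_abs_abs (hb _ hρ).1 (hb _ hρ).2
  have hone : ∀ c : ℝ, ∫ ρ, {ρ | X (θ^[n] ρ) = x₀}.indicator (fun _ ↦ c) ρ ∂P x =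
      (P x).real {ρ | X (θ^[n] ρ) = x₀} * c := fun c ↦ by
    rw [integral_indicator_const _ hS, smul_eq_mul]
  have hii : ∀ c : ℝ, Integrable ({ρ | X (θ^[n] ρ) = x₀}.indicator fun _ ↦ c) (P x) := fun c ↦
    (integrable_const c).indicator hS
  have hb0 := hb x₀ hx₀
  rw [e]
  constructor
  · calc lo + δ * (f x₀ - lo) ≤ lo + (P x).real {ρ | X (θ^[n] ρ) = x₀} * (f x₀ - lo) := by
          have := mul_le_mul_of_nonneg_right (hmin x hx) (sub_nonneg.2 hb0.1)
          linarith
      _ = ∫ ρ, (lo + {ρ | X (θ^[n] ρ) = x₀}.indicator (fun _ ↦ f x₀ - lo) ρ) ∂P x := by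
          rw [integral_add (integrable_const _) (hii _), hone]
          simp
      _ ≤ ∫ ρ, f (X (θ^[n] ρ)) ∂P x := by
          refine integral_mono_ae ((integrable_const _).add (hii _)) hint (hin.mono fun ρ hρ ↦ ?_)
          by_cases hρ0 : X (θ^[n] ρ) = x₀
          · dsimp only
            rw [indicator_of_mem (show ρ ∈ {ρ | X (θ^[n] ρ) = x₀} from hρ0), hρ0]
            linarith
          · dsimp only
            rw [indicator_of_notMem (show ρ ∉ {ρ | X (θ^[n] ρ) = x₀} from hρ0), add_zero]
            exact (hb _ hρ).1
  · calc ∫ ρ, f (X (θ^[n] ρ)) ∂P x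
        ≤ ∫ ρ, (hi - {ρ | X (θ^[n] ρ) = x₀}.indicator (fun _ ↦ hi - f x₀) ρ) ∂P x := by
          refine integral_mono_ae hint ((integrable_const _).sub (hii _)) (hin.mono fun ρ hρ ↦ ?_)
          by_cases hρ0 : X (θ^[n] ρ) = x₀
          · dsimp only
            rw [indicator_of_mem (show ρ ∈ {ρ | X (θ^[n] ρ) = x₀} from hρ0), hρ0]
            linarith
          · dsimp only
            rw [indicator_of_notMem (show ρ ∉ {ρ | X (θ^[n] ρ) = x₀} from hρ0), sub_zero]
            exact (hb _ hρ).2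
      _ = hi - (P x).real {ρ | X (θ^[n] ρ) = x₀} * (hi - f x₀) := by
          rw [integral_sub (integrable_const _) (hii _), hone]
          simp
      _ ≤ hi - δ * (hi - f x₀) := by
          have := mul_le_mul_of_nonneg_right (hmin x hx) (sub_nonneg.2 hb0.2)
          linarith

end IsMarkovShift

end MarkovShift

/-! ### Moments from a geometric tail -/

section Tail

variable {Ω : Type*} [MeasurableSpace Ω] {μ : Measure Ω} [IsProbabilityMeasure μ]
  {N : Ω → ℕ∞} {n : ℕ} {q : ℝ}

theorem ae_ne_top_of_geometric_tail (hq0 : 0 < q) (hq1 : q < 1)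
    (htail : ∀ j : ℕ, μ {ω | ((j * n : ℕ) : ℕ∞) < N ω} ≤ ENNReal.ofReal (q ^ j)) :
    ∀ᵐ ω ∂μ, N ω ≠ ⊤ := by
  rw [ae_iff]
  have hle : ∀ j : ℕ, μ {ω | ¬ N ω ≠ ⊤} ≤ ENNReal.ofReal (q ^ j) := fun j ↦
    (measure_mono fun ω hω ↦ by
      simp only [ne_eq, not_not, mem_ofPred_eq] at hω ⊢
      rw [hω]
      exact ENat.natCast_lt_top _).trans (htail j)
  have hlim : Filter.Tendsto (fun j : ℕ ↦ ENNReal.ofReal (q ^ j)) Filter.atTop (nhds 0) := by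
    rw [← ENNReal.ofReal_zero]
    exact ENNReal.tendsto_ofReal (tendsto_pow_atTop_nhds_zero_of_lt_one hq0.le hq1)
  exact le_antisymm (ge_of_tendsto' hlim hle) zero_le

theorem exists_integrable_exp_of_geometric_tail (hn : 1 ≤ n) (hq0 : 0 < q) (hq1 : q < 1)
    (hNm : Measurable N) (hN1 : ∀ ω, 1 ≤ N ω)
    (htail : ∀ j : ℕ, μ {ω | ((j * n : ℕ) : ℕ∞) < N ω} ≤ ENNReal.ofReal (q ^ j)) :
    ∃ δ : ℝ, 0 < δ ∧ ∀ t : ℝ, |t| < δ →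
      Integrable (fun ω ↦ Real.exp (t * ((N ω).toNat : ℝ))) μ := by
  have hn0 : (0 : ℝ) < n := by exact_mod_cast hn
  have hm : ∀ t : ℝ, Measurable fun ω ↦ Real.exp (t * ((N ω).toNat : ℝ)) := fun t ↦ by
    have : Measurable fun ω ↦ ((N ω).toNat : ℝ) :=
      (measurable_of_countable fun k : ℕ∞ ↦ ((k.toNat : ℕ) : ℝ)).comp hNm
    fun_prop
  refine ⟨-Real.log q / n, div_pos (neg_pos.2 (Real.log_neg hq0 hq1)) hn0, fun t ht ↦ ?_⟩
  rcases le_or_gt t 0 with ht0 | ht0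
  · refine Integrable.of_bound (hm t).aestronglyMeasurable 1
      (Filter.Eventually.of_forall fun ω ↦ ?_)
    rw [Real.norm_eq_abs, abs_of_pos (Real.exp_pos _), Real.exp_le_one_iff]
    exact mul_nonpos_of_nonpos_of_nonneg ht0 (Nat.cast_nonneg _)
  rw [abs_of_pos ht0, lt_div_iff₀ hn0] at ht
  -- the ratio of the geometric series that dominates the exponential moment
  let r : ℝ := Real.exp (t * n) * q
  have hr0 : 0 < r := mul_pos (Real.exp_pos _) hq0
  have hr1 : r < 1 := by
    have : Real.exp (t * n) < q⁻¹ := by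
      rw [← Real.exp_log hq0, ← Real.exp_neg]
      exact Real.exp_lt_exp.2 ht
    calc r < q⁻¹ * q := mul_lt_mul_of_pos_right this hq0
      _ = 1 := inv_mul_cancel₀ hq0.ne'
  refine ⟨(hm t).aestronglyMeasurable, ?_⟩
  rw [hasFiniteIntegral_iff_ofReal (Filter.Eventually.of_forall fun ω ↦ (Real.exp_pos _).le)]
  have hset : ∀ j : ℕ, MeasurableSet {ω | ((j * n : ℕ) : ℕ∞) < N ω} := fun j ↦
    hNm (MeasurableSet.of_discrete (s := {k : ℕ∞ | ((j * n : ℕ) : ℕ∞) < k}))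
  have hbound : ∀ᵐ ω ∂μ, ENNReal.ofReal (Real.exp (t * ((N ω).toNat : ℝ))) ≤
      ∑' j : ℕ, {ω | ((j * n : ℕ) : ℕ∞) < N ω}.indicator
        (fun _ ↦ ENNReal.ofReal (Real.exp (t * ((j + 1) * n)))) ω := by
    filter_upwards [ae_ne_top_of_geometric_tail hq0 hq1 htail] with ω hω
    obtain ⟨k, hk⟩ := ENat.ne_top_iff_exists.1 hω
    have hk1 : 1 ≤ k := by
      have := hN1 ω
      rw [← hk] at this
      exact_mod_cast this
    -- the `j` with `j n < k ≤ (j + 1) n`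
    refine le_trans ?_ (ENNReal.le_tsum ((k - 1) / n))
    have hlt : (k - 1) / n * n < k := (Nat.div_mul_le_self _ _).trans_lt (by omega)
    have hle : k ≤ ((k - 1) / n + 1) * n := by
      have := Nat.lt_mul_of_div_lt (Nat.lt_succ_self ((k - 1) / n)) (by omega : 0 < n)
      rw [Nat.succ_eq_add_one] at this
      exact Nat.le_of_pred_lt this
    rw [indicator_of_mem (by rw [mem_ofPred_eq, ← hk]; exact_mod_cast hlt), ← hk,
      ENat.toNat_natCast]
    refine ENNReal.ofReal_le_ofReal (Real.exp_le_exp.2 ?_)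
    have : (k : ℝ) ≤ (((k - 1) / n : ℕ) + 1) * n := by exact_mod_cast hle
    exact mul_le_mul_of_nonneg_left this ht0.le
  refine (lintegral_mono_ae hbound).trans_lt ?_
  rw [lintegral_tsum fun j ↦ (measurable_const.indicator (hset j)).aemeasurable]
  have hterm : ∀ j : ℕ, ∫⁻ ω, {ω | ((j * n : ℕ) : ℕ∞) < N ω}.indicator
      (fun _ ↦ ENNReal.ofReal (Real.exp (t * ((j + 1) * n)))) ω ∂μ ≤
      ENNReal.ofReal (Real.exp (t * n) * r ^ j) := by
    intro j
    rw [lintegral_indicator_const (hset j)]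
    refine (mul_le_mul' le_rfl (htail j)).trans (le_of_eq ?_)
    rw [← ENNReal.ofReal_mul (Real.exp_pos _).le, mul_pow, ← Real.exp_nat_mul,
      ← mul_assoc (Real.exp _), ← Real.exp_add]
    congr 3
    ring
  refine (ENNReal.tsum_le_tsum hterm).trans_lt ?_
  rw [← ENNReal.ofReal_tsum_of_nonneg (fun j ↦ by positivity)
    ((summable_geometric_of_lt_one hr0.le hr1).mul_left _)]
  exact ENNReal.ofReal_lt_top

theorem lintegral_rpow_lt_top_of_exp (hfin : ∀ᵐ ω ∂μ, N ω ≠ ⊤) {δ : ℝ}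
    (hδ : 0 < δ) (hexp : ∀ t : ℝ, |t| < δ →
      Integrable (fun ω ↦ Real.exp (t * ((N ω).toNat : ℝ))) μ) {a : ℝ} (ha : 0 < a) :
    ∫⁻ ω, ((N ω : ℕ∞) : ENNReal) ^ a ∂μ < ⊤ := by
  have h0 : (0 : ℝ) ∈ interior (integrableExpSet (fun ω ↦ ((N ω).toNat : ℝ)) μ) := by
    rw [mem_interior]
    refine ⟨Metric.ball 0 δ, fun t ht ↦ hexp t ?_, Metric.isOpen_ball, Metric.mem_ball_self hδ⟩
    simpa using ht
  have hint := integrable_rpow_abs_of_mem_interior_integrableExpSet h0 ha.le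
  have h1 := hint.2
  rw [hasFiniteIntegral_iff_ofReal (Filter.Eventually.of_forall fun ω ↦ by positivity)] at h1
  refine lt_of_le_of_lt (lintegral_mono_ae (hfin.mono fun ω hω ↦ ?_)) h1
  obtain ⟨k, hk⟩ := ENat.ne_top_iff_exists.1 hω
  rw [← hk, ENat.toNat_natCast, Nat.abs_cast,
    ← ENNReal.ofReal_rpow_of_nonneg (Nat.cast_nonneg _) ha.le, ENNReal.ofReal_natCast]
  simp

end Tail

/-! ### The length of a cycle -/

section ReturnTime

variable {E Ω : Type*}

theorem tsum_indicator_lt (n : ℕ∞) :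
    ∑' k : ℕ, (Iio n).indicator (1 : ℕ∞ → ENNReal) k = (n : ENNReal) := by
  induction n using ENat.recTopCoe with
  | top =>
    have e : ∀ k : ℕ, (Iio ⊤).indicator (1 : ℕ∞ → ENNReal) k = 1 := fun k ↦
      indicator_of_mem (mem_Iio.2 (ENat.natCast_lt_top k)) _
    simp only [e]
    rw [ENNReal.tsum_const_eq_top_of_ne_zero one_ne_zero]
    rfl
  | coe n =>
    rw [tsum_eq_sum (s := Finset.range n)]
    · have e : ∀ k ∈ Finset.range n, (Iio (n : ℕ∞)).indicator (1 : ℕ∞ → ENNReal) k = 1 :=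
        fun k hk ↦ indicator_of_mem
          (mem_Iio.2 (ENat.natCast_lt_natCast.2 (Finset.mem_range.1 hk))) _
      rw [Finset.sum_congr rfl e]
      simp
    · exact fun k hk ↦ indicator_of_notMem (fun h ↦
        hk (Finset.mem_range.2 (ENat.natCast_lt_natCast.1 (mem_Iio.1 h)))) _

theorem one_le_returnTime (θ : Ω → Ω) (X : Ω → E) (x₀ : E) (ρ : Ω) :
    1 ≤ returnTime θ X x₀ ρ :=
  le_iInf₂ fun k hk ↦ by exact_mod_cast hk.1

namespace IsMarkovShift

variable [MeasurableSpace E] [MeasurableSpace Ω] [MeasurableSingletonClass E]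
  {P : Kernel E Ω} [IsFiniteKernel P] {θ : Ω → Ω} {X : Ω → E} {G : Set E} {x₀ : E}

theorem measurable_returnTime (h : IsMarkovShift P θ X G) : Measurable (returnTime θ X x₀) := by
  refine measurable_to_countable' fun y ↦ ?_
  have e : returnTime θ X x₀ ⁻¹' {y} =
      ⋂ k : ℕ, {ρ | (k : ℕ∞) < returnTime θ X x₀ ρ ↔ (k : ℕ∞) < y} := by
    ext ρ
    simp only [mem_preimage, mem_singleton_iff, mem_iInter, mem_ofPred_eq]
    refine ⟨fun h _ ↦ h ▸ Iff.rfl, fun h ↦ ?_⟩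
    by_contra hne
    rcases lt_or_gt_of_ne hne with hlt | hlt
    · obtain ⟨k, hk⟩ := ENat.ne_top_iff_exists.1 hlt.ne_top
      exact lt_irrefl _ (hk ▸ (h k).2 (hk ▸ hlt))
    · obtain ⟨k, hk⟩ := ENat.ne_top_iff_exists.1 hlt.ne_top
      exact lt_irrefl _ (hk ▸ (h k).1 (hk ▸ hlt))
  rw [e]
  refine MeasurableSet.iInter fun k ↦ ?_
  have hT : MeasurableSet {ρ | (k : ℕ∞) < returnTime θ X x₀ ρ} := by
    have := h.measurableSet_taboo (x₀ := x₀) k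
    rwa [show taboo θ X x₀ k = {ρ | (k : ℕ∞) < returnTime θ X x₀ ρ} from
      ext fun _ ↦ mem_taboo_iff_lt_returnTime] at this
  by_cases hk : (k : ℕ∞) < y
  · simpa only [hk, iff_true] using hT
  · simp only [hk, iff_false]
    exact hT.compl

end IsMarkovShift

end ReturnTime

/-! ### Splitting off the first row of an i.i.d. array -/

section Split

variable {S X : Type*} [MeasurableSpace X] (μ : S → Measure X) [∀ s, IsProbabilityMeasure (μ s)]

/-- If the law of an independent array `a (n, s)` does not depend on `n`, then the first row is
independent of the remaining rows, which again form such an array. -/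
theorem measurePreserving_splitRow :
    MeasurePreserving (fun a : ℕ × S → X ↦ ((fun s ↦ a (0, s)), fun q : ℕ × S ↦ a (q.1 + 1, q.2)))
      (Measure.infinitePi fun q : ℕ × S ↦ μ q.2)
      ((Measure.infinitePi μ).prod (Measure.infinitePi fun q : ℕ × S ↦ μ q.2)) := by
  have hm : Measurable
      (fun a : ℕ × S → X ↦ ((fun s ↦ a (0, s)), fun q : ℕ × S ↦ a (q.1 + 1, q.2))) := by fun_prop
  let merge : (S → X) × (ℕ × S → X) → (ℕ × S → X) := fun z q ↦
    match q with
    | (0, s) => z.1 s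
    | (n + 1, s) => z.2 (n, s)
  have hmerge : Measurable merge := by
    refine measurable_pi_lambda _ fun q ↦ ?_
    obtain ⟨_ | n, s⟩ := q
    · exact (measurable_pi_apply s).comp measurable_fst
    · exact (measurable_pi_apply (n, s)).comp measurable_snd
  have key : ((Measure.infinitePi μ).prod (Measure.infinitePi fun q : ℕ × S ↦ μ q.2)).map merge
      = Measure.infinitePi fun q : ℕ × S ↦ μ q.2 := by
    refine Measure.eq_infinitePi _ fun F t ht ↦ ?_
    classical
    have i0 : Function.Injective (fun s : S ↦ ((0 : ℕ), s)) := fun a b h ↦ (Prod.mk.inj h).2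
    have i1 : Function.Injective (fun q : ℕ × S ↦ (q.1 + 1, q.2)) := fun a b h ↦ by
      obtain ⟨h1, h2⟩ := Prod.mk.inj h
      exact Prod.ext (Nat.succ_injective h1) h2
    let F0 := F.preimage (fun s : S ↦ ((0 : ℕ), s)) i0.injOn
    let F1 := F.preimage (fun q : ℕ × S ↦ (q.1 + 1, q.2)) i1.injOn
    have hpre : merge ⁻¹' (Set.pi F t) =
        (Set.pi F0 fun s ↦ t (0, s)) ×ˢ (Set.pi F1 fun q ↦ t (q.1 + 1, q.2)) := by
      ext ⟨r, a⟩
      simp only [mem_preimage, Set.mem_pi, mem_prod, F0, F1, Finset.mem_coe, Finset.mem_preimage]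
      constructor
      · exact fun h ↦ ⟨fun s hs ↦ h (0, s) hs, fun q hq ↦ h (q.1 + 1, q.2) hq⟩
      · rintro ⟨h0, h1⟩ ⟨_ | n, s⟩ hq
        · exact h0 s hq
        · exact h1 (n, s) hq
    rw [Measure.map_apply hmerge (.pi F.countable_toSet fun q _ ↦ ht q), hpre, Measure.prod_prod,
      Measure.infinitePi_pi _ fun s _ ↦ ht _, Measure.infinitePi_pi _ fun q _ ↦ ht _]
    rw [Finset.prod_preimage' (fun s : S ↦ ((0 : ℕ), s)) F i0.injOn (fun q ↦ μ q.2 (t q)),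
      Finset.prod_preimage' (fun q : ℕ × S ↦ (q.1 + 1, q.2)) F i1.injOn (fun q ↦ μ q.2 (t q)),
      ← Finset.prod_filter_mul_prod_filter_not F (fun q ↦ q ∈ range fun s : S ↦ ((0 : ℕ), s))]
    congr 1
    refine Finset.prod_congr (Finset.filter_congr fun q _ ↦ ?_) fun _ _ ↦ rfl
    obtain ⟨_ | n, s⟩ := q <;> simp
  refine ⟨hm, ?_⟩
  conv_lhs => rw [← key]
  rw [Measure.map_map hm hmerge]
  exact Measure.map_id

end Split

namespace OnOffTCP

variable {ι : Type*} [Fintype ι] (m : OnOffTCP ι)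

/-! ### The law of the future channel states -/

/-- Prefix a sequence by one term. -/
def seqCons {β : Type*} (z : β) (w : ℕ → β) : ℕ → β
  | 0 => z
  | n + 1 => w n

theorem measurable_seqCons {β : Type*} [MeasurableSpace β] :
    Measurable fun p : β × (ℕ → β) ↦ seqCons p.1 p.2 := by
  refine measurable_pi_lambda _ fun n ↦ ?_
  cases n with
  | zero => exact measurable_fst
  | succ n => exact (measurable_pi_apply n).comp measurable_snd

/-- The channel states visited after `s`, with their sojourn times, when the array `a` of
sojourn times and successors is used. -/
def future (s : Option ι) (a : ℕ × Option ι → ℝ × Option ι) : ℕ → Option ι × ℝ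
  | 0 => ((a (0, s)).2, (a (1, (a (0, s)).2)).1)
  | n + 1 => ((a (n + 1, (future s a n).1)).2, (a (n + 2, (a (n + 1, (future s a n).1)).2)).1)

/-- The law of the array of sojourn times and successors. -/
noncomputable def arrayLaw : Measure (ℕ × Option ι → ℝ × Option ι) :=
  Measure.infinitePi fun q : ℕ × Option ι ↦ (m.sojournLaw q.2).prod (m.jumpLaw q.2)

instance : IsProbabilityMeasure m.arrayLaw := by unfold arrayLaw; infer_instance

theorem measurable_eval_countable {α β κ : Type*} [MeasurableSpace α] [MeasurableSpace β]
    [MeasurableSpace κ] [Countable κ] [DiscreteMeasurableSpace κ] {f : α → κ} {g : κ → α → β}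
    (hf : Measurable f) (hg : ∀ i, Measurable (g i)) : Measurable fun x ↦ g (f x) x := by
  have h : Measurable fun p : κ × α ↦ g p.1 p.2 := measurable_from_prod_countable_right hg
  exact h.comp (hf.prodMk measurable_id)

theorem measurable_future (s : Option ι) : Measurable (future s) := by
  have h2 : ∀ (n : ℕ) (f : (ℕ × Option ι → ℝ × Option ι) → Option ι), Measurable f →
      Measurable fun a : ℕ × Option ι → ℝ × Option ι ↦ (a (n, f a)).2 := fun n f hf ↦
    measurable_eval_countable (g := fun i a ↦ (a (n, i)).2) hf fun i ↦
      measurable_snd.comp (measurable_pi_apply _)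
  have h1 : ∀ (n : ℕ) (f : (ℕ × Option ι → ℝ × Option ι) → Option ι), Measurable f →
      Measurable fun a : ℕ × Option ι → ℝ × Option ι ↦ (a (n, f a)).1 := fun n f hf ↦
    measurable_eval_countable (g := fun i a ↦ (a (n, i)).1) hf fun i ↦
      measurable_fst.comp (measurable_pi_apply _)
  refine measurable_pi_lambda _ fun n ↦ ?_
  induction n with
  | zero => exact (h2 0 _ measurable_const).prodMk (h1 1 _ (h2 0 _ measurable_const))
  | succ n ih => exact (h2 _ _ ih.fst).prodMk (h1 _ _ (h2 _ _ ih.fst))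

theorem visited_sojourn_succ (ω : Sample ι) (n : ℕ) :
    (visited ω (n + 1), sojourn ω (n + 1)) = future ω.1.1.1 ω.2.1 n := by
  have h : ∀ n, visited ω (n + 1) = (future ω.1.1.1 ω.2.1 n).1 := by
    intro n
    induction n with
    | zero => rfl
    | succ n ih =>
      change (ω.2.1 (n + 1, visited ω (n + 1))).2 = _
      rw [ih]
      rfl
  refine Prod.ext (h n) ?_
  change (ω.2.1 (n + 1, visited ω (n + 1))).1 = _
  rw [h n]
  cases n <;> rfl

/-- After the first jump the future is that of the state entered, read off the remaining rows. -/
theorem future_eq_seqCons (s : Option ι) (a : ℕ × Option ι → ℝ × Option ι) :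
    future s a = seqCons ((a (0, s)).2, (a (1, (a (0, s)).2)).1)
      (future (a (0, s)).2 fun q ↦ a (q.1 + 1, q.2)) := by
  funext n
  cases n with
  | zero => rfl
  | succ n =>
    change _ = future (a (0, s)).2 (fun q ↦ a (q.1 + 1, q.2)) n
    induction n with
    | zero => rfl
    | succ n ih =>
      rw [future, ih]
      rfl

/-- The law of the future of a channel state. -/
noncomputable def futureLaw : Kernel (Option ι) (ℕ → Option ι × ℝ) where
  toFun s := m.arrayLaw.map (future s)
  measurable' := measurable_of_countable _

theorem futureLaw_apply (s : Option ι) : m.futureLaw s = m.arrayLaw.map (future s) := rfl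

instance : IsMarkovKernel m.futureLaw :=
  ⟨fun s ↦ Measure.isProbabilityMeasure_map (measurable_future s).aemeasurable⟩

theorem lintegral_arrayLaw_split (s : Option ι)
    {G : ℝ × Option ι → (ℕ × Option ι → ℝ × Option ι) → ENNReal}
    (hG : Measurable (Function.uncurry G)) :
    ∫⁻ a, G (a (0, s)) (fun q ↦ a (q.1 + 1, q.2)) ∂m.arrayLaw =
      ∫⁻ r, ∫⁻ s', ∫⁻ a, G (r, s') a ∂m.arrayLaw ∂m.jumpLaw s ∂m.sojournLaw s := by
  have h := measurePreserving_splitRow fun s ↦ (m.sojournLaw s).prod (m.jumpLaw s)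
  have h2 := (measurePreserving_eval_infinitePi
    (fun s ↦ (m.sojournLaw s).prod (m.jumpLaw s)) s).prod
    (MeasurePreserving.id (Measure.infinitePi fun q : ℕ × Option ι ↦
      (m.sojournLaw q.2).prod (m.jumpLaw q.2)))
  have h3 := (h2.comp h).lintegral_comp hG
  refine h3.trans ?_
  rw [lintegral_prod _ hG.aemeasurable, lintegral_prod]
  · rfl
  · exact (Measurable.lintegral_prod_right hG).aemeasurable

/-- First step analysis of the future: a jump, a sojourn in the state entered, and then the
future of that state. -/
theorem lintegral_futureLaw (s : Option ι) {F : (ℕ → Option ι × ℝ) → ENNReal} (hF : Measurable F) :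
    ∫⁻ w, F w ∂m.futureLaw s = ∫⁻ s', ∫⁻ r, ∫⁻ w, F (seqCons (s', r) w)
      ∂m.futureLaw s' ∂m.sojournLaw s' ∂m.jumpLaw s := by
  have hfm : Measurable fun p : Option ι × (ℕ × Option ι → ℝ × Option ι) ↦ future p.1 p.2 :=
    measurable_from_prod_countable_right fun s ↦ measurable_future s
  -- the sequence that starts with the sojourn in `s'` itself, read off row `0`
  let fresh : Option ι → (ℕ × Option ι → ℝ × Option ι) → ℕ → Option ι × ℝ :=
    fun s' a ↦ seqCons (s', (a (0, s')).1) (future s' a)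
  have hfr : Measurable fun p : Option ι × (ℕ × Option ι → ℝ × Option ι) ↦ fresh p.1 p.2 :=
    measurable_from_prod_countable_right fun s' ↦ by
      have h1 : Measurable fun a : ℕ × Option ι → ℝ × Option ι ↦ (a (0, s')).1 :=
        measurable_fst.comp (measurable_pi_apply _)
      exact measurable_seqCons.comp ((measurable_const.prodMk h1).prodMk (measurable_future s'))
  have hff : ∀ s a, future s a = fresh (a (0, s)).2 fun q ↦ a (q.1 + 1, q.2) :=
    fun s a ↦ future_eq_seqCons s a
  have one : ∀ (s : Option ι) {F : (ℕ → Option ι × ℝ) → ENNReal}, Measurable F →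
      ∫⁻ w, F w ∂m.futureLaw s = ∫⁻ s', ∫⁻ a, F (fresh s' a) ∂m.arrayLaw ∂m.jumpLaw s := by
    intro s F hF
    rw [futureLaw_apply, lintegral_map hF (measurable_future s)]
    simp_rw [hff s]
    have := m.lintegral_arrayLaw_split s (G := fun z a ↦ F (fresh z.2 a))
      (hF.comp (hfr.comp (measurable_fst.snd.prodMk measurable_snd)))
    rw [this]
    dsimp only
    rw [lintegral_const, measure_univ, mul_one]
  rw [one s hF]
  refine lintegral_congr fun s' ↦ ?_
  have h1 : ∀ a, fresh s' a = seqCons (s', (a (0, s')).1)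
      (fresh (a (0, s')).2 fun q ↦ a (q.1 + 1, q.2)) := fun a ↦ by rw [← hff]
  simp_rw [h1]
  rw [m.lintegral_arrayLaw_split s' (G := fun z a ↦ F (seqCons (s', z.1) (fresh z.2 a)))]
  · refine lintegral_congr fun r ↦ ?_
    rw [one s' (F := fun w ↦ F (seqCons (s', r) w))]
    exact hF.comp (measurable_seqCons.comp (measurable_const.prodMk measurable_id))
  · exact hF.comp (measurable_seqCons.comp ((measurable_const.prodMk measurable_fst.fst).prodMk
      (hfr.comp (measurable_fst.snd.prodMk measurable_snd))))

/-! ### Sojourn times -/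

theorem expMeasure_Iic {r : ℝ} (hr : 0 < r) (t : ℝ) :
    expMeasure r (Iic t) = ENNReal.ofReal (if 0 ≤ t then 1 - Real.exp (-(r * t)) else 0) := by
  have := isProbabilityMeasure_expMeasure hr
  rw [← ofReal_cdf, cdf_expMeasure_eq hr]

theorem expMeasure_Ioi {r : ℝ} (hr : 0 < r) {t : ℝ} (ht : 0 ≤ t) :
    expMeasure r (Ioi t) = ENNReal.ofReal (Real.exp (-(r * t))) := by
  have := isProbabilityMeasure_expMeasure hr
  have h0 : Real.exp (-(r * t)) ≤ 1 := Real.exp_le_one_iff.2 (by nlinarith)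
  rw [← compl_Iic, prob_compl_eq_one_sub measurableSet_Iic, expMeasure_Iic hr, if_pos ht,
    ← ENNReal.ofReal_one, ← ENNReal.ofReal_sub _ (by linarith)]
  congr 1
  ring

theorem ae_pos_expMeasure {r : ℝ} (hr : 0 < r) : ∀ᵐ x ∂expMeasure r, 0 < x := by
  rw [ae_iff]
  simp only [not_lt]
  change expMeasure r (Iic 0) = 0
  rw [expMeasure_Iic hr]
  simp

theorem expMeasure_ne_zero {r : ℝ} (hr : 0 < r) {B : Set ℝ} (hB : MeasurableSet B)
    (hpos : volume (B ∩ Ioi 0) ≠ 0) : expMeasure r B ≠ 0 := by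
  intro h
  apply hpos
  have e : expMeasure r = volume.withDensity (exponentialPDF r) := rfl
  have hm : Measurable (exponentialPDF r) := (measurable_exponentialPDFReal r).ennreal_ofReal
  rw [e, withDensity_apply _ hB, lintegral_eq_zero_iff hm,
    Filter.EventuallyEq, ae_restrict_iff' hB] at h
  refine measure_mono_null (fun x hx ↦ ?_) h
  simp only [mem_compl_iff, mem_ofPred_eq, Classical.not_imp]
  refine ⟨hx.1, ?_⟩
  have := exponentialPDFReal_pos hr hx.2
  simpa [exponentialPDF] using this

/-- The exponential law has no memory. -/
theorem setLIntegral_expMeasure_sub {r : ℝ} (hr : 0 < r) {t : ℝ} (ht : 0 ≤ t) {f : ℝ → ENNReal}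
    (hf : Measurable f) : ∫⁻ x in Ioi t, f (x - t) ∂expMeasure r =
      expMeasure r (Ioi t) * ∫⁻ x, f x ∂expMeasure r := by
  have := isProbabilityMeasure_expMeasure hr
  have hm : Measurable fun x : ℝ ↦ x - t := measurable_id.sub_const t
  have key : ((expMeasure r).restrict (Ioi t)).map (fun x ↦ x - t) =
      expMeasure r (Ioi t) • expMeasure r := by
    refine Measure.ext_of_Ici _ _ fun a ↦ ?_
    have hns : ∀ b, expMeasure r {b} = 0 := fun b ↦
      (withDensity_absolutelyContinuous volume (exponentialPDF r)) (by simp)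
    have hci : ∀ b, expMeasure r (Ici b) = expMeasure r (Ioi b) := fun b ↦ by
      refine le_antisymm ?_ (measure_mono Ioi_subset_Ici_self)
      rw [← Ioi_union_left]
      exact (measure_union_le _ _).trans (by rw [hns b, add_zero])
    rw [Measure.map_apply hm measurableSet_Ici, Measure.restrict_apply (hm measurableSet_Ici),
      Measure.smul_apply, smul_eq_mul, hci]
    rcases le_or_gt 0 a with ha | ha
    · have : (fun x : ℝ ↦ x - t) ⁻¹' Ici a ∩ Ioi t ⊆ Ici (a + t) := by
        rintro x ⟨h1, -⟩
        simp only [mem_preimage, mem_Ici] at h1 ⊢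
        linarith
      have h2 : Ioi (a + t) ⊆ (fun x : ℝ ↦ x - t) ⁻¹' Ici a ∩ Ioi t := by
        intro x hx
        simp only [mem_preimage, mem_Ici, mem_inter_iff, mem_Ioi] at hx ⊢
        constructor <;> linarith
      have h3 : expMeasure r ((fun x : ℝ ↦ x - t) ⁻¹' Ici a ∩ Ioi t) =
          expMeasure r (Ioi (a + t)) :=
        le_antisymm ((measure_mono this).trans (hci _).le) (measure_mono h2)
      rw [h3, expMeasure_Ioi hr (by positivity), expMeasure_Ioi hr ht, expMeasure_Ioi hr ha,
        ← ENNReal.ofReal_mul (Real.exp_pos _).le, ← Real.exp_add]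
      congr 2
      ring
    · have h1 : (fun x : ℝ ↦ x - t) ⁻¹' Ici a ∩ Ioi t = Ioi t := by
        refine inter_eq_right.2 fun x hx ↦ ?_
        simp only [mem_preimage, mem_Ici, mem_Ioi] at hx ⊢
        linarith
      have h2 : expMeasure r (Ioi a) = 1 := by
        rw [prob_compl_eq_zero_iff measurableSet_Ioi |>.symm.trans (by rw [compl_Ioi]),
          expMeasure_Iic hr, if_neg (not_le.2 ha), ENNReal.ofReal_zero]
      rw [h1, h2, mul_one]
  rw [← lintegral_map hf hm, key, lintegral_smul_measure, smul_eq_mul]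

theorem sojournLaw_some (i : ι) : m.sojournLaw (some i) = expMeasure (m.rate i) := rfl

theorem sojournLaw_none : m.sojournLaw none = m.ν := rfl

theorem ae_nonneg_sojournLaw (s : Option ι) : ∀ᵐ r ∂m.sojournLaw s, 0 ≤ r := by
  cases s with
  | none =>
    rw [sojournLaw_none, ae_iff]
    simp only [not_le]
    exact m.off_nonneg
  | some i => exact (ae_pos_expMeasure (m.rate_pos i)).mono fun _ h ↦ h.le

theorem jumpLaw_none_none : m.jumpLaw none {none} = 0 := by
  change (m.α.map some).toMeasure {none} = 0
  rw [PMF.toMeasure_apply_eq_zero_iff _ (measurableSet_singleton _)]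
  rw [Set.disjoint_left]
  rintro _ h rfl
  simp at h

theorem ae_jumpLaw_none : ∀ᵐ s ∂m.jumpLaw none, s ≠ none := by
  rw [ae_iff]
  simpa using m.jumpLaw_none_none

theorem jumpLaw_some_ne_zero {i : ι} {b : Option ι} (hb : 0 < m.Q (some i) b) :
    m.jumpLaw (some i) {b} ≠ 0 := by
  change (m.phaseJump i).toMeasure {b} ≠ 0
  have hne : b ≠ some i := by
    rintro rfl
    have := m.rate_pos i
    unfold rate at this
    linarith
  rw [PMF.toMeasure_apply_singleton _ _ (measurableSet_singleton _), phaseJump, PMF.ofFintype_apply,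
    if_neg hne]
  simpa using div_pos hb (m.rate_pos i)

/-! ### The channel makes finitely many jumps in finite time -/

theorem ae_futureLaw_of_step {s : Option ι} {p : (ℕ → Option ι × ℝ) → Prop}
    (hp : MeasurableSet {w | p w})
    (h : ∀ s', ∀ᵐ r ∂m.sojournLaw s', ∀ᵐ w ∂m.futureLaw s', p (seqCons (s', r) w)) :
    ∀ᵐ w ∂m.futureLaw s, p w := by
  rw [ae_iff]
  change m.futureLaw s {w | p w}ᶜ = 0
  rw [← lintegral_indicator_one hp.compl,
    m.lintegral_futureLaw s (measurable_one.indicator hp.compl)]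
  refine (lintegral_congr fun s' ↦ ?_).trans lintegral_zero
  refine (lintegral_congr_ae ((h s').mono fun r hr ↦ ?_)).trans lintegral_zero
  refine (lintegral_congr_ae (hr.mono fun w hw ↦ ?_)).trans lintegral_zero
  rw [indicator_of_notMem]
  simpa using hw

theorem ae_futureLaw_nonneg (s : Option ι) : ∀ᵐ w ∂m.futureLaw s, ∀ n, 0 ≤ (w n).2 := by
  rw [ae_all_iff]
  intro n
  have hms : ∀ n, MeasurableSet {w : ℕ → Option ι × ℝ | 0 ≤ (w n).2} := fun n ↦
    measurableSet_le measurable_const (measurable_snd.comp (measurable_pi_apply n))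
  induction n generalizing s with
  | zero =>
    refine m.ae_futureLaw_of_step (hms 0) fun s' ↦ (m.ae_nonneg_sojournLaw s').mono fun r hr ↦ ?_
    exact Filter.Eventually.of_forall fun w ↦ hr
  | succ n ih =>
    exact m.ae_futureLaw_of_step (hms _) fun s' ↦ Filter.Eventually.of_forall fun r ↦ ih s'

/-- The Laplace transform at `1` of the sojourn time in an ON phase is less than `1`. -/
theorem lintegral_exp_neg_sojourn_lt_one (i : ι) :
    ∫⁻ r, ENNReal.ofReal (Real.exp (-r)) ∂m.sojournLaw (some i) < 1 := by
  have hpos := ae_pos_expMeasure (m.rate_pos i)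
  have h1 : (1 : ENNReal) = ∫⁻ _, 1 ∂m.sojournLaw (some i) := by simp
  rw [h1]
  have hlt : ∀ᵐ r ∂m.sojournLaw (some i), ENNReal.ofReal (Real.exp (-r)) < 1 :=
    hpos.mono fun r hr ↦ by
      rw [← ENNReal.ofReal_one]
      exact (ENNReal.ofReal_lt_ofReal_iff one_pos).2 (by rw [Real.exp_lt_one_iff]; linarith)
  refine lintegral_strict_mono (IsProbabilityMeasure.ne_zero _) (by fun_prop) ?_ hlt
  refine ne_top_of_le_ne_top ENNReal.one_ne_top ?_
  calc _ ≤ ∫⁻ _, 1 ∂m.sojournLaw (some i) := lintegral_mono_ae (hlt.mono fun _ h ↦ h.le)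
    _ = 1 := by simp

/-- The total time `T` the channel spends in the states it will visit is infinite: otherwise
`E [exp (-T)]` would be positive for some initial state, while each ON period passed on the way
reduces this expectation by a factor less than `1`. -/
theorem ae_futureLaw_unbounded (s : Option ι) :
    ∀ᵐ w ∂m.futureLaw s, ∀ t : ℝ, ∃ n, t < ∑ l ∈ Finset.range n, (w l).2 := by
  let T : ℕ → (ℕ → Option ι × ℝ) → ENNReal := fun n w ↦
    ENNReal.ofReal (Real.exp (-∑ l ∈ Finset.range n, (w l).2))
  let E : (ℕ → Option ι × ℝ) → ENNReal := fun w ↦ ⨅ n, T n w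
  have hT : ∀ n, Measurable (T n) := fun n ↦ by
    refine ENNReal.measurable_ofReal.comp (Real.measurable_exp.comp (Measurable.neg ?_))
    exact Finset.measurable_sum _ fun l _ ↦ measurable_snd.comp (measurable_pi_apply l)
  have hE : Measurable E := Measurable.iInf hT
  have hEcons : ∀ s' r w, E (seqCons (s', r) w) ≤ ENNReal.ofReal (Real.exp (-r)) * E w := by
    intro s' r w
    rw [show E w = ⨅ n, T n w from rfl, ENNReal.mul_iInf_of_ne (by simp [Real.exp_pos]) (by simp)]
    refine le_iInf fun n ↦ (iInf_le _ (n + 1)).trans (le_of_eq ?_)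
    change ENNReal.ofReal _ = ENNReal.ofReal _ * ENNReal.ofReal _
    rw [← ENNReal.ofReal_mul (Real.exp_pos _).le, ← Real.exp_add, Finset.sum_range_succ']
    congr 2
    simp only [seqCons]
    ring
  let g : Option ι → ENNReal := fun s ↦ ∫⁻ w, E w ∂m.futureLaw s
  have hg1 : ∀ s, g s ≤ 1 := fun s ↦ by
    calc g s ≤ ∫⁻ _, 1 ∂m.futureLaw s := lintegral_mono fun w ↦ (iInf_le _ 0).trans (by simp [T])
      _ = 1 := by simp
  let lam : Option ι → ENNReal := fun s ↦ ∫⁻ r, ENNReal.ofReal (Real.exp (-r)) ∂m.sojournLaw s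
  have hlam : ∀ s, lam s ≤ 1 := fun s ↦ by
    calc lam s ≤ ∫⁻ _, 1 ∂m.sojournLaw s :=
          lintegral_mono_ae ((m.ae_nonneg_sojournLaw s).mono fun r hr ↦ by
            rw [← ENNReal.ofReal_one]
            exact ENNReal.ofReal_le_ofReal (Real.exp_le_one_iff.2 (by linarith)))
      _ = 1 := by simp
  have hstep : ∀ s, g s ≤ ∫⁻ s', lam s' * g s' ∂m.jumpLaw s := by
    intro s
    change ∫⁻ w, E w ∂m.futureLaw s ≤ _
    rw [m.lintegral_futureLaw s hE]
    refine lintegral_mono fun s' ↦ ?_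
    calc _ ≤ ∫⁻ r, ∫⁻ w, ENNReal.ofReal (Real.exp (-r)) * E w ∂m.futureLaw s' ∂m.sojournLaw s' :=
          lintegral_mono fun r ↦ lintegral_mono fun w ↦ hEcons s' r w
      _ = ∫⁻ r, ENNReal.ofReal (Real.exp (-r)) * g s' ∂m.sojournLaw s' :=
          lintegral_congr fun r ↦ lintegral_const_mul _ hE
      _ = lam s' * g s' := lintegral_mul_const _ (by fun_prop)
  let Λ : ENNReal := Finset.univ.sup fun i : ι ↦ lam (some i)
  have hΛ : Λ < 1 := (Finset.sup_lt_iff (by simp)).2 fun i _ ↦ m.lintegral_exp_neg_sojourn_lt_one i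
  have hΛi : ∀ i, lam (some i) ≤ Λ := fun i ↦
    Finset.le_sup (f := fun i : ι ↦ lam (some i)) (Finset.mem_univ i)
  let γ : ENNReal := Finset.univ.sup fun i : ι ↦ g (some i)
  have hγi : ∀ i, g (some i) ≤ γ := fun i ↦
    Finset.le_sup (f := fun i : ι ↦ g (some i)) (Finset.mem_univ i)
  have hγ1 : γ ≤ 1 := Finset.sup_le fun i _ ↦ hg1 _
  have hnone : g none ≤ Λ * γ := by
    refine (hstep none).trans ?_
    calc _ ≤ ∫⁻ _, Λ * γ ∂m.jumpLaw none := by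
          refine lintegral_mono_ae (m.ae_jumpLaw_none.mono fun s' hs' ↦ ?_)
          obtain _ | i := s'
          · exact absurd rfl hs'
          · exact mul_le_mul' (hΛi i) (hγi i)
      _ = Λ * γ := by simp
  have hsome : ∀ i, g (some i) ≤ Λ * γ := by
    intro i
    refine (hstep (some i)).trans ?_
    calc _ ≤ ∫⁻ _, Λ * γ ∂m.jumpLaw (some i) := by
          refine lintegral_mono fun s' ↦ ?_
          obtain _ | j := s'
          · exact (mul_le_mul' (hlam none) hnone).trans (one_mul _).le
          · exact mul_le_mul' (hΛi j) (hγi j)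
      _ = Λ * γ := by simp
  have hγ0 : γ = 0 := by
    by_contra h0
    have h1 : γ ≤ Λ * γ := Finset.sup_le fun i _ ↦ hsome i
    have h2 : Λ * γ < 1 * γ :=
      ENNReal.mul_lt_mul_left h0 (ne_top_of_le_ne_top ENNReal.one_ne_top hγ1) hΛ
    rw [one_mul] at h2
    exact absurd h1 (not_le.2 h2)
  have hg0 : g s = 0 := by
    obtain _ | i := s
    · simpa [hγ0] using hnone
    · simpa [hγ0] using hsome i
  refine ((lintegral_eq_zero_iff hE).1 hg0).mono fun w hw t ↦ ?_
  by_contra! hcon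
  have : ENNReal.ofReal (Real.exp (-t)) ≤ E w := le_iInf fun n ↦
    ENNReal.ofReal_le_ofReal (Real.exp_le_exp.2 (neg_le_neg (hcon n)))
  rw [hw] at this
  simp only [Pi.zero_apply, nonpos_iff_eq_zero, ENNReal.ofReal_eq_zero] at this
  exact absurd (Real.exp_pos (-t)) (not_lt.2 this)

/-! ### The channel in the course of time -/

/-- The channel at a given time: its state, the time already spent in it, the residual time, and
the states visited afterwards with their sojourn times. -/
abbrev Config (ι : Type*) := Option ι × ℝ × ℝ × (ℕ → Option ι × ℝ)

/-- The channel at the moment of its next jump. -/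
def jump (c : Config ι) : Config ι :=
  ((c.2.2.2 0).1, 0, (c.2.2.2 0).2, fun n ↦ c.2.2.2 (n + 1))

/-- The time of the `n`-th jump. -/
noncomputable def epoch (c : Config ι) (n : ℕ) : ℝ :=
  ∑ l ∈ Finset.range n, (jump^[l] c).2.2.1

/-- The number of jumps up to time `t`. -/
noncomputable def hops (t : ℝ) (c : Config ι) : ℕ := sInf {n : ℕ | t < epoch c (n + 1)}

/-- The channel `t` time units later. -/
noncomputable def advance (t : ℝ) (c : Config ι) : Config ι :=
  let d := jump^[hops t c] c
  let e := t - epoch c (hops t c)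
  (d.1, d.2.1 + e, d.2.2.1 - e, d.2.2.2)

/-- Nonnegative sojourn times, finitely many jumps in finite time. -/
structure Regular (c : Config ι) : Prop where
  nonneg : ∀ n, 0 ≤ (jump^[n] c).2.2.1
  unbounded : ∀ t, ∃ n, t < epoch c n

theorem measurable_jump : Measurable (jump (ι := ι)) := by
  have h0 : Measurable fun c : Config ι ↦ c.2.2.2 0 :=
    (measurable_pi_apply 0).comp measurable_snd.snd.snd
  refine h0.fst.prodMk (measurable_const.prodMk (h0.snd.prodMk ?_))
  exact measurable_pi_lambda _ fun n ↦ (measurable_pi_apply (n + 1)).comp measurable_snd.snd.snd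

theorem measurable_epoch (n : ℕ) : Measurable fun c : Config ι ↦ epoch c n :=
  Finset.measurable_sum _ fun l _ ↦ (measurable_jump.iterate l).snd.snd.fst

theorem measurable_sInf_nat {α : Type*} [MeasurableSpace α] {p : ℕ → α → Prop}
    (hp : ∀ n, MeasurableSet {x | p n x}) : Measurable fun x ↦ sInf {n | p n x} := by
  refine measurable_to_countable' fun k ↦ ?_
  have hex : MeasurableSet {x | ∃ n, p n x} := by
    rw [ofPred_exists]
    exact MeasurableSet.iUnion hp
  have hfirst : MeasurableSet {x | p k x ∧ ∀ j < k, ¬ p j x} := by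
    rw [ofPred_and]
    refine (hp k).inter ?_
    simp only [ofPred_forall]
    exact MeasurableSet.iInter fun j ↦ MeasurableSet.iInter fun _ ↦ (hp j).compl
  have e : (fun x ↦ sInf {n | p n x}) ⁻¹' {k} =
      {x | p k x ∧ ∀ j < k, ¬ p j x} ∪ ({x | ∃ n, p n x}ᶜ ∩ {_x | k = 0}) := by
    ext x
    simp only [mem_preimage, mem_singleton_iff, mem_union, mem_inter_iff, mem_compl_iff,
      mem_ofPred_eq]
    by_cases hx : ∃ n, p n x
    · constructor
      · rintro rfl
        exact Or.inl ⟨Nat.sInf_mem hx, fun j hj ↦ Nat.notMem_of_lt_sInf hj⟩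
      · rintro (⟨h1, h2⟩ | ⟨h1, -⟩)
        · refine le_antisymm (Nat.sInf_le h1) (not_lt.1 fun h ↦ h2 _ h (Nat.sInf_mem hx))
        · exact absurd hx h1
    · have : {n | p n x} = ∅ := eq_empty_of_forall_notMem fun n hn ↦ hx ⟨n, hn⟩
      rw [this, Nat.sInf_empty]
      constructor
      · rintro rfl
        exact Or.inr ⟨hx, rfl⟩
      · rintro (⟨h1, -⟩ | ⟨-, h2⟩)
        · exact absurd ⟨k, h1⟩ hx
        · exact h2.symm
  rw [e]
  exact hfirst.union (hex.compl.inter (MeasurableSet.const _))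

theorem measurable_hops : Measurable fun p : ℝ × Config ι ↦ hops p.1 p.2 :=
  measurable_sInf_nat fun n ↦
    measurableSet_lt measurable_fst ((measurable_epoch (n + 1)).comp measurable_snd)

theorem measurable_advance : Measurable fun p : ℝ × Config ι ↦ advance p.1 p.2 := by
  refine measurable_eval_countable (g := fun n (p : ℝ × Config ι) ↦
    (((jump^[n] p.2).1, (jump^[n] p.2).2.1 + (p.1 - epoch p.2 n),
      (jump^[n] p.2).2.2.1 - (p.1 - epoch p.2 n), (jump^[n] p.2).2.2.2) : Config ι))
    measurable_hops fun n ↦ ?_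
  have h : Measurable fun p : ℝ × Config ι ↦ jump^[n] p.2 :=
    (measurable_jump.iterate n).comp measurable_snd
  have he : Measurable fun p : ℝ × Config ι ↦ p.1 - epoch p.2 n :=
    measurable_fst.sub ((measurable_epoch n).comp measurable_snd)
  exact h.fst.prodMk ((h.snd.fst.add he).prodMk ((h.snd.snd.fst.sub he).prodMk h.snd.snd.snd))

theorem epoch_zero (c : Config ι) : epoch c 0 = 0 := by simp [epoch]

theorem epoch_succ' (c : Config ι) (n : ℕ) : epoch c (n + 1) = c.2.2.1 + epoch (jump c) n := by
  unfold epoch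
  rw [Finset.sum_range_succ', add_comm]
  rfl

theorem epoch_succ (c : Config ι) (n : ℕ) :
    epoch c (n + 1) = epoch c n + (jump^[n] c).2.2.1 := Finset.sum_range_succ _ _

theorem Regular.jump {c : Config ι} (h : Regular c) : Regular (jump c) := by
  refine ⟨fun n ↦ h.nonneg (n + 1), fun t ↦ ?_⟩
  obtain ⟨n, hn⟩ := h.unbounded (max (t + c.2.2.1) 0)
  obtain _ | n := n
  · rw [epoch_zero] at hn
    exact absurd (le_max_right _ _) (not_le.2 hn)
  · rw [epoch_succ'] at hn
    have := le_max_left (t + c.2.2.1) 0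
    exact ⟨n, by linarith⟩

theorem Regular.monotone_epoch {c : Config ι} (h : Regular c) : Monotone (epoch c) :=
  monotone_nat_of_le_succ fun n ↦ by
    rw [epoch_succ]
    linarith [h.nonneg n]

theorem epoch_hops_le {c : Config ι} {t : ℝ} (ht : 0 ≤ t) :
    epoch c (hops t c) ≤ t := by
  rcases hn : hops t c with _ | n
  · rwa [epoch_zero]
  · by_contra! hcon
    have : hops t c ≤ n := Nat.sInf_le hcon
    omega

theorem Regular.lt_epoch_hops {c : Config ι} (h : Regular c) (t : ℝ) :
    t < epoch c (hops t c + 1) := by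
  have : {n : ℕ | t < epoch c (n + 1)}.Nonempty := by
    obtain ⟨n, hn⟩ := h.unbounded t
    exact ⟨n, hn.trans_le (h.monotone_epoch n.le_succ)⟩
  exact Nat.sInf_mem this

theorem hops_of_lt {c : Config ι} {t : ℝ} (ht : t < c.2.2.1) : hops t c = 0 := by
  refine Nat.le_zero.1 (Nat.sInf_le ?_)
  change t < epoch c 1
  rwa [epoch_succ', epoch_zero, add_zero]

theorem advance_of_lt {c : Config ι} {t : ℝ} (ht : t < c.2.2.1) :
    advance t c = (c.1, c.2.1 + t, c.2.2.1 - t, c.2.2.2) := by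
  unfold advance
  rw [hops_of_lt ht, epoch_zero, sub_zero]
  rfl

theorem Regular.hops_of_le {c : Config ι} (h : Regular c) {t : ℝ} (ht : c.2.2.1 ≤ t) :
    hops t c = hops (t - c.2.2.1) (OnOffTCP.jump c) + 1 := by
  apply le_antisymm
  · refine Nat.sInf_le ?_
    change t < epoch c (_ + 1 + 1)
    rw [epoch_succ']
    linarith [h.jump.lt_epoch_hops (t - c.2.2.1)]
  · rcases hn : hops t c with _ | n
    · have := h.lt_epoch_hops t
      rw [hn, epoch_succ', epoch_zero] at this
      linarith
    · refine Nat.succ_le_succ (Nat.sInf_le ?_)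
      change _ < epoch _ (n + 1)
      have := h.lt_epoch_hops t
      rw [hn, epoch_succ'] at this
      linarith

theorem Regular.advance_of_le {c : Config ι} (h : Regular c) {t : ℝ} (ht : c.2.2.1 ≤ t) :
    advance t c = advance (t - c.2.2.1) (OnOffTCP.jump c) := by
  unfold advance
  rw [h.hops_of_le ht, epoch_succ', Function.iterate_succ_apply, sub_add_eq_sub_sub]

theorem iterate_jump_shift (s : Option ι) (a r t : ℝ) (w : ℕ → Option ι × ℝ) (n : ℕ) :
    jump^[n + 1] ((s, a + t, r - t, w) : Config ι) = jump^[n + 1] (s, a, r, w) := by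
  rw [Function.iterate_succ_apply, Function.iterate_succ_apply]
  rfl

theorem Regular.shift {s : Option ι} {a r t : ℝ} {w : ℕ → Option ι × ℝ}
    (h : Regular ((s, a, r, w) : Config ι)) (ht : t ≤ r) : Regular (s, a + t, r - t, w) := by
  refine ⟨fun n ↦ ?_, fun u ↦ ?_⟩
  · cases n with
    | zero => exact sub_nonneg.2 ht
    | succ n =>
      rw [iterate_jump_shift]
      exact h.nonneg _
  · obtain ⟨n, hn⟩ := h.unbounded (max (u + t) 0)
    cases n with
    | zero =>
      rw [epoch_zero] at hn
      exact absurd (le_max_right _ _) (not_le.2 hn)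
    | succ n =>
      refine ⟨n + 1, ?_⟩
      rw [epoch_succ'] at hn ⊢
      change _ < r - t + epoch (OnOffTCP.jump (s, a, r, w)) n
      have := le_max_left (u + t) 0
      change _ < r + _ at hn
      linarith

/-- Induction over the number of jumps up to time `t`. -/
theorem Regular.induction {P : ℝ → Config ι → Prop}
    (h0 : ∀ t c, Regular c → 0 ≤ t → t < c.2.2.1 → P t c)
    (h1 : ∀ t c, Regular c → c.2.2.1 ≤ t → P (t - c.2.2.1) (OnOffTCP.jump c) → P t c)
    {t : ℝ} {c : Config ι} (ht : 0 ≤ t) (hc : Regular c) : P t c := by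
  induction hn : hops t c generalizing t c with
  | zero =>
    refine h0 t c hc ht ?_
    have := hc.lt_epoch_hops t
    rwa [hn, epoch_succ', epoch_zero, add_zero] at this
  | succ n ih =>
    rcases lt_or_ge t c.2.2.1 with h | h
    · exact h0 t c hc ht h
    · refine h1 t c hc h (ih (sub_nonneg.2 h) hc.jump ?_)
      rw [hc.hops_of_le h] at hn
      omega

theorem Regular.advance {c : Config ι} (hc : Regular c) {t : ℝ} (ht : 0 ≤ t) :
    Regular (advance t c) ∧ 0 < (OnOffTCP.advance t c).2.2.1 := by
  refine Regular.induction (P := fun t c ↦ Regular (OnOffTCP.advance t c) ∧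
    0 < (OnOffTCP.advance t c).2.2.1) ?_ ?_ ht hc
  · intro t c hc _ h
    rw [advance_of_lt h]
    exact ⟨hc.shift h.le, sub_pos.2 h⟩
  · intro t c hc h ih
    rwa [hc.advance_of_le h]

theorem Regular.advance_advance {c : Config ι} (hc : Regular c) {t u : ℝ} (ht : 0 ≤ t)
    (hu0 : 0 ≤ u) :
    OnOffTCP.advance u (OnOffTCP.advance t c) = OnOffTCP.advance (t + u) c := by
  refine Regular.induction (P := fun t c ↦ OnOffTCP.advance u (OnOffTCP.advance t c) =
    OnOffTCP.advance (t + u) c) ?_ ?_ ht hc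
  · intro t c hc _ h
    rw [advance_of_lt h]
    rcases lt_or_ge u (c.2.2.1 - t) with hu | hu
    · rw [advance_of_lt hu, advance_of_lt (by linarith : t + u < c.2.2.1)]
      simp only [add_assoc, sub_sub]
    · rw [(hc.shift h.le).advance_of_le hu, hc.advance_of_le (by linarith : c.2.2.1 ≤ t + u)]
      change OnOffTCP.advance (u - (c.2.2.1 - t)) (OnOffTCP.jump c) = _
      congr 1
      ring
  · intro t c hc h ih
    rw [hc.advance_of_le h, ih]
    rw [hc.advance_of_le (by linarith : c.2.2.1 ≤ t + u)]
    congr 1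
    ring

/-! ### The Markov property of the channel at a fixed time -/

/-- The law of the channel in state `s` of age `a`, the residual time having law `ℓ`. -/
noncomputable def configLaw (s : Option ι) (a : ℝ) (ℓ : Measure ℝ) : Measure (Config ι) :=
  (ℓ.prod (m.futureLaw s)).map fun p ↦ (s, a, p.1, p.2)

theorem measurable_config_mk (s : Option ι) (a : ℝ) :
    Measurable fun p : ℝ × (ℕ → Option ι × ℝ) ↦ ((s, a, p.1, p.2) : Config ι) := by fun_prop

instance (s : Option ι) (a : ℝ) (ℓ : Measure ℝ) [IsProbabilityMeasure ℓ] :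
    IsProbabilityMeasure (m.configLaw s a ℓ) :=
  Measure.isProbabilityMeasure_map (measurable_config_mk s a).aemeasurable

theorem lintegral_configLaw (s : Option ι) (a : ℝ) (ℓ : Measure ℝ) [SFinite ℓ]
    {F : Config ι → ENNReal} (hF : Measurable F) :
    ∫⁻ c, F c ∂m.configLaw s a ℓ = ∫⁻ r, ∫⁻ w, F (s, a, r, w) ∂m.futureLaw s ∂ℓ := by
  unfold configLaw
  rw [lintegral_map hF (measurable_config_mk s a)]
  exact lintegral_prod _ (hF.comp (measurable_config_mk s a)).aemeasurable

/-- First step analysis: sojourn, jump, and then the channel starts afresh in the new state. -/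
theorem lintegral_configLaw_step (s : Option ι) (a : ℝ) (ℓ : Measure ℝ) [SFinite ℓ]
    {F : ℝ → Config ι → ENNReal} (hF : Measurable (Function.uncurry F)) :
    ∫⁻ c, F c.2.2.1 (jump c) ∂m.configLaw s a ℓ =
      ∫⁻ r, ∫⁻ s', ∫⁻ c, F r c ∂m.configLaw s' 0 (m.sojournLaw s') ∂m.jumpLaw s ∂ℓ := by
  have h1 : Measurable fun c : Config ι ↦ F c.2.2.1 (jump c) :=
    hF.comp (measurable_snd.snd.fst.prodMk measurable_jump)
  rw [m.lintegral_configLaw s a ℓ h1]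
  refine lintegral_congr fun r ↦ ?_
  have h2 : Measurable fun w : ℕ → Option ι × ℝ ↦ ((s, a, r, w) : Config ι) := by fun_prop
  refine (m.lintegral_futureLaw s (h1.comp h2)).trans (lintegral_congr fun s' ↦ ?_)
  exact (m.lintegral_configLaw s' 0 _ (F := F r)
    (hF.comp (measurable_const.prodMk measurable_id))).symm

theorem ae_configLaw (s : Option ι) (a : ℝ) (ℓ : Measure ℝ) [SFinite ℓ] {p : Config ι → Prop}
    (hp : ∀ᵐ r ∂ℓ, ∀ᵐ w ∂m.futureLaw s, p (s, a, r, w)) (hm : MeasurableSet {c | p c}) :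
    ∀ᵐ c ∂m.configLaw s a ℓ, p c := by
  unfold configLaw
  rw [ae_map_iff (measurable_config_mk s a).aemeasurable hm]
  exact (Measure.ae_prod_iff_ae_ae (measurable_config_mk s a hm)).2 hp

theorem jump_iterate_succ (s : Option ι) (a r : ℝ) (w : ℕ → Option ι × ℝ) (n : ℕ) :
    jump^[n + 1] ((s, a, r, w) : Config ι) = ((w n).1, 0, (w n).2, fun k ↦ w (n + 1 + k)) := by
  induction n with
  | zero =>
    simp only [Function.iterate_succ_apply, Function.iterate_zero, id, jump, zero_add, add_comm]
  | succ n ih =>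
    rw [Function.iterate_succ_apply', ih]
    simp only [jump, add_zero]
    congr 4
    funext k
    congr 1
    omega

theorem measurableSet_regular : MeasurableSet {c : Config ι | Regular c} := by
  have e : {c : Config ι | Regular c} = (⋂ n, {c | 0 ≤ (jump^[n] c).2.2.1}) ∩
      ⋂ k : ℕ, ⋃ n, {c | (k : ℝ) < epoch c n} := by
    ext c
    simp only [mem_ofPred_eq, mem_inter_iff, mem_iInter, mem_iUnion]
    refine ⟨fun h ↦ ⟨h.nonneg, fun k ↦ h.unbounded k⟩, fun h ↦ ⟨h.1, fun t ↦ ?_⟩⟩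
    obtain ⟨k, hk⟩ := exists_nat_gt t
    obtain ⟨n, hn⟩ := h.2 k
    exact ⟨n, hk.trans hn⟩
  rw [e]
  refine (MeasurableSet.iInter fun n ↦ ?_).inter
    (MeasurableSet.iInter fun k ↦ MeasurableSet.iUnion fun n ↦ ?_)
  · exact measurableSet_le measurable_const (measurable_jump.iterate n).snd.snd.fst
  · exact measurableSet_lt measurable_const (measurable_epoch n)

theorem ae_regular (s : Option ι) (a : ℝ) (ℓ : Measure ℝ) [SFinite ℓ] (hℓ : ∀ᵐ r ∂ℓ, 0 ≤ r) :
    ∀ᵐ c ∂m.configLaw s a ℓ, Regular c := by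
  refine m.ae_configLaw s a ℓ (hℓ.mono fun r hr ↦ ?_) measurableSet_regular
  filter_upwards [m.ae_futureLaw_nonneg s, m.ae_futureLaw_unbounded s] with w h1 h2
  refine ⟨fun n ↦ ?_, fun t ↦ ?_⟩
  · cases n with
    | zero => exact hr
    | succ n =>
      rw [jump_iterate_succ]
      exact h1 n
  · obtain ⟨n, hn⟩ := h2 t
    refine ⟨n + 1, ?_⟩
    unfold epoch
    rw [Finset.sum_range_succ']
    simp only [jump_iterate_succ]
    change _ < _ + r
    linarith

/-- `ℓ` is a possible law of the residual time in the state `s` at the age `a`: given that this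
time exceeds `t`, what is left of it has the residual law at the age `a + t`. -/
structure IsLifetime (s : Option ι) (a : ℝ) (ℓ : Measure ℝ) : Prop where
  ae_nonneg : ∀ᵐ r ∂ℓ, 0 ≤ r
  setLIntegral_sub : ∀ t, 0 ≤ t → ∀ f : ℝ → ENNReal, Measurable f →
    ∫⁻ r in Ioi t, f (r - t) ∂ℓ = ℓ (Ioi t) * ∫⁻ r, f r ∂m.residualLaw (s, a + t)

theorem lintegral_residualLaw_none (a : ℝ) {f : ℝ → ENNReal} (hf : Measurable f) :
    ∫⁻ r, f r ∂m.residualLaw (none, a) = (m.ν (Ioi a))⁻¹ * ∫⁻ y in Ioi a, f (y - a) ∂m.ν := by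
  have hm : Measurable fun x : ℝ ↦ x - a := measurable_id.sub_const a
  rw [residualLaw, lintegral_map hf hm, ProbabilityTheory.cond, lintegral_smul_measure, smul_eq_mul]

theorem mul_lintegral_residualLaw_none (a : ℝ) {f : ℝ → ENNReal} (hf : Measurable f) :
    m.ν (Ioi a) * ∫⁻ r, f r ∂m.residualLaw (none, a) = ∫⁻ y in Ioi a, f (y - a) ∂m.ν := by
  rw [m.lintegral_residualLaw_none a hf, ← mul_assoc]
  by_cases h : m.ν (Ioi a) = 0
  · rw [Measure.restrict_eq_zero.2 h]
    simp
  · rw [ENNReal.mul_inv_cancel h (measure_ne_top _ _), one_mul]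

theorem isLifetime_sojournLaw (s : Option ι) : m.IsLifetime s 0 (m.sojournLaw s) := by
  refine ⟨m.ae_nonneg_sojournLaw s, fun t ht f hf ↦ ?_⟩
  cases s with
  | none => rw [sojournLaw_none, zero_add, m.mul_lintegral_residualLaw_none t hf]
  | some i => exact setLIntegral_expMeasure_sub (m.rate_pos i) ht hf

instance (x : Option ι × ℝ) : IsFiniteMeasure (m.residualLaw x) :=
  inferInstanceAs (IsFiniteMeasure (m.residualKernel x))

theorem ae_pos_residualLaw (s : Option ι) (a : ℝ) : ∀ᵐ r ∂m.residualLaw (s, a), 0 < r := by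
  cases s with
  | none =>
    have hm : Measurable fun x : ℝ ↦ x - a := measurable_id.sub_const a
    rw [residualLaw, ae_map_iff hm.aemeasurable measurableSet_Ioi]
    exact (ProbabilityTheory.ae_cond_mem measurableSet_Ioi).mono fun y hy ↦ sub_pos.2 hy
  | some i => exact ae_pos_expMeasure (m.rate_pos i)

theorem isLifetime_residualLaw (s : Option ι) (a : ℝ) :
    m.IsLifetime s a (m.residualLaw (s, a)) := by
  refine ⟨(m.ae_pos_residualLaw s a).mono fun _ h ↦ h.le, fun t ht f hf ↦ ?_⟩
  cases s with
  | some i => exact setLIntegral_expMeasure_sub (m.rate_pos i) ht hf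
  | none =>
    have hft : Measurable fun r ↦ f (r - t) := hf.comp (measurable_id.sub_const t)
    have e : ∀ g : ℝ → ENNReal, (∫⁻ y in Ioi a, (Ioi t).indicator g (y - a) ∂m.ν) =
        ∫⁻ y in Ioi (a + t), g (y - a) ∂m.ν := by
      intro g
      rw [← lintegral_indicator measurableSet_Ioi, ← lintegral_indicator measurableSet_Ioi]
      refine lintegral_congr fun y ↦ ?_
      by_cases h : a + t < y
      · rw [indicator_of_mem (show y ∈ Ioi a by simp only [mem_Ioi]; linarith),
          indicator_of_mem (show y ∈ Ioi (a + t) from h),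
          indicator_of_mem (show y - a ∈ Ioi t by simp only [mem_Ioi]; linarith)]
      · rw [indicator_of_notMem (show y ∉ Ioi (a + t) from h)]
        refine indicator_apply_eq_zero.2 fun _ ↦ indicator_of_notMem ?_ _
        simp only [mem_Ioi]
        linarith
    have h1 : m.residualLaw (none, a) (Ioi t) = (m.ν (Ioi a))⁻¹ * m.ν (Ioi (a + t)) := by
      rw [← lintegral_indicator_one measurableSet_Ioi, m.lintegral_residualLaw_none a
        (measurable_one.indicator measurableSet_Ioi), e]
      simp
    rw [← lintegral_indicator measurableSet_Ioi,
      m.lintegral_residualLaw_none a (hft.indicator measurableSet_Ioi), e, h1, mul_assoc,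
      m.mul_lintegral_residualLaw_none (a + t) hf]
    simp only [sub_sub]

/-- The law of the channel in state `s` of age `a`. -/
noncomputable abbrev channelLaw (z : Option ι × ℝ) : Measure (Config ι) :=
  m.configLaw z.1 z.2 (m.residualLaw z)

theorem measurable_lintegral_channelLaw {g : Config ι → ENNReal} (hg : Measurable g) :
    Measurable fun z ↦ ∫⁻ c, g c ∂m.channelLaw z := by
  have e : ∀ z : Option ι × ℝ, ∫⁻ c, g c ∂m.channelLaw z =
      ∫⁻ r, ∫⁻ w, g (z.1, z.2, r, w) ∂m.futureLaw z.1 ∂m.residualKernel z := fun z ↦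
    m.lintegral_configLaw z.1 z.2 (m.residualLaw z) hg
  simp_rw [e]
  have h1 : Measurable fun p : (Option ι × ℝ) × ℝ ↦
      ∫⁻ w, g (p.1.1, p.1.2, p.2, w) ∂m.futureLaw p.1.1 := by
    have := Measurable.lintegral_kernel_prod_right' (κ := m.futureLaw.comap
      (fun p : (Option ι × ℝ) × ℝ ↦ p.1.1) measurable_fst.fst)
      (f := fun q ↦ g (q.1.1.1, q.1.1.2, q.1.2, q.2)) (hg.comp (by fun_prop))
    exact this
  exact Measurable.lintegral_kernel_prod_right' (κ := m.residualKernel) h1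

/-- The Markov property on the event that the first `n` jumps have not all occurred by time `t`. -/
theorem lintegral_advance_lt_epoch {g : Config ι → ENNReal} (hg : Measurable g) (n : ℕ) :
    ∀ {s : Option ι} {a : ℝ} {ℓ : Measure ℝ} [SFinite ℓ] {t : ℝ}, m.IsLifetime s a ℓ → 0 ≤ t →
    ∫⁻ c, {c | t < epoch c n}.indicator (fun c ↦ g (advance t c)) c ∂m.configLaw s a ℓ =
    ∫⁻ c, {c | t < epoch c n}.indicator (fun c ↦ ∫⁻ c', g c'
      ∂m.channelLaw ((advance t c).1, (advance t c).2.1)) c ∂m.configLaw s a ℓ := by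
  have hadv : ∀ t : ℝ, Measurable fun c : Config ι ↦ advance t c := fun t ↦
    measurable_advance.comp (measurable_const.prodMk measurable_id)
  induction n with
  | zero =>
    intro s a ℓ _ t _ ht
    have : ∀ c : Config ι, c ∉ {c : Config ι | t < epoch c 0} := fun c h ↦ by
      rw [mem_ofPred_eq, epoch_zero] at h
      linarith
    simp only [indicator_of_notMem (this _)]
  | succ n ih =>
    intro s a ℓ _ t hℓ ht
    -- both integrals split according to whether the first jump occurs before time `t`
    have split : ∀ h : Config ι → ENNReal, Measurable h →
        ∫⁻ c, {c | t < epoch c (n + 1)}.indicator (fun c ↦ h (advance t c)) c ∂m.configLaw s a ℓ =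
        (∫⁻ r in Ioi t, ∫⁻ w, h (s, a + t, r - t, w) ∂m.futureLaw s ∂ℓ) +
        ∫⁻ r in Iic t, ∫⁻ s', ∫⁻ c, {c | t - r < epoch c n}.indicator
          (fun c ↦ h (advance (t - r) c)) c
            ∂m.configLaw s' 0 (m.sojournLaw s') ∂m.jumpLaw s ∂ℓ := by
      intro h hh
      let F1 : Config ι → ENNReal := fun c ↦
        (Ioi t).indicator (fun r ↦ h (c.1, c.2.1 + t, r - t, c.2.2.2)) c.2.2.1
      let F2 : ℝ → Config ι → ENNReal := fun r c ↦ (Iic t).indicator (fun r ↦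
        {c | t - r < epoch c n}.indicator (fun c ↦ h (advance (t - r) c)) c) r
      have hF1 : Measurable F1 := by
        have : F1 = {c : Config ι | t < c.2.2.1}.indicator
            fun c ↦ h (c.1, c.2.1 + t, c.2.2.1 - t, c.2.2.2) := by
          funext c
          simp only [F1, indicator, mem_Ioi, mem_ofPred_eq]
        rw [this]
        refine Measurable.indicator (hh.comp (by fun_prop)) ?_
        exact measurableSet_lt measurable_const measurable_snd.snd.fst
      have hF2 : Measurable (Function.uncurry F2) := by
        have : Function.uncurry F2 = {p : ℝ × Config ι | p.1 ≤ t}.indicator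
            ({p : ℝ × Config ι | t - p.1 < epoch p.2 n}.indicator
              fun p ↦ h (advance (t - p.1) p.2)) := by
          funext p
          simp only [F2, Function.uncurry, indicator, mem_Iic, mem_ofPred_eq]
        rw [this]
        refine Measurable.indicator (Measurable.indicator (hh.comp (measurable_advance.comp
          ((measurable_const.sub measurable_fst).prodMk measurable_snd))) ?_) ?_
        · exact measurableSet_lt (measurable_const.sub measurable_fst)
            ((measurable_epoch n).comp measurable_snd)
        · exact measurableSet_le measurable_fst measurable_const
      calc _ = ∫⁻ c, (F1 c + F2 c.2.2.1 (jump c)) ∂m.configLaw s a ℓ := by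
            refine lintegral_congr_ae ((m.ae_regular s a ℓ hℓ.ae_nonneg).mono fun c hc ↦ ?_)
            dsimp only
            rcases lt_or_ge t c.2.2.1 with hlt | hle
            · have h1 : c ∈ {c : Config ι | t < epoch c (n + 1)} := by
                have := hc.monotone_epoch (show 1 ≤ n + 1 by omega)
                rw [epoch_succ', epoch_zero, add_zero] at this
                exact hlt.trans_le this
              simp only [F1, F2]
              rw [indicator_of_mem h1, indicator_of_mem (show c.2.2.1 ∈ Ioi t from hlt),
                indicator_of_notMem (show c.2.2.1 ∉ Iic t from not_le.2 hlt), add_zero,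
                advance_of_lt hlt]
            · simp only [F1, F2]
              rw [indicator_of_notMem (show c.2.2.1 ∉ Ioi t from not_lt.2 hle),
                indicator_of_mem (show c.2.2.1 ∈ Iic t from hle), zero_add]
              simp only [indicator, mem_ofPred_eq, epoch_succ', hc.advance_of_le hle,
                sub_lt_iff_lt_add']
        _ = (∫⁻ c, F1 c ∂m.configLaw s a ℓ) + ∫⁻ c, F2 c.2.2.1 (jump c) ∂m.configLaw s a ℓ :=
            lintegral_add_left hF1 _
        _ = _ := by
            congr 1
            · rw [m.lintegral_configLaw s a ℓ hF1, ← lintegral_indicator measurableSet_Ioi]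
              refine lintegral_congr fun r ↦ ?_
              simp only [F1, indicator]
              split_ifs <;> simp
            · rw [m.lintegral_configLaw_step s a ℓ hF2, ← lintegral_indicator measurableSet_Iic]
              refine lintegral_congr fun r ↦ ?_
              simp only [F2]
              by_cases hr : r ∈ Iic t <;> simp [hr]
    have hG : Measurable fun c : Config ι ↦ ∫⁻ c', g c' ∂m.channelLaw (c.1, c.2.1) :=
      (m.measurable_lintegral_channelLaw hg).comp (measurable_fst.prodMk measurable_snd.fst)
    rw [split g hg, split (fun c ↦ ∫⁻ c', g c' ∂m.channelLaw (c.1, c.2.1)) hG]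
    congr 1
    · have hf : Measurable fun r ↦ ∫⁻ w, g (s, a + t, r, w) ∂m.futureLaw s :=
        Measurable.lintegral_prod_right' (f := fun p ↦ g (s, a + t, p.1, p.2))
          (hg.comp (measurable_config_mk s (a + t)))
      rw [hℓ.setLIntegral_sub t ht _ hf, ← m.lintegral_configLaw s (a + t) _ hg]
      simp [mul_comm]
    · refine setLIntegral_congr_fun measurableSet_Iic fun r hr ↦ ?_
      refine lintegral_congr fun s' ↦ ?_
      exact ih (m.isLifetime_sojournLaw s') (sub_nonneg.2 hr)

/-- The Markov property of the channel at the time `t`. -/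
theorem lintegral_advance {g : Config ι → ENNReal} (hg : Measurable g) {s : Option ι} {a : ℝ}
    {ℓ : Measure ℝ} [SFinite ℓ] (hℓ : m.IsLifetime s a ℓ) {t : ℝ} (ht : 0 ≤ t) :
    ∫⁻ c, g (advance t c) ∂m.configLaw s a ℓ =
    ∫⁻ c, ∫⁻ c', g c' ∂m.channelLaw ((advance t c).1, (advance t c).2.1) ∂m.configLaw s a ℓ := by
  have hadv : Measurable fun c : Config ι ↦ advance t c :=
    measurable_advance.comp (measurable_const.prodMk measurable_id)
  have mono : ∀ h : Config ι → ENNReal, Measurable h → ∫⁻ c, h c ∂m.configLaw s a ℓ =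
      ⨆ n, ∫⁻ c, {c | t < epoch c n}.indicator h c ∂m.configLaw s a ℓ := by
    intro h hh
    rw [← lintegral_iSup']
    · refine lintegral_congr_ae ((m.ae_regular s a ℓ hℓ.ae_nonneg).mono fun c hc ↦ ?_)
      obtain ⟨n, hn⟩ := hc.unbounded t
      refine le_antisymm (le_iSup_of_le n ?_) (iSup_le fun k ↦ indicator_le_self _ _ _)
      rw [indicator_of_mem (show c ∈ {c | t < epoch c n} from hn)]
    · exact fun n ↦ (hh.indicator (measurableSet_lt measurable_const
        (measurable_epoch n))).aemeasurable
    · refine (m.ae_regular s a ℓ hℓ.ae_nonneg).mono fun c hc n k hnk ↦ ?_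
      by_cases hn : t < epoch c n
      · dsimp only
        rw [indicator_of_mem (show c ∈ {c | t < epoch c n} from hn), indicator_of_mem
          (show c ∈ {c | t < epoch c k} from hn.trans_le (hc.monotone_epoch hnk))]
      · dsimp only
        rw [indicator_of_notMem (show c ∉ {c | t < epoch c n} from hn)]
        exact zero_le
  have hG : Measurable fun c : Config ι ↦ ∫⁻ c', g c'
      ∂m.channelLaw ((advance t c).1, (advance t c).2.1) :=
    (m.measurable_lintegral_channelLaw hg).comp (hadv.fst.prodMk hadv.snd.fst)
  rw [mono _ hG]
  refine (mono _ (hg.comp hadv)).trans ?_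
  exact iSup_congr fun n ↦ m.lintegral_advance_lt_epoch hg n hℓ ht

/-! ### The flow as a Markov chain -/

/-- The system at a transmission attempt with everything that determines its future: the channel,
the time until the next attempt, window size and slow start threshold, and the packet losses of
the windows to come. -/
abbrev Run (ι : Type*) := Config ι × (ℝ × ℕ × ℕ) × (ℕ × ℕ → Bool)

/-- Set the age of an ON phase, which is irrelevant, to zero. -/
def resetAge (c : Config ι) : Config ι := (c.1, c.1.elim c.2.1 fun _ ↦ 0, c.2.2)

/-- The full state seen at the present attempt. -/
def state (ρ : Run ι) : Full ι := (ρ.1.1, ρ.1.2.1, ρ.2.1)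

/-- The observed part `(S, J, W, H)` of a full state. -/
def obs (x : Full ι) : Obs ι := (x.1, x.2.2)

/-- A sample point with given packet losses; `nextWindow` depends only on these. -/
def lossSample (l : ℕ × ℕ → Bool) : Sample ι := (((none, 0, 0, 0, 0), 0), fun _ ↦ (0, none), l)

/-- The system at the next attempt. -/
noncomputable def next (ρ : Run ι) : Run ι :=
  (resetAge (advance ρ.2.1.1 ρ.1),
    (m.nextGap ρ.1.1 (advance ρ.2.1.1 ρ.1).1 ρ.2.1.1,
      m.nextWindow (lossSample ρ.2.2) 0 ρ.1.1 ρ.2.1.2.1 ρ.2.1.2.2),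
    fun q ↦ ρ.2.2 (q.1 + 1, q.2))

/-- The system at attempt `0`. -/
def run (ω : Sample ι) : Run ι :=
  ((ω.1.1.1, ω.1.1.2.1, ω.1.2, future ω.1.1.1 ω.2.1), ω.1.1.2.2, ω.2.2)

theorem resetAge_regular {c : Config ι} (h : Regular c) : Regular (resetAge c) := by
  have e : ∀ n, (jump^[n] (resetAge c)).2.2.1 = (jump^[n] c).2.2.1 := fun n ↦ by
    cases n <;> rfl
  refine ⟨fun n ↦ (e n).symm ▸ h.nonneg n, fun t ↦ ?_⟩
  obtain ⟨n, hn⟩ := h.unbounded t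
  refine ⟨n, ?_⟩
  unfold epoch at hn ⊢
  simpa only [e] using hn

theorem advance_resetAge_fst (t : ℝ) (c : Config ι) :
    (advance t (resetAge c)).1 = (advance t c).1 := by
  have e : ∀ n, (jump^[n] (resetAge c)).2.2.1 = (jump^[n] c).2.2.1 := fun n ↦ by
    cases n <;> rfl
  have e' : ∀ n, (jump^[n] (resetAge c)).1 = (jump^[n] c).1 := fun n ↦ by
    cases n <;> rfl
  unfold advance hops epoch
  simp only [e, e']

theorem channel_eq (ω : Sample ι) (t : ℝ) : channel ω t = (advance t (run ω).1).1 := by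
  have h1 : ∀ n, visited ω n = (jump^[n] (run ω).1).1 := fun n ↦ by
    cases n with
    | zero => rfl
    | succ n =>
      rw [run, jump_iterate_succ, ← visited_sojourn_succ]
  have h2 : ∀ n, sojourn ω n = (jump^[n] (run ω).1).2.2.1 := fun n ↦ by
    cases n with
    | zero => rfl
    | succ n =>
      rw [run, jump_iterate_succ, ← visited_sojourn_succ]
  have h3 : (fun n ↦ sojourn ω n) = fun n ↦ (jump^[n] (run ω).1).2.2.1 := funext h2
  change visited ω (sInf {n : ℕ | t < ∑ l ∈ Finset.range (n + 1), (fun n ↦ sojourn ω n) l}) = _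
  rw [h1, h3]
  rfl

theorem nextWindow_congr {ω ω' : Sample ι} {k k' : ℕ}
    (h : ∀ l, ω.2.2 (k, l) = ω'.2.2 (k', l)) (s : Option ι) (w h' : ℕ) :
    m.nextWindow ω k s w h' = m.nextWindow ω' k' s w h' := by
  have : Lost ω k w = Lost ω' k' w := by
    unfold Lost
    simp only [h]
  unfold nextWindow
  by_cases h1 : Lost ω k w
  · have h2 : Lost ω' k' w := this ▸ h1
    rw [if_pos h1, if_pos h2]
  · have h2 : ¬ Lost ω' k' w := this ▸ h1
    rw [if_neg h1, if_neg h2]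

theorem M_pos : 0 < m.M := lt_max_of_lt_left m.R_pos

theorem M_le_Tmax : m.M ≤ m.Tmax := m.Tmax_ge

theorem nextGap_nonneg (s s' : Option ι) {j : ℝ} (hj : 0 ≤ j) : 0 ≤ m.nextGap s s' j := by
  have h1 := m.M_pos
  have h2 := m.M_le_Tmax
  cases s' with
  | some _ => exact m.R_pos.le
  | none => cases s with
    | some _ => exact h1.le
    | none => exact le_min (by linarith) (by linarith)

/-- The chain of successive `Run`s reproduces the sample paths of the flow. -/
theorem proc_eq {ω : Sample ι} (hreg : Regular (run ω).1) (hpos : 0 < ω.1.2)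
    (hJ : 0 ≤ ω.1.1.2.2.1) (k : ℕ) : m.proc k ω = obs (state (m.next^[k] (run ω))) := by
  have key : ∀ k, 0 ≤ (m.attempt ω k).1 ∧ 0 ≤ (m.attempt ω k).2.1 ∧
      (m.next^[k] (run ω)).2.1 = (m.attempt ω k).2 ∧
      (m.next^[k] (run ω)).2.2 = (fun q ↦ ω.2.2 (q.1 + k, q.2)) ∧
      Regular (m.next^[k] (run ω)).1 ∧
      (m.next^[k] (run ω)).1.1 = channel ω (m.attempt ω k).1 ∧
      ∀ u, 0 ≤ u → (advance u (m.next^[k] (run ω)).1).1 = channel ω ((m.attempt ω k).1 + u) := by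
    intro k
    induction k with
    | zero =>
      refine ⟨le_rfl, hJ, rfl, rfl, hreg, ?_, fun u _ ↦ ?_⟩
      · rw [channel_eq]
        change _ = (advance 0 _).1
        rw [advance_of_lt (show (0 : ℝ) < (run ω).1.2.2.1 from hpos)]
        rfl
      · rw [channel_eq]
        change _ = (advance (0 + u) _).1
        rw [zero_add]
        rfl
    | succ k ih =>
      obtain ⟨hU, hJk, e1, e2, hr, e3, e4⟩ := ih
      have eU : (m.attempt ω (k + 1)).1 = (m.attempt ω k).1 + (m.attempt ω k).2.1 := rfl
      have eS : (m.next^[k + 1] (run ω)).1 =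
          resetAge (advance (m.attempt ω k).2.1 (m.next^[k] (run ω)).1) := by
        rw [Function.iterate_succ_apply', next, e1]
      have eC : (m.next^[k + 1] (run ω)).1.1 = channel ω (m.attempt ω (k + 1)).1 := by
        rw [eS, eU, ← e4 _ hJk]
        rfl
      refine ⟨by rw [eU]; positivity, m.nextGap_nonneg _ _ hJk, ?_, ?_, ?_, eC, fun u hu ↦ ?_⟩
      · rw [Function.iterate_succ_apply', next, e1, e3, e4 _ hJk]
        refine Prod.ext rfl (m.nextWindow_congr (fun l ↦ ?_) _ _ _)
        change (m.next^[k] (run ω)).2.2 (0, l) = _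
        rw [e2]
        simp
      · rw [Function.iterate_succ_apply', next]
        simp only [e2]
        funext q
        rw [Nat.add_right_comm, Nat.add_assoc]
      · rw [eS]
        exact resetAge_regular (hr.advance hJk).1
      · rw [eS, advance_resetAge_fst, hr.advance_advance hJk hu, e4 _ (by positivity), eU,
          add_assoc]
  obtain ⟨-, -, e1, -, -, e3, -⟩ := key k
  exact (Prod.ext e3 e1).symm

/-! ### Measurability -/

theorem measurable_resetAge : Measurable (resetAge (ι := ι)) := by
  refine measurable_fst.prodMk (Measurable.prodMk ?_ measurable_snd.snd)
  exact measurable_eval_countable (g := fun s (c : Config ι) ↦ Option.elim s c.2.1 fun _ ↦ 0)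
    measurable_fst fun s ↦ by cases s <;> simp only [Option.elim] <;> fun_prop

theorem measurable_state : Measurable (state (ι := ι)) := by unfold state; fun_prop

theorem measurable_obs : Measurable (obs (ι := ι)) := by unfold obs; fun_prop

theorem measurable_nextGap : Measurable fun p : (Option ι × Option ι) × ℝ ↦
    m.nextGap p.1.1 p.1.2 p.2 := by
  refine measurable_from_prod_countable_right fun ⟨s, s'⟩ ↦ ?_
  unfold nextGap
  cases s' <;> cases s <;> simp only <;> fun_prop

theorem measurable_nextWindow (k : ℕ) : Measurable fun p : (Option ι × ℕ × ℕ) × (ℕ × ℕ → Bool) ↦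
    m.nextWindow (lossSample p.2) k p.1.1 p.1.2.1 p.1.2.2 := by
  refine measurable_from_prod_countable_right fun ⟨s, w, h⟩ ↦ ?_
  have hL : MeasurableSet {l : ℕ × ℕ → Bool | Lost (lossSample (ι := ι) l) k w} := by
    have : {l : ℕ × ℕ → Bool | Lost (lossSample (ι := ι) l) k w} =
        ⋃ j ∈ Finset.range w, {l | l (k, j) = true} := by
      ext l
      simp [Lost, lossSample]
    rw [this]
    exact Finset.measurableSet_biUnion _ fun j _ ↦
      measurableSet_eq_fun (measurable_pi_apply (k, j)) measurable_const
  unfold nextWindow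
  dsimp only
  refine Measurable.ite (MeasurableSet.const _) measurable_const ?_
  refine Measurable.ite hL measurable_const ?_
  exact Measurable.ite (MeasurableSet.const _) measurable_const measurable_const

theorem measurable_next : Measurable m.next := by
  have hadv : Measurable fun ρ : Run ι ↦ advance ρ.2.1.1 ρ.1 :=
    measurable_advance.comp (measurable_snd.fst.fst.prodMk measurable_fst)
  refine (measurable_resetAge.comp hadv).prodMk (Measurable.prodMk (Measurable.prodMk ?_ ?_) ?_)
  · exact m.measurable_nextGap.comp ((measurable_fst.fst.prodMk hadv.fst).prodMk
      measurable_snd.fst.fst)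
  · exact (m.measurable_nextWindow 0).comp ((measurable_fst.fst.prodMk
      (measurable_snd.fst.snd.fst.prodMk measurable_snd.fst.snd.snd)).prodMk measurable_snd.snd)
  · exact measurable_pi_lambda _ fun q ↦ (measurable_pi_apply _).comp measurable_snd.snd

theorem measurable_run : Measurable (run (ι := ι)) := by
  have hf : Measurable fun p : Option ι × (ℕ × Option ι → ℝ × Option ι) ↦ future p.1 p.2 :=
    measurable_from_prod_countable_right fun s ↦ measurable_future s
  refine Measurable.prodMk (measurable_fst.fst.fst.prodMk (measurable_fst.fst.snd.fst.prodMk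
    (measurable_fst.snd.prodMk ?_))) (by fun_prop)
  exact hf.comp (measurable_fst.fst.fst.prodMk measurable_snd.fst)

theorem measurable_channel : Measurable fun p : Sample ι × ℝ ↦ channel p.1 p.2 := by
  simp_rw [channel_eq]
  exact (measurable_advance.comp
    (measurable_snd.prodMk (measurable_run.fst.comp measurable_fst))).fst

theorem measurable_attempt (k : ℕ) : Measurable fun ω : Sample ι ↦ m.attempt ω k := by
  induction k with
  | zero => exact measurable_const.prodMk measurable_fst.fst.snd.snd
  | succ k ih =>
    have hu : Measurable fun ω : Sample ι ↦ (m.attempt ω k).1 + (m.attempt ω k).2.1 :=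
      ih.fst.add ih.snd.fst
    have hc : Measurable fun ω : Sample ι ↦ channel ω (m.attempt ω k).1 :=
      measurable_channel.comp (measurable_id.prodMk ih.fst)
    refine hu.prodMk (Measurable.prodMk ?_ ?_)
    · exact m.measurable_nextGap.comp ((hc.prodMk (measurable_channel.comp
        (measurable_id.prodMk hu))).prodMk ih.snd.fst)
    · have := (m.measurable_nextWindow k).comp ((hc.prodMk ih.snd.snd).prodMk
        (measurable_snd.snd : Measurable fun ω : Sample ι ↦ ω.2.2))
      exact this

theorem measurable_proc (k : ℕ) : Measurable (m.proc k) :=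
  (measurable_channel.comp (measurable_id.prodMk (m.measurable_attempt k).fst)).prodMk
    (m.measurable_attempt k).snd

/-! ### The law of the chain -/

/-- The law of the packet losses. -/
noncomputable def lossLaw : Measure (ℕ × ℕ → Bool) :=
  Measure.infinitePi fun _ : ℕ × ℕ ↦ bernoulliMeasure true false m.p

instance : IsProbabilityMeasure m.lossLaw := by unfold lossLaw; infer_instance

/-- The law of the run that starts in a given full state. -/
noncomputable def runLaw : Kernel (Full ι) (Run ι) where
  toFun x := ((m.channelLaw (x.1, x.2.1)).prod m.lossLaw).map fun p ↦ (p.1, x.2.2, p.2)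
  measurable' := by
    refine Measure.measurable_of_measurable_coe _ fun B hB ↦ ?_
    have hmk : ∀ x : Full ι, Measurable fun p : Config ι × (ℕ × ℕ → Bool) ↦
        ((p.1, x.2.2, p.2) : Run ι) := fun x ↦ by fun_prop
    have e : ∀ x : Full ι, ((m.channelLaw (x.1, x.2.1)).prod m.lossLaw).map
        (fun p ↦ ((p.1, x.2.2, p.2) : Run ι)) B =
        ∫⁻ r, ∫⁻ w, m.lossLaw {l | (((x.1, x.2.1, r, w), x.2.2, l) : Run ι) ∈ B}
          ∂m.futureLaw x.1 ∂m.residualKernel (x.1, x.2.1) := by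
      intro x
      rw [Measure.map_apply (hmk x) hB, Measure.prod_apply (hmk x hB),
        m.lintegral_configLaw _ _ _ (measurable_measure_prodMk_left (hmk x hB))]
      rfl
    simp_rw [e]
    have h0 : Measurable fun p : (Full ι × ℝ) × (ℕ → Option ι × ℝ) ↦
        m.lossLaw {l | (((p.1.1.1, p.1.1.2.1, p.1.2, p.2), p.1.1.2.2, l) : Run ι) ∈ B} :=
      measurable_measure_prodMk_left (ν := m.lossLaw)
        (s := {q : ((Full ι × ℝ) × (ℕ → Option ι × ℝ)) × (ℕ × ℕ → Bool) |
          (((q.1.1.1.1, q.1.1.1.2.1, q.1.1.2, q.1.2), q.1.1.1.2.2, q.2) : Run ι) ∈ B})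
        ((by fun_prop : Measurable fun q : ((Full ι × ℝ) × (ℕ → Option ι × ℝ)) × (ℕ × ℕ → Bool) ↦
          (((q.1.1.1.1, q.1.1.1.2.1, q.1.1.2, q.1.2), q.1.1.1.2.2, q.2) : Run ι)) hB)
    have h1 : Measurable fun p : Full ι × ℝ ↦ ∫⁻ w,
        m.lossLaw {l | (((p.1.1, p.1.2.1, p.2, w), p.1.2.2, l) : Run ι) ∈ B} ∂m.futureLaw p.1.1 :=
      Measurable.lintegral_kernel_prod_right' (κ := m.futureLaw.comap
        (fun p : Full ι × ℝ ↦ p.1.1) measurable_fst.fst) h0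
    exact Measurable.lintegral_kernel_prod_right' (κ := m.residualKernel.comap
        (fun p : Full ι ↦ (p.1, p.2.1)) (by fun_prop)) h1

theorem lintegral_runLaw (x : Full ι) {F : Run ι → ENNReal} (hF : Measurable F) :
    ∫⁻ ρ, F ρ ∂m.runLaw x =
      ∫⁻ c, ∫⁻ l, F (c, x.2.2, l) ∂m.lossLaw ∂m.channelLaw (x.1, x.2.1) := by
  have hmk : Measurable fun p : Config ι × (ℕ × ℕ → Bool) ↦
        ((p.1, x.2.2, p.2) : Run ι) := by fun_prop
  change ∫⁻ ρ, F ρ ∂((m.channelLaw (x.1, x.2.1)).prod m.lossLaw).map _ = _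
  rw [lintegral_map hF hmk]
  exact lintegral_prod _ (hF.comp hmk).aemeasurable

instance (s : Option ι) (a : ℝ) (ℓ : Measure ℝ) [IsFiniteMeasure ℓ] :
    IsFiniteMeasure (m.configLaw s a ℓ) := by unfold configLaw; infer_instance

theorem residualLaw_univ_le (z : Option ι × ℝ) : m.residualLaw z univ ≤ 1 := by
  obtain ⟨_ | i, a⟩ := z
  · have hf : Measurable fun y : ℝ ↦ y - a := measurable_id.sub_const a
    rw [residualLaw, Measure.map_apply hf MeasurableSet.univ]
    exact prob_le_one
  · exact (prob_le_one : m.sojournLaw (some i) univ ≤ 1)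

theorem configLaw_univ (s : Option ι) (a : ℝ) (ℓ : Measure ℝ) [SFinite ℓ] :
    m.configLaw s a ℓ univ = ℓ univ := by
  rw [configLaw, Measure.map_apply (measurable_config_mk s a) MeasurableSet.univ, preimage_univ,
    ← univ_prod_univ, Measure.prod_prod, measure_univ (μ := m.futureLaw s), mul_one]

theorem runLaw_univ (x : Full ι) : m.runLaw x univ = m.residualLaw (x.1, x.2.1) univ := by
  rw [← lintegral_one, m.lintegral_runLaw x measurable_const]
  simp [configLaw_univ]

instance : IsFiniteKernel m.runLaw :=
  ⟨1, ENNReal.one_lt_top, fun x ↦ (m.runLaw_univ x).trans_le (m.residualLaw_univ_le _)⟩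

theorem ae_runLaw {x : Full ι} {p : Run ι → Prop} (hm : MeasurableSet {ρ | p ρ})
    (hp : ∀ᵐ c ∂m.channelLaw (x.1, x.2.1), ∀ l, p (c, x.2.2, l)) : ∀ᵐ ρ ∂m.runLaw x, p ρ := by
  rw [ae_iff]
  change m.runLaw x {ρ | p ρ}ᶜ = 0
  rw [← lintegral_indicator_one hm.compl, m.lintegral_runLaw x (measurable_one.indicator hm.compl)]
  refine (lintegral_congr_ae (hp.mono fun c hc ↦ ?_)).trans lintegral_zero
  refine (lintegral_congr fun l ↦ ?_).trans lintegral_zero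
  rw [indicator_of_notMem]
  simpa using hc l

theorem ae_configLaw_fst (s : Option ι) (a : ℝ) (ℓ : Measure ℝ) [SFinite ℓ] :
    ∀ᵐ c ∂m.configLaw s a ℓ, c.1 = s ∧ c.2.1 = a :=
  m.ae_configLaw s a ℓ (Filter.Eventually.of_forall fun _ ↦ Filter.Eventually.of_forall
    fun _ ↦ ⟨rfl, rfl⟩) ((measurableSet_eq_fun measurable_fst measurable_const).inter
      (measurableSet_eq_fun measurable_snd.fst measurable_const))

theorem ae_runLaw_state (x : Full ι) : ∀ᵐ ρ ∂m.runLaw x, state ρ = x := by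
  refine m.ae_runLaw ?_ ((m.ae_configLaw_fst x.1 x.2.1 _).mono fun c hc l ↦ ?_)
  · exact measurableSet_eq_fun measurable_state measurable_const
  · exact Prod.ext hc.1 (Prod.ext hc.2 rfl)

theorem lintegral_law (η : Measure (Full ι)) [SFinite η] {F : Run ι → ENNReal}
    (hF : Measurable F) : ∫⁻ ω, F (run ω) ∂m.law η = ∫⁻ x, ∫⁻ ρ, F ρ ∂m.runLaw x ∂η := by
  have hFr : Measurable fun ω : Sample ι ↦ F (run ω) := hF.comp measurable_run
  have e : m.law η = (η ⊗ₘ m.residualKernel.comap (fun x : Full ι ↦ (x.1, x.2.1))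
    (by fun_prop)).prod (m.arrayLaw.prod m.lossLaw) := rfl
  rw [e, lintegral_prod _ hFr.aemeasurable,
    Measure.lintegral_compProd (Measurable.lintegral_prod_right' hFr)]
  refine lintegral_congr fun x ↦ ?_
  rw [m.lintegral_runLaw x hF, m.lintegral_configLaw _ _ _
    (Measurable.lintegral_prod_right' (f := fun p ↦ F (p.1, x.2.2, p.2)) (by fun_prop))]
  change ∫⁻ r, _ ∂m.residualLaw (x.1, x.2.1) = _
  refine lintegral_congr fun r ↦ ?_
  refine (lintegral_prod _ (hFr.comp measurable_prodMk_left).aemeasurable).trans ?_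
  rw [futureLaw_apply, lintegral_map _ (measurable_future _)]
  · rfl
  · exact Measurable.lintegral_prod_right' (f := fun p : (ℕ → Option ι × ℝ) × (ℕ × ℕ → Bool) ↦
      F ((x.1, x.2.1, r, p.1), x.2.2, p.2)) (by fun_prop)

theorem lintegral_channelLaw_resetAge (z : Option ι × ℝ) {g : Config ι → ENNReal}
    (hg : Measurable g) : ∫⁻ c, g (resetAge c) ∂m.channelLaw z =
      ∫⁻ c, g c ∂m.channelLaw (z.1, z.1.elim z.2 fun _ ↦ 0) := by
  rw [m.lintegral_configLaw _ _ _ hg]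
  refine (m.lintegral_configLaw _ _ _ (hg.comp measurable_resetAge)).trans ?_
  obtain ⟨_ | i, a⟩ := z <;> rfl

/-- The Markov property at the first attempt. -/
theorem lintegral_runLaw_next {x : Full ι} (hx : 0 ≤ x.2.2.1) {F : Run ι → ENNReal}
    (hF : Measurable F) : ∫⁻ ρ, F (m.next ρ) ∂m.runLaw x =
      ∫⁻ ρ, ∫⁻ ρ', F ρ' ∂m.runLaw (state (m.next ρ)) ∂m.runLaw x := by
  obtain ⟨s, a, j, w, h⟩ := x
  change 0 ≤ j at hx
  -- the run at the next attempt, given the channel `c` there and the losses `l₀` of this window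
  let G : (ℕ → Bool) → Config ι → (ℕ × ℕ → Bool) → Run ι := fun l₀ c l ↦
    (resetAge c, (m.nextGap s c.1 j, m.nextWindow (lossSample fun q ↦ l₀ q.2) 0 s w h), l)
  have hG : Measurable fun p : (ℕ → Bool) × Config ι × (ℕ × ℕ → Bool) ↦ G p.1 p.2.1 p.2.2 := by
    refine (measurable_resetAge.comp measurable_snd.fst).prodMk
      (Measurable.prodMk (Measurable.prodMk ?_ ?_) measurable_snd.snd)
    · exact m.measurable_nextGap.comp ((measurable_const.prodMk measurable_snd.fst.fst).prodMk
        measurable_const)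
    · have h1 : Measurable fun p : (ℕ → Bool) × Config ι × (ℕ × ℕ → Bool) ↦
          fun q : ℕ × ℕ ↦ p.1 q.2 :=
        measurable_pi_lambda _ fun q ↦ (measurable_pi_apply q.2).comp measurable_fst
      exact (m.measurable_nextWindow 0).comp
        ((measurable_const : Measurable fun _ ↦ (s, w, h)).prodMk h1)
  let B : Measure (ℕ → Bool) := Measure.infinitePi fun _ ↦ bernoulliMeasure true false m.p
  have hadv : Measurable fun c : Config ι ↦ advance j c :=
    measurable_advance.comp (measurable_const.prodMk measurable_id)
  have expand : ∀ F : Run ι → ENNReal, Measurable F →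
      ∫⁻ ρ, F (m.next ρ) ∂m.runLaw (s, a, j, w, h) =
      ∫⁻ l₀, ∫⁻ c, ∫⁻ l, F (G l₀ (advance j c) l) ∂m.lossLaw ∂m.channelLaw (s, a) ∂B := by
    intro F hF
    refine (m.lintegral_runLaw _ (hF.comp m.measurable_next)).trans ?_
    have h1 : ∀ᵐ c ∂m.channelLaw (s, a), ∫⁻ l, F (m.next (c, (j, w, h), l)) ∂m.lossLaw =
        ∫⁻ l₀, ∫⁻ l, F (G l₀ (advance j c) l) ∂m.lossLaw ∂B := by
      filter_upwards [m.ae_configLaw_fst s a (m.residualLaw (s, a))] with c hc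
      have h2 : Measurable fun p : (ℕ → Bool) × (ℕ × ℕ → Bool) ↦ F (G p.1 (advance j c) p.2) :=
        hF.comp (hG.comp (measurable_fst.prodMk (measurable_const.prodMk measurable_snd)))
      have h3 := (measurePreserving_splitRow (S := ℕ)
        fun _ ↦ bernoulliMeasure true false m.p).lintegral_comp h2
      rw [lintegral_prod _ h2.aemeasurable] at h3
      refine Eq.trans (lintegral_congr fun l ↦ ?_) h3
      congr 1
      refine Prod.ext rfl (Prod.ext (Prod.ext ?_ ?_) rfl)
      · simp only [next, G, hc.1]
      · simp only [next, G, hc.1]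
        exact m.nextWindow_congr (fun _ ↦ rfl) _ _ _
    refine (lintegral_congr_ae h1).trans ?_
    refine lintegral_lintegral_swap (f := fun c l₀ ↦ ∫⁻ l, F (G l₀ (advance j c) l) ∂m.lossLaw) ?_
    refine (Measurable.lintegral_prod_right'
      (f := fun p : (Config ι × (ℕ → Bool)) × (ℕ × ℕ → Bool) ↦
        F (G p.1.2 (advance j p.1.1) p.2)) ?_).aemeasurable
    exact hF.comp (hG.comp (measurable_fst.snd.prodMk
      ((hadv.comp measurable_fst.fst).prodMk measurable_snd)))
  have hK : Measurable fun ρ : Run ι ↦ ∫⁻ ρ', F ρ' ∂m.runLaw (state ρ) :=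
    (Measurable.lintegral_kernel (κ := m.runLaw) hF).comp measurable_state
  rw [expand F hF, expand (fun ρ ↦ ∫⁻ ρ', F ρ' ∂m.runLaw (state ρ)) hK]
  refine lintegral_congr fun l₀ ↦ ?_
  have h4 : Measurable fun p : Config ι × (ℕ × ℕ → Bool) ↦ F (G l₀ p.1 p.2) :=
    hF.comp (hG.comp (measurable_const.prodMk measurable_id))
  have h5 : Measurable fun c : Config ι ↦ ∫⁻ l, F (G l₀ c l) ∂m.lossLaw :=
    Measurable.lintegral_prod_right' h4
  rw [m.lintegral_advance h5 (m.isLifetime_residualLaw s a) hx]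
  refine lintegral_congr fun c ↦ ?_
  have h6 : ∀ l, state (G l₀ (advance j c) l) = state (G l₀ (advance j c) fun _ ↦ false) :=
    fun l ↦ rfl
  simp_rw [h6]
  rw [lintegral_const, measure_univ, mul_one, m.lintegral_runLaw _ hF]
  refine Eq.trans ?_ (m.lintegral_channelLaw_resetAge ((advance j c).1, (advance j c).2.1) (g :=
    fun c' ↦ ∫⁻ l, F (c', (m.nextGap s (advance j c).1 j,
      m.nextWindow (lossSample fun q ↦ l₀ q.2) 0 s w h), l) ∂m.lossLaw) ?_)
  · refine lintegral_congr_ae ((m.ae_configLaw_fst _ _ _).mono fun c' hc' ↦ ?_)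
    simp only [G, hc'.1]
  · exact Measurable.lintegral_prod_right' (f := fun p : Config ι × (ℕ × ℕ → Bool) ↦
      F (p.1, (m.nextGap s (advance j c).1 j,
        m.nextWindow (lossSample fun q ↦ l₀ q.2) 0 s w h), p.2)) (by fun_prop)

/-! ### The flow is a Markov chain on the admissible states -/

theorem measurable_measure_Ioi : Measurable fun a ↦ m.ν (Ioi a) :=
  Antitone.measurable fun _ _ h ↦ measure_mono (Ioi_subset_Ioi h)

theorem measurableSet_admissible : MeasurableSet {x | m.Admissible x} := by
  have h1 : MeasurableSet {x : Full ι | match x.1 with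
      | some _ => x.2.2.1 = m.R
      | none => 0 ≤ x.2.1 ∧ m.ν (Ioi x.2.1) ≠ 0 ∧ ∃ n : ℕ, x.2.2.1 = min (2 ^ n * m.M) m.Tmax} := by
    have hJ : ∀ b : ℝ, MeasurableSet {x : Full ι | x.2.2.1 = b} := fun b ↦
      measurableSet_eq_fun measurable_snd.snd.fst measurable_const
    have h0 : MeasurableSet {x : Full ι | x.1 = none} :=
      measurableSet_eq_fun measurable_fst measurable_const
    have hoff : MeasurableSet {x : Full ι | 0 ≤ x.2.1 ∧ m.ν (Ioi x.2.1) ≠ 0 ∧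
        ∃ n : ℕ, x.2.2.1 = min (2 ^ n * m.M) m.Tmax} := by
      rw [ofPred_and, ofPred_and, ofPred_exists]
      exact (measurableSet_le measurable_const measurable_snd.fst).inter
        ((measurableSet_eq_fun (m.measurable_measure_Ioi.comp measurable_snd.fst)
          measurable_const).compl.inter (MeasurableSet.iUnion fun n ↦ hJ _))
    convert (h0.inter hoff).union (h0.compl.inter (hJ m.R)) using 1
    ext ⟨s, a, j, w, h⟩
    cases s <;> simp
  have hW : Measurable fun x : Full ι ↦ x.2.2.2 := measurable_snd.snd.snd
  have h2 : MeasurableSet {p : ℕ × ℕ | (1 ≤ p.1 ∧ p.1 ≤ m.Wmax) ∧ 1 ≤ p.2 ∧ p.2 ≤ m.Wmax} :=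
    MeasurableSet.of_discrete
  exact h1.inter (hW h2)

theorem residualLaw_univ_eq_zero {a : ℝ} (h : m.ν (Ioi a) = 0) :
    m.residualLaw (none, a) univ = 0 := by
  rw [← lintegral_one, m.lintegral_residualLaw_none a measurable_const,
    Measure.restrict_eq_zero.2 h]
  simp

theorem residualLaw_none_apply (a : ℝ) {B : Set ℝ} (hB : MeasurableSet B) :
    m.residualLaw (none, a) B = (m.ν (Ioi a))⁻¹ * m.ν (Ioi a ∩ (fun y ↦ y - a) ⁻¹' B) := by
  have hf : Measurable fun y : ℝ ↦ y - a := measurable_id.sub_const a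
  rw [residualLaw, Measure.map_apply hf hB, cond_apply measurableSet_Ioi]

theorem Admissible.residualLaw_univ {x : Full ι} (hx : m.Admissible x) :
    m.residualLaw (x.1, x.2.1) univ = 1 := by
  obtain ⟨_ | i, a, j, w, h⟩ := x
  · rw [m.residualLaw_none_apply a MeasurableSet.univ, preimage_univ, inter_univ,
      ENNReal.inv_mul_cancel hx.1.2.1 (measure_ne_top _ _)]
  · exact (measure_univ : m.sojournLaw (some i) univ = 1)

theorem Admissible.gap_pos {x : Full ι} (hx : m.Admissible x) :
    0 < x.2.2.1 ∧ x.2.2.1 ≤ m.Tmax := by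
  have h1 := m.M_pos
  have h2 := m.M_le_Tmax
  have h3 : m.R ≤ m.M := le_max_left _ _
  obtain ⟨_ | i, a, j, w, h⟩ := x
  · obtain ⟨-, -, n, hn⟩ := hx.1
    change j = _ at hn
    change 0 < j ∧ j ≤ _
    rw [hn]
    exact ⟨lt_min (by positivity) (by linarith), min_le_right _ _⟩
  · have hj : j = m.R := hx.1
    change 0 < j ∧ j ≤ _
    rw [hj]
    exact ⟨m.R_pos, by linarith⟩

theorem Admissible.M_le_gap {a j : ℝ} {w h : ℕ} (hx : m.Admissible (none, a, j, w, h)) :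
    m.M ≤ j := by
  obtain ⟨-, -, n, hn⟩ := hx.1
  change j = _ at hn
  rw [hn]
  refine le_min ?_ m.M_le_Tmax
  have : (1 : ℝ) ≤ 2 ^ n := one_le_pow₀ one_le_two
  nlinarith [m.M_pos]

theorem advance_age_nonneg {c : Config ι} {t : ℝ} (hc : c.1 = none → 0 ≤ c.2.1) (ht : 0 ≤ t)
    (hS : (advance t c).1 = none) : 0 ≤ (advance t c).2.1 := by
  have h1 : ∀ n, (jump^[n] c).1 = none → 0 ≤ (jump^[n] c).2.1 := fun n hn ↦ by
    cases n with
    | zero => exact hc hn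
    | succ n =>
      rw [Function.iterate_succ_apply']
      exact le_rfl
  exact add_nonneg (h1 _ hS) (sub_nonneg.2 (epoch_hops_le ht))

theorem half_bounds {w : ℕ} (hw : w ≤ m.Wmax) : 1 ≤ half w ∧ half w ≤ m.Wmax := by
  have := m.Wmax_pos
  unfold half
  omega

theorem nextWindow_bounds (ω : Sample ι) (k : ℕ) (s : Option ι) {w h : ℕ}
    (hw : 1 ≤ w ∧ w ≤ m.Wmax) (hh : 1 ≤ h ∧ h ≤ m.Wmax) :
    (1 ≤ (m.nextWindow ω k s w h).1 ∧ (m.nextWindow ω k s w h).1 ≤ m.Wmax) ∧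
    (1 ≤ (m.nextWindow ω k s w h).2 ∧ (m.nextWindow ω k s w h).2 ≤ m.Wmax) := by
  have h1 := m.Wmax_pos
  have h2 := m.half_bounds hw.2
  unfold nextWindow
  split_ifs
  · exact ⟨⟨le_rfl, h1⟩, h2⟩
  · exact ⟨h2, h2⟩
  · refine ⟨⟨?_, ?_⟩, hh⟩ <;> dsimp only <;> omega
  · refine ⟨⟨?_, ?_⟩, hh⟩ <;> dsimp only <;> omega

theorem ae_next_admissible {x : Full ι} (hx : m.Admissible x) :
    ∀ᵐ ρ ∂m.runLaw x, m.Admissible (state (m.next ρ)) := by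
  have hj := (hx.gap_pos m).1
  have hmass : ∀ᵐ ρ ∂m.runLaw x, m.runLaw (state (m.next ρ)) univ = 1 := by
    have h1 := m.lintegral_runLaw_next hj.le (F := fun _ ↦ 1) measurable_const
    simp only [lintegral_one] at h1
    have hm : Measurable fun ρ ↦ m.runLaw (state (m.next ρ)) univ :=
      (m.runLaw.measurable_coe MeasurableSet.univ).comp (measurable_state.comp m.measurable_next)
    have hle : ∀ ρ, m.runLaw (state (m.next ρ)) univ ≤ 1 := fun ρ ↦
      (m.runLaw_univ _).trans_le (m.residualLaw_univ_le _)
    have huniv : m.runLaw x univ = 1 := (m.runLaw_univ x).trans (hx.residualLaw_univ m)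
    have h2 : ∫⁻ ρ, (1 - m.runLaw (state (m.next ρ)) univ) ∂m.runLaw x = 0 := by
      rw [lintegral_sub hm (by rw [← h1]; exact measure_ne_top _ _)
        (Filter.Eventually.of_forall hle), ← h1, lintegral_one, huniv, tsub_self]
    have h3 := (lintegral_eq_zero_iff (measurable_const.sub hm)).1 h2
    exact h3.mono fun ρ hρ ↦ le_antisymm (hle ρ) (tsub_eq_zero_iff_le.1 hρ)
  filter_upwards [hmass, m.ae_runLaw_state x] with ρ h1 h2
  obtain ⟨⟨s, a, c⟩, ⟨j, w, h⟩, l⟩ := ρ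
  subst h2
  rw [runLaw_univ] at h1
  refine ⟨?_, m.nextWindow_bounds _ _ _ hx.2.1 hx.2.2⟩
  rcases hS : (advance j (s, a, c)).1 with _ | i
  · have hstate : state (m.next ((s, a, c), (j, w, h), l)) = (none, (advance j (s, a, c)).2.1,
        m.nextGap s none j, m.nextWindow (lossSample l) 0 s w h) := by
      simp only [state, next, resetAge, hS, Option.elim]
    rw [hstate] at h1 ⊢
    dsimp only
    refine ⟨advance_age_nonneg (fun hs ↦ ?_) hj.le hS, fun h0 ↦ ?_, ?_⟩
    · obtain rfl : s = none := hs
      exact hx.1.1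
    · rw [m.residualLaw_univ_eq_zero h0] at h1
      exact zero_ne_one h1
    · cases s with
      | some i => exact ⟨0, by rw [pow_zero, one_mul, min_eq_left m.M_le_Tmax]; rfl⟩
      | none =>
        obtain ⟨-, -, n, hn⟩ := hx.1
        change j = _ at hn
        refine ⟨n + 1, ?_⟩
        change min (2 * j) m.Tmax = _
        have hT : m.Tmax ≤ 2 * m.Tmax := by linarith [m.M_pos, m.M_le_Tmax]
        rw [hn, mul_min_of_nonneg _ _ zero_le_two, min_assoc, min_eq_right hT, pow_succ']
        ring_nf
  · have hstate : state (m.next ((s, a, c), (j, w, h), l)) = (some i, 0,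
        m.R, m.nextWindow (lossSample l) 0 s w h) := by
      simp only [state, next, resetAge, hS, Option.elim, nextGap]
    rw [hstate]

theorem isMarkovShift : IsMarkovShift m.runLaw m.next state {x | m.Admissible x} where
  measurable_shift := m.measurable_next
  measurable_state := measurable_state
  measurableSet_states := m.measurableSet_admissible
  apply_univ x hx := (m.runLaw_univ x).trans (Admissible.residualLaw_univ m hx)
  ae_state x _ := m.ae_runLaw_state x
  ae_mem _ hx := m.ae_next_admissible hx
  lintegral_shift _ hx _ hF := m.lintegral_runLaw_next (Admissible.gap_pos m hx).1.le hF

/-- The full state at a regeneration epoch. -/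
def regFull (i₁ : ι) : Full ι := (some i₁, 0, m.R, 1, 1)

theorem admissible_regFull (i₁ : ι) : m.Admissible (m.regFull i₁) :=
  ⟨rfl, ⟨le_rfl, m.Wmax_pos⟩, le_rfl, m.Wmax_pos⟩

/-- After attempt `0` the chain is in the regeneration state as soon as it is seen there. -/
theorem obs_next_eq_regState {i₁ : ι} (ρ : Run ι) :
    obs (state (m.next ρ)) = m.regState i₁ ↔ state (m.next ρ) = m.regFull i₁ := by
  constructor
  · intro h
    have h1 : (state (m.next ρ)).1 = some i₁ := congrArg Prod.fst h
    have h2 : (state (m.next ρ)).2.2 = (m.R, 1, 1) := congrArg Prod.snd h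
    refine Prod.ext h1 (Prod.ext ?_ h2)
    change Option.elim (advance ρ.2.1.1 ρ.1).1 _ _ = _
    change (advance ρ.2.1.1 ρ.1).1 = _ at h1
    rw [h1]
    rfl
  · intro h
    rw [h]
    rfl

/-! ### Events of positive probability for the channel -/

/-- The law of the channel that has just entered a state. -/
noncomputable def freshLaw : Kernel (Option ι) (Config ι) where
  toFun s := m.configLaw s 0 (m.sojournLaw s)
  measurable' := measurable_of_countable _

instance : IsMarkovKernel m.freshLaw :=
  ⟨fun s ↦ inferInstanceAs (IsProbabilityMeasure (m.configLaw s 0 (m.sojournLaw s)))⟩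

theorem measurable_advance_right (t : ℝ) : Measurable fun c : Config ι ↦ advance t c :=
  measurable_advance.comp (measurable_const.prodMk measurable_id)

/-- What can happen after a jump from `s` to `s'` that occurs at a time in `S` can happen. -/
theorem configLaw_ne_zero_of_jump {s : Option ι} {a : ℝ} {ℓ : Measure ℝ} [SFinite ℓ]
    (hℓ : ∀ᵐ r ∂ℓ, 0 ≤ r) {t : ℝ} {B : Set (Config ι)} (hB : MeasurableSet B) {s' : Option ι}
    (hs' : m.jumpLaw s {s'} ≠ 0) {S : Set ℝ} (hS : MeasurableSet S) (hSt : S ⊆ Iic t)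
    (hℓS : ℓ S ≠ 0) (hpos : ∀ r ∈ S, m.freshLaw s' {c | advance (t - r) c ∈ B} ≠ 0) :
    m.configLaw s a ℓ {c | advance t c ∈ B} ≠ 0 := by
  intro h0
  let F : ℝ → Config ι → ENNReal := fun r c ↦
    {p : ℝ × Config ι | p.1 ∈ S ∧ advance (t - p.1) p.2 ∈ B}.indicator 1 (r, c)
  have hF : Measurable (Function.uncurry F) := by
    refine measurable_one.indicator ((measurable_fst hS).inter ?_)
    exact (measurable_advance.comp ((measurable_const.sub measurable_fst).prodMk
      measurable_snd)) hB
  have h1 : ∫⁻ c, F c.2.2.1 (jump c) ∂m.configLaw s a ℓ = 0 := by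
    refine le_antisymm ?_ zero_le
    have hBt : MeasurableSet {c : Config ι | advance t c ∈ B} := measurable_advance_right t hB
    rw [← h0, ← lintegral_indicator_one hBt]
    refine lintegral_mono_ae ((m.ae_regular s a ℓ hℓ).mono fun c hc ↦ ?_)
    dsimp only [F]
    by_cases hr : c.2.2.1 ∈ S ∧ advance (t - c.2.2.1) (jump c) ∈ B
    · have h2 : c ∈ {c : Config ι | advance t c ∈ B} := by
        rw [mem_ofPred_eq, hc.advance_of_le (hSt hr.1)]
        exact hr.2
      rw [indicator_of_mem h2]
      exact indicator_le_self' (fun _ _ ↦ zero_le) _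
    · rw [indicator_of_notMem (show (c.2.2.1, jump c) ∉
        {p : ℝ × Config ι | p.1 ∈ S ∧ advance (t - p.1) p.2 ∈ B} from hr)]
      exact zero_le
  rw [m.lintegral_configLaw_step s a ℓ hF] at h1
  have hK : Measurable fun r ↦ ∫⁻ s', ∫⁻ c, F r c ∂m.freshLaw s' ∂m.jumpLaw s := by
    refine Measurable.lintegral_prod_right' (f := fun p : ℝ × Option ι ↦
      ∫⁻ c, F p.1 c ∂m.freshLaw p.2) ?_
    exact Measurable.lintegral_kernel_prod_right' (κ := m.freshLaw.comap
      (fun p : ℝ × Option ι ↦ p.2) measurable_snd) (f := fun q ↦ F q.1.1 q.2)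
      (hF.comp (measurable_fst.fst.prodMk measurable_snd))
  have h2 := (lintegral_eq_zero_iff hK).1 h1
  refine hℓS (measure_mono_null (fun r hr ↦ ?_) h2)
  rw [mem_compl_iff, mem_ofPred_eq, Pi.zero_apply]
  intro h3
  have h4 := (lintegral_eq_zero_iff (measurable_of_countable _)).1 h3
  refine hs' (measure_mono_null ?_ h4)
  rintro _ rfl
  rw [mem_compl_iff, mem_ofPred_eq, Pi.zero_apply]
  intro h5
  refine hpos r hr ?_
  have hBt : MeasurableSet {c : Config ι | advance (t - r) c ∈ B} :=
    measurable_advance_right (t - r) hB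
  rw [← lintegral_indicator_one hBt, ← h5]
  refine lintegral_congr fun c ↦ ?_
  dsimp only [F]
  by_cases hc : advance (t - r) c ∈ B
  · rw [indicator_of_mem (show c ∈ {c : Config ι | advance (t - r) c ∈ B} from hc),
      indicator_of_mem (show (r, c) ∈ {p : ℝ × Config ι | p.1 ∈ S ∧ advance (t - p.1) p.2 ∈ B}
        from ⟨hr, hc⟩)]
    rfl
  · rw [indicator_of_notMem (show c ∉ {c : Config ι | advance (t - r) c ∈ B} from hc),
      indicator_of_notMem (show (r, c) ∉ {p : ℝ × Config ι | p.1 ∈ S ∧ advance (t - p.1) p.2 ∈ B}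
        from fun h ↦ hc h.2)]

theorem measurableSet_lt_residual (t : ℝ) : MeasurableSet {c : Config ι | t < c.2.2.1} :=
  measurableSet_lt measurable_const measurable_snd.snd.fst

theorem configLaw_lt_residual (s : Option ι) (a : ℝ) (ℓ : Measure ℝ) [SFinite ℓ] (t : ℝ) :
    m.configLaw s a ℓ {c | t < c.2.2.1} = ℓ (Ioi t) := by
  have h1 := measurableSet_lt_residual (ι := ι) t
  rw [← lintegral_indicator_one h1, m.lintegral_configLaw s a ℓ (measurable_one.indicator h1),
    ← lintegral_indicator_one measurableSet_Ioi]
  refine lintegral_congr fun r ↦ ?_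
  simp only [indicator, mem_ofPred_eq, mem_Ioi, Pi.one_apply, lintegral_const, measure_univ,
    mul_one]

/-- The channel stays in its state for the time `t` if the residual time can exceed `t`. -/
theorem configLaw_ge_of_stay {s : Option ι} {a : ℝ} {ℓ : Measure ℝ} [SFinite ℓ] {t : ℝ}
    {B : Set (Config ι)}
    (hmem : ∀ r w, t < r → (s, a + t, r - t, w) ∈ B) :
    ℓ (Ioi t) ≤ m.configLaw s a ℓ {c | advance t c ∈ B} := by
  rw [← m.configLaw_lt_residual s a ℓ t]
  refine measure_mono_ae ?_
  filter_upwards [m.ae_configLaw_fst s a ℓ] with c hc hlt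
  obtain ⟨s', a', r, w⟩ := c
  obtain ⟨rfl, rfl⟩ := hc
  change advance t _ ∈ B
  rw [advance_of_lt hlt]
  exact hmem r w hlt

theorem measurableSet_state_eq (s : Option ι) : MeasurableSet {c : Config ι | c.1 = s} :=
  measurableSet_eq_fun measurable_fst measurable_const

theorem expMeasure_Ioo_ne_zero {r t : ℝ} (hr : 0 < r) (ht : 0 < t) :
    expMeasure r (Ioo 0 t) ≠ 0 := by
  refine expMeasure_ne_zero hr measurableSet_Ioo ?_
  rw [inter_eq_left.2 Ioo_subset_Ioi_self, Real.volume_Ioo]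
  simpa using ht

/-- From every phase every phase can be reached in every positive time. -/
theorem freshLaw_phase_ne_zero (i j : ι) {t : ℝ} (ht : 0 < t) :
    m.freshLaw (some i) {c | (advance t c).1 = some j} ≠ 0 := by
  have hB := measurableSet_state_eq (some j)
  -- the claim holds along any path to `some j`, which cannot pass through the absorbing state
  have key : ∀ s, Leads m.Q s (some j) →
      s ≠ none ∧ ∀ t, 0 < t → m.freshLaw s {c | (advance t c).1 = some j} ≠ 0 := by
    intro s hs
    induction hs using Relation.ReflTransGen.head_induction_on with
    | refl =>
      refine ⟨by simp, fun t ht ↦ ?_⟩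
      refine ne_of_gt (lt_of_lt_of_le ?_ (m.configLaw_ge_of_stay (t := t)
        (B := {c | c.1 = some j}) fun r w _ ↦ rfl))
      rw [sojournLaw_some, expMeasure_Ioi (m.rate_pos j) ht.le]
      simp [Real.exp_pos]
    | @head b d hbd _ ih =>
      have hb : b ≠ none := by
        rintro rfl
        rw [m.absorbing] at hbd
        exact lt_irrefl _ hbd
      obtain ⟨k, rfl⟩ := Option.ne_none_iff_exists'.1 hb
      refine ⟨hb, fun t ht ↦ ?_⟩
      refine m.configLaw_ne_zero_of_jump (m.ae_nonneg_sojournLaw _) hB (m.jumpLaw_some_ne_zero hbd)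
        (S := Ioo 0 t) measurableSet_Ioo (fun r hr ↦ hr.2.le)
        (expMeasure_Ioo_ne_zero (m.rate_pos k) ht) fun r hr ↦ ?_
      exact ih.2 (t - r) (by linarith [hr.2])
  exact (key _ (m.irreducible i j)).2 t ht

theorem measurableSet_off {B : Set ℝ} (hB : MeasurableSet B) :
    MeasurableSet {c : Config ι | c.1 = none ∧ c.2.1 ∈ B} :=
  (measurableSet_state_eq none).inter (measurable_snd.fst hB)

/-- Started in an ON phase, the age of an OFF period at time `t` is in every given set of ages in
`(0, t)` of positive Lebesgue measure with positive probability. -/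
theorem freshLaw_off_ne_zero (i : ι) {t : ℝ} {B : Set ℝ} (hB : MeasurableSet B)
    (hBν : ∀ b ∈ B, m.ν (Ioi b) ≠ 0) (hvol : volume (B ∩ Ioo 0 t) ≠ 0) :
    m.freshLaw (some i) {c | (advance t c).1 = none ∧ (advance t c).2.1 ∈ B} ≠ 0 := by
  have hBm := measurableSet_off (ι := ι) hB
  have key : ∀ s, Leads m.Q s none → s ≠ none → ∀ t, volume (B ∩ Ioo 0 t) ≠ 0 →
      m.freshLaw s {c | (advance t c).1 = none ∧ (advance t c).2.1 ∈ B} ≠ 0 := by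
    intro s hs
    induction hs using Relation.ReflTransGen.head_induction_on with
    | refl => exact fun h ↦ absurd rfl h
    | @head b d hbd _ ih =>
      intro hb t hvol
      obtain ⟨k, rfl⟩ := Option.ne_none_iff_exists'.1 hb
      rcases eq_or_ne d none with rfl | hd
      · -- the OFF period starts at time `r` and lasts longer than `t - r`
        have hS : MeasurableSet ((fun r ↦ t - r) ⁻¹' (B ∩ Ioo 0 t)) :=
          (measurable_const.sub measurable_id) (hB.inter measurableSet_Ioo)
        refine m.configLaw_ne_zero_of_jump (m.ae_nonneg_sojournLaw _) hBm
          (m.jumpLaw_some_ne_zero hbd) hS (fun r hr ↦ ?_) ?_ fun r hr ↦ ?_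
        · have := hr.2.1
          simp only [mem_Iic]
          linarith
        · refine expMeasure_ne_zero (m.rate_pos k) hS ?_
          have hsub : (fun r ↦ t - r) ⁻¹' (B ∩ Ioo 0 t) ⊆ Ioi 0 := fun r hr ↦ by
            have := hr.2.2
            simp only [mem_Ioi]
            linarith
          rw [inter_eq_left.2 hsub, (Measure.measurePreserving_sub_left volume t).measure_preimage
            (hB.inter measurableSet_Ioo).nullMeasurableSet]
          exact hvol
        · refine ne_of_gt (lt_of_lt_of_le (pos_iff_ne_zero.2 (hBν _ hr.1))
            (m.configLaw_ge_of_stay (t := t - r) (B := {c | c.1 = none ∧ c.2.1 ∈ B})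
              fun r' w _ ↦ ⟨rfl, ?_⟩))
          change 0 + (t - r) ∈ B
          rw [zero_add]
          exact hr.1
      · -- the first jump takes place early enough
        obtain ⟨r₀, hr₀, hvol₀⟩ : ∃ r₀, 0 < r₀ ∧ volume (B ∩ Ioo 0 (t - r₀)) ≠ 0 := by
          by_contra! hcon
          refine hvol (measure_mono_null (t := ⋃ n : ℕ, B ∩ Ioo 0 (t - 1 / (n + 1))) ?_
            (measure_iUnion_null fun n ↦ hcon _ (by positivity)))
          rintro x ⟨hx, hx0, hxt⟩
          obtain ⟨n, hn⟩ := exists_nat_one_div_lt (sub_pos.2 hxt)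
          exact mem_iUnion.2 ⟨n, hx, hx0, by linarith⟩
        have htpos : r₀ < t := by
          by_contra! hle
          rw [Ioo_eq_empty (by linarith), inter_empty, measure_empty] at hvol₀
          exact hvol₀ rfl
        refine m.configLaw_ne_zero_of_jump (m.ae_nonneg_sojournLaw _) hBm
          (m.jumpLaw_some_ne_zero hbd) (S := Ioo 0 r₀) measurableSet_Ioo
          (fun r hr ↦ (hr.2.trans htpos).le) (expMeasure_Ioo_ne_zero (m.rate_pos k) hr₀)
          fun r hr ↦ ih hd (t - r) fun h0 ↦ hvol₀ (measure_mono_null ?_ h0)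
        exact inter_subset_inter_right _ (Ioo_subset_Ioo_right (by linarith [hr.2]))
  exact key _ (m.exits i) (by simp) t hvol

theorem exists_start : ∃ j : ι, m.jumpLaw none {some j} ≠ 0 := by
  by_contra! hcon
  have h1 : m.jumpLaw none univ = 0 := by
    have : (univ : Set (Option ι)) ⊆ {none} ∪ ⋃ j : ι, {some j} := by
      rintro (_ | j) -
      · exact Or.inl rfl
      · exact Or.inr (mem_iUnion.2 ⟨j, rfl⟩)
    exact measure_mono_null this (measure_union_null m.jumpLaw_none_none (measure_iUnion_null hcon))
  rw [measure_univ] at h1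
  exact one_ne_zero h1

theorem inv_measure_ne_zero (B : Set ℝ) : (m.ν B)⁻¹ ≠ 0 :=
  ENNReal.inv_ne_zero.2 (measure_ne_top _ _)

/-- An OFF period of age `a` that may end within the time `t` may be followed by phase `j` at
time `t`. -/
theorem channelLaw_off_phase_ne_zero (j : ι) {a t : ℝ} (h : m.ν (Ioo a (a + t)) ≠ 0) :
    m.channelLaw (none, a) {c | (advance t c).1 = some j} ≠ 0 := by
  obtain ⟨k, hk⟩ := m.exists_start
  refine m.configLaw_ne_zero_of_jump ((m.ae_pos_residualLaw none a).mono fun _ h ↦ h.le)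
    (measurableSet_state_eq (some j)) hk (S := Ioo 0 t) measurableSet_Ioo (fun r hr ↦ hr.2.le) ?_
    fun r hr ↦ m.freshLaw_phase_ne_zero k j (by linarith [hr.2])
  rw [m.residualLaw_none_apply a measurableSet_Ioo]
  refine mul_ne_zero (m.inv_measure_ne_zero _) fun h0 ↦ h (measure_mono_null ?_ h0)
  rintro y ⟨h1, h2⟩
  refine ⟨h1, ?_, ?_⟩ <;> dsimp only <;> linarith

theorem channelLaw_off_stay_ne_zero {a t : ℝ} (ht : 0 ≤ t) (h : m.ν (Ioi (a + t)) ≠ 0) :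
    m.channelLaw (none, a)
      {c | (advance t c).1 = none ∧ (advance t c).2.1 ∈ ({a + t} : Set ℝ)} ≠ 0 := by
  refine ne_of_gt (lt_of_lt_of_le (pos_iff_ne_zero.2 ?_) (m.configLaw_ge_of_stay (t := t)
    (B := {c | c.1 = none ∧ c.2.1 ∈ ({a + t} : Set ℝ)}) fun r w _ ↦ ⟨rfl, rfl⟩))
  rw [m.residualLaw_none_apply a measurableSet_Ioi]
  refine mul_ne_zero (m.inv_measure_ne_zero _) fun h0 ↦ h (measure_mono_null (fun y hy ↦ ?_) h0)
  simp only [mem_Ioi] at hy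
  refine ⟨?_, ?_⟩
  · simp only [mem_Ioi]
    linarith
  · simp only [mem_preimage, mem_Ioi]
    linarith

theorem runLaw_channel (x : Full ι) {B : Set (Config ι)} (hB : MeasurableSet B) :
    m.runLaw x {ρ | ρ.1 ∈ B} = m.channelLaw (x.1, x.2.1) B := by
  have hBr : MeasurableSet {ρ : Run ι | ρ.1 ∈ B} := measurable_fst hB
  rw [← lintegral_indicator_one hBr, m.lintegral_runLaw x (measurable_one.indicator hBr),
    ← lintegral_indicator_one hB]
  refine lintegral_congr fun c ↦ ?_
  have e : ∀ l, {ρ : Run ι | ρ.1 ∈ B}.indicator (1 : Run ι → ENNReal) (c, x.2.2, l) =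
      B.indicator 1 c := fun _ ↦ rfl
  simp only [e, lintegral_const, measure_univ, mul_one]

/-! ### Reaching the regeneration state -/

/-- The probability to be in the regeneration state at attempt `n`. -/
noncomputable def reach (i₁ : ι) (n : ℕ) (x : Full ι) : ENNReal :=
  m.runLaw x {ρ | state (m.next^[n] ρ) = m.regFull i₁}

theorem measurableSet_reach (i₁ : ι) (n : ℕ) :
    MeasurableSet {ρ | state (m.next^[n] ρ) = m.regFull i₁} :=
  m.isMarkovShift.measurable_iterate n (measurableSet_singleton _)

theorem measurable_reach (i₁ : ι) (n : ℕ) : Measurable (m.reach i₁ n) :=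
  m.runLaw.measurable_coe (m.measurableSet_reach i₁ n)

theorem reach_add (i₁ : ι) (n k : ℕ) {x : Full ι} (hx : m.Admissible x) :
    m.reach i₁ (n + k) x = ∫⁻ ρ, m.reach i₁ n (state (m.next^[k] ρ)) ∂m.runLaw x := by
  have := m.isMarkovShift.measure_iterate_preimage k (m.measurableSet_reach i₁ n) (x := x) hx
  unfold reach
  rw [← this]
  congr 1
  ext ρ
  simp only [mem_preimage, mem_ofPred_eq, Function.iterate_add_apply]

/-- If with positive probability the channel at the next attempt is such that the regeneration
state can be reached from there in `n` steps, then it can be reached in `n + 1` steps. -/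
theorem reach_succ_ne_zero {i₁ : ι} {n : ℕ} {x : Full ι} (hx : m.Admissible x)
    {B : Set (Config ι)} (hB : MeasurableSet B)
    (hpos : m.channelLaw (x.1, x.2.1) {c | advance x.2.2.1 c ∈ B} ≠ 0)
    (h : ∀ c ∈ B, ∀ l, m.reach i₁ n ((resetAge c).1, (resetAge c).2.1,
      m.nextGap x.1 c.1 x.2.2.1, m.nextWindow (lossSample l) 0 x.1 x.2.2.2.1 x.2.2.2.2) ≠ 0) :
    m.reach i₁ (n + 1) x ≠ 0 := by
  intro h0
  rw [m.reach_add i₁ n 1 hx] at h0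
  replace h0 := (lintegral_eq_zero_iff ((m.measurable_reach i₁ n).comp
    (m.isMarkovShift.measurable_iterate 1))).1 h0
  have hBx : MeasurableSet {c | advance x.2.2.1 c ∈ B} := measurable_advance_right _ hB
  rw [← m.runLaw_channel x hBx] at hpos
  refine hpos (measure_mono_null_ae ?_ h0)
  filter_upwards [m.ae_runLaw_state x] with ρ hρ hmem
  subst hρ
  exact h _ hmem ρ.2.2

theorem nextWindow_none (ω : Sample ι) (k w h : ℕ) : m.nextWindow ω k none w h = (1, half w) :=
  if_pos rfl

theorem half_one : half 1 = 1 := rfl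

/-- After a timeout with window size `1` the flow may regenerate. -/
theorem reach_one_ne_zero (i₁ : ι) {a j : ℝ} {h : ℕ} (hx : m.Admissible (none, a, j, 1, h))
    (hν : m.ν (Ioo a (a + j)) ≠ 0) : m.reach i₁ 1 (none, a, j, 1, h) ≠ 0 := by
  refine m.reach_succ_ne_zero hx (measurableSet_state_eq (some i₁))
    (m.channelLaw_off_phase_ne_zero i₁ hν) fun c hc l ↦ ?_
  change c.1 = some i₁ at hc
  have e : (((resetAge c).1, (resetAge c).2.1, m.nextGap none c.1 j,
      m.nextWindow (lossSample l) 0 none 1 h) : Full ι) = m.regFull i₁ := by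
    rw [nextWindow_none, half_one, resetAge, hc]
    rfl
  change m.reach i₁ 0 ((resetAge c).1, (resetAge c).2.1, m.nextGap none c.1 j,
      m.nextWindow (lossSample l) 0 none 1 h) ≠ 0
  rw [e]
  refine ne_of_gt (lt_of_lt_of_le one_pos ?_)
  rw [← m.isMarkovShift.apply_univ (m.regFull i₁) (m.admissible_regFull i₁)]
  refine measure_mono_ae ?_
  filter_upwards [m.ae_runLaw_state (m.regFull i₁)] with ρ hρ _
  exact hρ

theorem admissible_off_next {a j : ℝ} {w h : ℕ} (hx : m.Admissible (none, a, j, w, h))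
    (hν : m.ν (Ioi (a + j)) ≠ 0) :
    m.Admissible (none, a + j, min (2 * j) m.Tmax, 1, half w) := by
  have hj := (hx.gap_pos m).1
  obtain ⟨⟨ha, -, n, hn⟩, hw, -⟩ := hx
  change j = _ at hn
  change 0 ≤ a at ha
  change 0 < j at hj
  refine ⟨⟨by positivity, hν, n + 1, ?_⟩, ⟨le_rfl, m.Wmax_pos⟩, m.half_bounds hw.2⟩
  have hT : m.Tmax ≤ 2 * m.Tmax := by linarith [m.M_pos, m.M_le_Tmax]
  change min (2 * j) m.Tmax = _
  rw [hn, mul_min_of_nonneg _ _ zero_le_two, min_assoc, min_eq_right hT, pow_succ']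
  ring_nf

/-- The OFF period may last until the next attempt, which then fails as well. -/
theorem reach_succ_ne_zero_of_off {i₁ : ι} {n : ℕ} {a j : ℝ} {w h : ℕ}
    (hx : m.Admissible (none, a, j, w, h)) (hν : m.ν (Ioi (a + j)) ≠ 0)
    (hn : m.reach i₁ n (none, a + j, min (2 * j) m.Tmax, 1, half w) ≠ 0) :
    m.reach i₁ (n + 1) (none, a, j, w, h) ≠ 0 := by
  refine m.reach_succ_ne_zero hx (measurableSet_off (measurableSet_singleton (a + j)))
    (m.channelLaw_off_stay_ne_zero (hx.gap_pos m).1.le hν) fun c hc l ↦ ?_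
  obtain ⟨h1, h2⟩ := hc
  rw [mem_singleton_iff] at h2
  convert hn using 2
  dsimp only
  rw [nextWindow_none, resetAge, h1, h2]
  rfl

/-- An OFF period of suitable age may be found at the first attempt after an ON phase. -/
theorem reach_succ_ne_zero_of_on {i₁ i : ι} {n : ℕ} {w h : ℕ}
    (hx : m.Admissible (some i, 0, m.R, w, h)) {B : Set ℝ} (hB : MeasurableSet B)
    (hBν : ∀ b ∈ B, m.ν (Ioi b) ≠ 0) (hvol : volume (B ∩ Ioo 0 m.R) ≠ 0)
    (hn : ∀ b ∈ B, ∀ w' h', (1 ≤ w' ∧ w' ≤ m.Wmax) → (1 ≤ h' ∧ h' ≤ m.Wmax) →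
      m.reach i₁ n (none, b, m.M, w', h') ≠ 0) :
    m.reach i₁ (n + 1) (some i, 0, m.R, w, h) ≠ 0 := by
  have h0 : m.channelLaw (some i, 0) {c | advance m.R c ∈ {c | c.1 = none ∧ c.2.1 ∈ B}} ≠ 0 :=
    m.freshLaw_off_ne_zero i hB hBν hvol
  refine m.reach_succ_ne_zero hx (measurableSet_off hB) h0 fun c hc l ↦ ?_
  obtain ⟨h1, h2⟩ := hc
  have hW := m.nextWindow_bounds (lossSample l) 0 (some i) hx.2.1 hx.2.2
  have := hn c.2.1 h2 _ _ hW.1 hW.2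
  convert this using 2
  dsimp only
  rw [resetAge, h1]
  rfl

/-- An ON phase may last until the next attempt. -/
theorem reach_succ_ne_zero_of_on_stay {i₁ i : ι} {n : ℕ} {a : ℝ} {w h : ℕ}
    (hx : m.Admissible (some i, a, m.R, w, h))
    (hn : ∀ w' h', (1 ≤ w' ∧ w' ≤ m.Wmax) → (1 ≤ h' ∧ h' ≤ m.Wmax) →
      m.reach i₁ n (some i, 0, m.R, w', h') ≠ 0) :
    m.reach i₁ (n + 1) (some i, a, m.R, w, h) ≠ 0 := by
  refine m.reach_succ_ne_zero hx (measurableSet_state_eq (some i)) ?_ fun c hc l ↦ ?_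
  · refine ne_of_gt (lt_of_lt_of_le ?_ (m.configLaw_ge_of_stay
      (B := {c | c.1 = some i}) fun r w _ ↦ rfl))
    change 0 < expMeasure (m.rate i) (Ioi m.R)
    rw [expMeasure_Ioi (m.rate_pos i) m.R_pos.le]
    simp [Real.exp_pos]
  change c.1 = some i at hc
  have hW := m.nextWindow_bounds (lossSample l) 0 (some i) hx.2.1 hx.2.2
  have := hn _ _ hW.1 hW.2
  convert this using 2
  dsimp only
  rw [resetAge, hc]
  rfl

theorem measurableSet_measure_Ioo_ne_zero (u v : ℝ) :
    MeasurableSet {s | m.ν (Ioo (s + u) (s + v)) ≠ 0} := by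
  have h : MeasurableSet {z : ℝ × ℝ | z.1 + u < z.2 ∧ z.2 < z.1 + v} :=
    (measurableSet_lt (measurable_fst.add_const u) measurable_snd).inter
      (measurableSet_lt measurable_snd (measurable_fst.add_const v))
  exact (measurable_measure_prodMk_left (ν := m.ν) h (measurableSet_singleton 0)).compl

/-- The number of attempts after which the flow may regenerate can be chosen independently of the
ON state it starts from: two timeouts, or three, reset window and threshold, and the next attempt
may find the channel in phase `i₁`. -/
theorem exists_reach_ne_zero (i₁ : ι) {ε₀ : ℝ} (hε₀ : 0 < ε₀)
    (hmid : ∀ s : ℝ, 0 ≤ s → s ≤ m.R → ε₀ ≤ m.ν.real (Ioo (s + m.M) (s + 3 * m.M))) :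
    ∃ n, ∀ i w h, (1 ≤ w ∧ w ≤ m.Wmax) → (1 ≤ h ∧ h ≤ m.Wmax) →
      m.reach i₁ n (some i, 0, m.R, w, h) ≠ 0 := by
  have hM := m.M_pos
  have hMT := m.M_le_Tmax
  have hmid' : ∀ s ∈ Ioo 0 m.R, m.ν (Ioo (s + m.M) (s + 3 * m.M)) ≠ 0 := fun s hs h0 ↦ by
    have := hmid s hs.1.le hs.2.le
    rw [measureReal_def, h0] at this
    simp at this
    linarith
  have hpos1 : ∀ s ∈ Ioo 0 m.R, m.ν (Ioi (s + m.M)) ≠ 0 := fun s hs h0 ↦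
    hmid' s hs (measure_mono_null Ioo_subset_Ioi_self h0)
  have hpos0 : ∀ s ∈ Ioo 0 m.R, m.ν (Ioi s) ≠ 0 := fun s hs h0 ↦
    hpos1 s hs (measure_mono_null (Ioi_subset_Ioi (by linarith)) h0)
  have hon : ∀ (i : ι) {w h : ℕ}, (1 ≤ w ∧ w ≤ m.Wmax) → (1 ≤ h ∧ h ≤ m.Wmax) →
      m.Admissible (some i, 0, m.R, w, h) := fun i w h hw hh ↦ ⟨rfl, hw, hh⟩
  have hoff : ∀ s ∈ Ioo 0 m.R, ∀ {w h : ℕ}, (1 ≤ w ∧ w ≤ m.Wmax) → (1 ≤ h ∧ h ≤ m.Wmax) →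
      m.Admissible (none, s, m.M, w, h) := fun s hs w h hw hh ↦
    ⟨⟨hs.1.le, hpos0 s hs, 0, by rw [pow_zero, one_mul, min_eq_left hMT]⟩, hw, hh⟩
  let J₂ := min (2 * m.M) m.Tmax
  let J₃ := min (2 * J₂) m.Tmax
  let B₃ := {s | m.ν (Ioo (s + m.M) (s + (m.M + J₂))) ≠ 0} ∩ Ioo 0 m.R
  let B₄ := {s | m.ν (Ioo (s + (m.M + J₂)) (s + (m.M + J₂ + J₃))) ≠ 0} ∩ Ioo 0 m.R
  have hB₃ : MeasurableSet B₃ := (m.measurableSet_measure_Ioo_ne_zero _ _).inter measurableSet_Ioo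
  have hB₄ : MeasurableSet B₄ := (m.measurableSet_measure_Ioo_ne_zero _ _).inter measurableSet_Ioo
  by_cases hvol : volume B₃ = 0
  · -- for almost every `s` an OFF period of age `s` that exceeds `s + M` exceeds `s + M + J₂`
    refine ⟨4, fun i w h hw hh ↦ ?_⟩
    have hcount : Set.Countable {y : ℝ | m.ν {y} ≠ 0} := by
      have := Measure.countable_meas_pos_of_disjoint_iUnion (μ := m.ν) (As := fun y : ℝ ↦ {y})
        (fun y ↦ measurableSet_singleton y) (fun x y hxy ↦ by simpa using hxy)
      simpa only [pos_iff_ne_zero] using this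
    have hatoms : volume ((fun s ↦ s + (m.M + J₂)) ⁻¹' {y : ℝ | m.ν {y} ≠ 0}) = 0 := by
      rw [measure_preimage_add_right]
      exact hcount.measure_zero volume
    have hcov : Ioo 0 m.R ⊆ B₃ ∪ ((fun s ↦ s + (m.M + J₂)) ⁻¹' {y : ℝ | m.ν {y} ≠ 0} ∪ B₄) := by
      intro s hs
      by_contra hcon
      simp only [mem_union, not_or] at hcon
      obtain ⟨h3, ha, h4⟩ := hcon
      have h3' : m.ν (Ioo (s + m.M) (s + (m.M + J₂))) = 0 := by
        by_contra hne
        exact h3 ⟨hne, hs⟩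
      have h4' : m.ν (Ioo (s + (m.M + J₂)) (s + (m.M + J₂ + J₃))) = 0 := by
        by_contra hne
        exact h4 ⟨hne, hs⟩
      have ha' : m.ν {s + (m.M + J₂)} = 0 := by
        by_contra hne
        exact ha hne
      have hlen : s + 3 * m.M ≤ s + (m.M + J₂ + J₃) := by
        have e1 : J₂ = min (2 * m.M) m.Tmax := rfl
        have e2 : J₃ = min (2 * J₂) m.Tmax := rfl
        rcases le_total (2 * m.M) m.Tmax with hle | hle
        · rw [min_eq_left hle] at e1
          have : 0 ≤ J₃ := e2 ▸ le_min (by linarith) (by linarith)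
          linarith
        · rw [min_eq_right hle] at e1
          rw [min_eq_right (by linarith)] at e2
          linarith
      refine hmid' s hs (measure_mono_null (t := Ioo (s + m.M) (s + (m.M + J₂)) ∪
        ({s + (m.M + J₂)} ∪ Ioo (s + (m.M + J₂)) (s + (m.M + J₂ + J₃)))) (fun y hy ↦ ?_)
        (measure_union_null h3' (measure_union_null ha' h4')))
      rcases lt_trichotomy y (s + (m.M + J₂)) with hlt | heq | hgt
      · exact Or.inl ⟨hy.1, hlt⟩
      · exact Or.inr (Or.inl heq)
      · exact Or.inr (Or.inr ⟨hgt, hy.2.trans_le hlen⟩)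
    have hvol4 : volume (B₄ ∩ Ioo 0 m.R) ≠ 0 := by
      rw [inter_eq_left.2 (fun s hs ↦ hs.2 : B₄ ⊆ Ioo 0 m.R)]
      intro h0
      have := measure_mono_null hcov (measure_union_null hvol (measure_union_null hatoms h0))
      rw [Real.volume_Ioo] at this
      simp only [sub_zero, ENNReal.ofReal_eq_zero] at this
      linarith [m.R_pos]
    refine m.reach_succ_ne_zero_of_on (hon i hw hh) hB₄ (fun s hs ↦ hpos0 s hs.2) hvol4
      fun s hs w' h' hw' hh' ↦ ?_
    have x1 := hoff s hs.2 hw' hh'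
    have x2 := m.admissible_off_next x1 (hpos1 s hs.2)
    have hν : m.ν (Ioi (s + m.M + J₂)) ≠ 0 := fun h0 ↦
      hs.1 (measure_mono_null (by rw [← add_assoc]; exact Ioo_subset_Ioi_self) h0)
    have x3 := m.admissible_off_next x2 hν
    refine m.reach_succ_ne_zero_of_off x1 (hpos1 s hs.2)
      (m.reach_succ_ne_zero_of_off x2 hν (m.reach_one_ne_zero i₁ x3 fun h0 ↦ hs.1 ?_))
    rw [← h0]
    congr 2 <;> ring
  · refine ⟨3, fun i w h hw hh ↦ ?_⟩
    have hvol3 : volume (B₃ ∩ Ioo 0 m.R) ≠ 0 := by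
      rwa [inter_eq_left.2 (fun s hs ↦ hs.2 : B₃ ⊆ Ioo 0 m.R)]
    refine m.reach_succ_ne_zero_of_on (hon i hw hh) hB₃ (fun s hs ↦ hpos0 s hs.2) hvol3
      fun s hs w' h' hw' hh' ↦ ?_
    have x1 := hoff s hs.2 hw' hh'
    have x2 := m.admissible_off_next x1 (hpos1 s hs.2)
    refine m.reach_succ_ne_zero_of_off x1 (hpos1 s hs.2)
      (m.reach_one_ne_zero i₁ x2 fun h0 ↦ hs.1 ?_)
    rw [← h0]
    congr 2
    ring

/-! ### A uniform lower bound for regeneration -/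

theorem exists_ne_zero_le {α : Type*} [Finite α] {f : α → ENNReal} (hf : ∀ a, f a ≠ 0) :
    ∃ κ : ENNReal, κ ≠ 0 ∧ ∀ a, κ ≤ f a := by
  rcases isEmpty_or_nonempty α with h | h
  · exact ⟨1, one_ne_zero, fun a ↦ h.elim a⟩
  · obtain ⟨a, ha⟩ := Finite.exists_min f
    exact ⟨f a, hf a, ha⟩

theorem exists_le_reach {i₁ : ι} {n : ℕ} (hn : ∀ i w h, (1 ≤ w ∧ w ≤ m.Wmax) →
      (1 ≤ h ∧ h ≤ m.Wmax) → m.reach i₁ n (some i, 0, m.R, w, h) ≠ 0) :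
    ∃ κ : ENNReal, κ ≠ 0 ∧ ∀ i w h, (1 ≤ w ∧ w ≤ m.Wmax) → (1 ≤ h ∧ h ≤ m.Wmax) →
      κ ≤ m.reach i₁ n (some i, 0, m.R, w, h) := by
  obtain ⟨κ, hκ, hle⟩ := exists_ne_zero_le (α := ι × Icc 1 m.Wmax × Icc 1 m.Wmax)
    (f := fun z ↦ m.reach i₁ n (some z.1, 0, m.R, z.2.1, z.2.2))
    fun z ↦ hn z.1 _ _ z.2.1.2 z.2.2.2
  exact ⟨κ, hκ, fun i w h hw hh ↦ hle (i, ⟨w, hw⟩, ⟨h, hh⟩)⟩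

theorem state_next_of_on {ρ : Run ι} {i : ι} (h : (state (m.next ρ)).1 = some i) :
    state (m.next ρ) = (some i, 0, m.R, (state (m.next ρ)).2.2.2) := by
  have hS : (advance ρ.2.1.1 ρ.1).1 = some i := h
  simp only [state, next, resetAge, hS, Option.elim, nextGap]

theorem measurableSet_on (k : ℕ) :
    MeasurableSet {ρ : Run ι | (state (m.next^[k] ρ)).1 ≠ none} :=
  measurable_fst.comp (m.isMarkovShift.measurable_iterate k)
    (MeasurableSet.of_discrete (s := {none}ᶜ))

/-- An ON phase at attempt `k + 1` allows regeneration after `n` further attempts, as the age is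
zero and the gap `R` there. -/
theorem mul_le_reach_add {i₁ : ι} {n : ℕ} {κ : ENNReal}
    (hκ : ∀ i w h, (1 ≤ w ∧ w ≤ m.Wmax) → (1 ≤ h ∧ h ≤ m.Wmax) →
      κ ≤ m.reach i₁ n (some i, 0, m.R, w, h)) (k : ℕ) {x : Full ι} (hx : m.Admissible x) :
    κ * m.runLaw x {ρ | (state (m.next^[k + 1] ρ)).1 ≠ none} ≤ m.reach i₁ (n + (k + 1)) x := by
  rw [m.reach_add i₁ n (k + 1) hx, ← lintegral_indicator_const (m.measurableSet_on (k + 1))]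
  refine lintegral_mono_ae ((m.isMarkovShift.ae_iterate_mem (k + 1) x hx).mono fun ρ hρ ↦ ?_)
  by_cases hon : (state (m.next^[k + 1] ρ)).1 = none
  · rw [indicator_of_notMem (fun h : ρ ∈ {ρ | (state (m.next^[k + 1] ρ)).1 ≠ none} ↦ h hon)]
    exact zero_le
  · rw [indicator_of_mem (show ρ ∈ {ρ | (state (m.next^[k + 1] ρ)).1 ≠ none} from hon)]
    obtain ⟨i, hi⟩ := Option.ne_none_iff_exists'.1 hon
    have hb : m.Admissible (state (m.next^[k + 1] ρ)) := hρ
    rw [Function.iterate_succ_apply'] at hi hb ⊢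
    rw [m.state_next_of_on hi] at hb ⊢
    exact hκ i _ _ hb.2.1 hb.2.2

/-- The bound on the residual OFF period that the assumption on `Y_off` given `Y_off ≥ s`
provides; the conditions `Y_off > a` and `Y_off ≥ s` are reconciled by letting `s` decrease
to `a`. -/
theorem le_residualLaw {ε₁ : ℝ} (hres : ∀ s : ℝ, 0 ≤ s → m.ν (Ici s) ≠ 0 →
      ε₁ ≤ (ProbabilityTheory.cond m.ν (Ici s)).real (Iic (s + 2 * m.M)))
    {a : ℝ} (ha : 0 ≤ a) (hν : m.ν (Ioi a) ≠ 0) :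
    ENNReal.ofReal ε₁ ≤ m.residualLaw (none, a) (Iic (2 * m.M)) := by
  have hstep : ∀ s, a < s → ENNReal.ofReal ε₁ * m.ν (Ici s) ≤ m.ν (Ioc a (s + 2 * m.M)) := by
    intro s hs
    by_cases h0 : m.ν (Ici s) = 0
    · simp [h0]
    have h1 := ENNReal.ofReal_le_of_le_toReal (hres s (ha.trans hs.le) h0)
    rw [cond_apply measurableSet_Ici] at h1
    calc ENNReal.ofReal ε₁ * m.ν (Ici s)
        ≤ (m.ν (Ici s))⁻¹ * m.ν (Ici s ∩ Iic (s + 2 * m.M)) * m.ν (Ici s) := mul_le_mul_left h1 _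
      _ = m.ν (Ici s ∩ Iic (s + 2 * m.M)) := by
          rw [mul_right_comm, ENNReal.inv_mul_cancel h0 (measure_ne_top _ _), one_mul]
      _ ≤ m.ν (Ioc a (s + 2 * m.M)) := measure_mono fun y hy ↦ ⟨hs.trans_le hy.1, hy.2⟩
  let s : ℕ → ℝ := fun n ↦ a + 1 / ((n : ℝ) + 1)
  have hs : ∀ n, a < s n := fun n ↦ lt_add_of_pos_right a (by positivity)
  have hanti : Antitone s := fun k n hkn ↦ by
    have : (k : ℝ) ≤ n := by exact_mod_cast hkn
    dsimp only [s]
    gcongr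
  have hlim : Filter.Tendsto s Filter.atTop (nhds a) := by
    simpa only [add_zero] using
      (tendsto_const_nhds (x := a)).add (tendsto_one_div_add_atTop_nhds_zero_nat (𝕜 := ℝ))
  have hU : ⋃ n, Ici (s n) = Ioi a := iUnion_Ici_eq_Ioi_of_lt_of_tendsto hs hlim
  have hI : ⋂ n, Ioc a (s n + 2 * m.M) = Ioc a (a + 2 * m.M) := by
    ext y
    simp only [mem_iInter, mem_Ioc]
    constructor
    · exact fun h ↦ ⟨(h 0).1, ge_of_tendsto' (hlim.add_const _) fun n ↦ (h n).2⟩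
    · exact fun h n ↦ ⟨h.1, h.2.trans (by linarith [hs n])⟩
  have h1 : Filter.Tendsto (fun n ↦ ENNReal.ofReal ε₁ * m.ν (Ici (s n))) Filter.atTop
      (nhds (ENNReal.ofReal ε₁ * m.ν (Ioi a))) := by
    rw [← hU]
    exact ENNReal.Tendsto.const_mul (tendsto_measure_iUnion_atTop
      fun k n hkn ↦ Ici_subset_Ici.2 (hanti hkn)) (Or.inr ENNReal.ofReal_ne_top)
  have h2 : Filter.Tendsto (fun n ↦ m.ν (Ioc a (s n + 2 * m.M))) Filter.atTop
      (nhds (m.ν (Ioc a (a + 2 * m.M)))) := by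
    rw [← hI]
    exact tendsto_measure_iInter_atTop (fun n ↦ measurableSet_Ioc.nullMeasurableSet)
      (fun k n hkn ↦ Ioc_subset_Ioc_right (by linarith [hanti hkn])) ⟨0, measure_ne_top _ _⟩
  have h3 := le_of_tendsto_of_tendsto' h1 h2 fun n ↦ hstep _ (hs n)
  have e : Ioi a ∩ (fun y ↦ y - a) ⁻¹' Iic (2 * m.M) = Ioc a (a + 2 * m.M) := by
    ext y
    simp only [mem_inter_iff, mem_Ioi, mem_preimage, mem_Iic, mem_Ioc]
    refine and_congr_right fun _ ↦ ?_
    rw [sub_le_iff_le_add']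
  rw [m.residualLaw_none_apply a measurableSet_Iic, e]
  calc ENNReal.ofReal ε₁ = (m.ν (Ioi a))⁻¹ * (ENNReal.ofReal ε₁ * m.ν (Ioi a)) := by
        rw [mul_left_comm, ENNReal.inv_mul_cancel hν (measure_ne_top _ _), mul_one]
    _ ≤ _ := mul_le_mul_right h3 _

/-- An OFF period ends within the time `2 M`, and an ON phase longer than `Tmax` follows. -/
def recovery : Set (Config ι) :=
  {c | c.2.2.1 ≤ 2 * m.M ∧ (jump c).1 ≠ none ∧ m.Tmax < (jump c).2.2.1}

theorem measurableSet_recovery : MeasurableSet m.recovery :=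
  (measurableSet_le measurable_snd.snd.fst measurable_const).inter
    ((measurable_jump.fst (MeasurableSet.of_discrete (s := {none}ᶜ))).inter
      (measurableSet_lt measurable_const measurable_jump.snd.snd.fst))

theorem le_channelLaw_recovery {β : ENNReal} (hβ : ∀ i, β ≤ m.sojournLaw (some i) (Ioi m.Tmax))
    (a : ℝ) : m.residualLaw (none, a) (Iic (2 * m.M)) * β ≤ m.channelLaw (none, a) m.recovery := by
  let D : Set (Config ι) := {c | c.1 ≠ none ∧ m.Tmax < c.2.2.1}
  have hD : MeasurableSet D := (measurable_fst (MeasurableSet.of_discrete (s := {none}ᶜ))).inter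
    (measurableSet_lt_residual m.Tmax)
  let F : ℝ → Config ι → ENNReal := fun r c ↦ (Iic (2 * m.M) ×ˢ D).indicator 1 (r, c)
  have hF : Measurable (Function.uncurry F) := measurable_one.indicator (measurableSet_Iic.prod hD)
  have h1 : m.channelLaw (none, a) m.recovery =
      ∫⁻ c, F c.2.2.1 (jump c) ∂m.channelLaw (none, a) := by
    rw [← lintegral_indicator_one m.measurableSet_recovery]
    rfl
  rw [h1, m.lintegral_configLaw_step _ _ _ hF, mul_comm,
    ← lintegral_indicator_const measurableSet_Iic]
  refine lintegral_mono fun r ↦ ?_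
  by_cases hr : r ∈ Iic (2 * m.M)
  · rw [indicator_of_mem hr]
    calc β = ∫⁻ _, β ∂m.jumpLaw none := by simp
      _ ≤ _ := lintegral_mono_ae (m.ae_jumpLaw_none.mono fun s hs ↦ ?_)
    obtain ⟨i, rfl⟩ := Option.ne_none_iff_exists'.1 hs
    have e : ∀ c, F r c = D.indicator 1 c := fun c ↦ by
      by_cases hc : c ∈ D
      · rw [indicator_of_mem hc]
        exact indicator_of_mem (show (r, c) ∈ Iic (2 * m.M) ×ˢ D from ⟨hr, hc⟩) _
      · rw [indicator_of_notMem hc]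
        exact indicator_of_notMem (fun h ↦ hc h.2) _
    simp only [e]
    rw [lintegral_indicator_one hD]
    refine (hβ i).trans ?_
    rw [← m.configLaw_lt_residual (some i) 0 (m.sojournLaw (some i))]
    refine measure_mono_ae ?_
    filter_upwards [m.ae_configLaw_fst (some i) 0 (m.sojournLaw (some i))] with c hc hlt
    exact ⟨by rw [hc.1]; simp, hlt⟩
  · rw [indicator_of_notMem hr]
    exact zero_le

/-- On the event `recovery` one of the next two attempts succeeds. -/
theorem on_of_recovery {ρ : Run ι} (hx : m.Admissible (state ρ)) (hreg : Regular ρ.1)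
    (hS : ρ.1.1 = none) (hrec : ρ.1 ∈ m.recovery) :
    (state (m.next ρ)).1 ≠ none ∨ (state (m.next (m.next ρ))).1 ≠ none := by
  obtain ⟨⟨s, a, r, f⟩, ⟨j, w, h⟩, l⟩ := ρ
  obtain rfl : s = none := hS
  obtain ⟨h2M, hon, hlong⟩ := hrec
  set c : Config ι := (none, a, r, f) with hc
  change r ≤ 2 * m.M at h2M
  have hMj : m.M ≤ j := hx.M_le_gap m
  have hj := hx.gap_pos m
  change 0 < j ∧ j ≤ m.Tmax at hj
  have hr0 : 0 ≤ r := hreg.nonneg 0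
  have hM := m.M_pos
  have hMT := m.M_le_Tmax
  -- the channel is ON at all times `t` that exceed `r` by at most `Tmax`
  have key : ∀ t, r ≤ t → t - r ≤ m.Tmax → (advance t c).1 = (jump c).1 := fun t h1 h2 ↦ by
    rw [hreg.advance_of_le (show c.2.2.1 ≤ t from h1)]
    rw [advance_of_lt (lt_of_le_of_lt h2 hlong)]
  rcases le_or_gt r j with hrj | hrj
  · left
    change (advance j c).1 ≠ none
    rw [key j hrj (by linarith)]
    exact hon
  · right
    have hoff : (advance j c).1 = none := by rw [advance_of_lt (show j < c.2.2.1 from hrj)]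
    change (advance (m.nextGap none (advance j c).1 j) (resetAge (advance j c))).1 ≠ none
    rw [hoff, advance_resetAge_fst]
    change (advance (min (2 * j) m.Tmax) (advance j c)).1 ≠ none
    have hg : m.M ≤ min (2 * j) m.Tmax := le_min (by linarith) hMT
    rw [hreg.advance_advance hj.1.le (by linarith), key]
    · exact hon
    · linarith
    · linarith [min_le_right (2 * j) m.Tmax]

/-- From every admissible state one of the next two attempts succeeds with a probability that is
bounded below. -/
theorem exists_le_on {ε₁ : ℝ} (hε₁ : 0 < ε₁) (hres : ∀ s : ℝ, 0 ≤ s → m.ν (Ici s) ≠ 0 →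
      ε₁ ≤ (ProbabilityTheory.cond m.ν (Ici s)).real (Iic (s + 2 * m.M))) :
    ∃ δ : ENNReal, δ ≠ 0 ∧ ∀ x, m.Admissible x →
      δ ≤ m.runLaw x {ρ | (state (m.next^[1] ρ)).1 ≠ none} +
        m.runLaw x {ρ | (state (m.next^[2] ρ)).1 ≠ none} := by
  have hexp : ∀ t, 0 ≤ t → ∀ i, m.sojournLaw (some i) (Ioi t) ≠ 0 := fun t ht i ↦ by
    rw [sojournLaw_some, expMeasure_Ioi (m.rate_pos i) ht]
    simp [Real.exp_pos]
  obtain ⟨β, hβ0, hβ⟩ := exists_ne_zero_le (hexp m.Tmax (m.M_pos.le.trans m.M_le_Tmax))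
  refine ⟨min β (ENNReal.ofReal ε₁ * β), ?_, fun x hx ↦ ?_⟩
  · refine (lt_min (pos_iff_ne_zero.2 hβ0) (pos_iff_ne_zero.2 (mul_ne_zero ?_ hβ0))).ne'
    simpa using hε₁
  obtain ⟨_ | i, a, j, w, h⟩ := x
  · refine (min_le_right _ _).trans (le_trans ?_ (measure_union_le _ _))
    refine (mul_le_mul_left (m.le_residualLaw hres hx.1.1 hx.1.2.1) β).trans ?_
    refine (m.le_channelLaw_recovery hβ a).trans ?_
    rw [← m.runLaw_channel (none, a, j, w, h) m.measurableSet_recovery]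
    have hreg : ∀ᵐ ρ ∂m.runLaw (none, a, j, w, h), Regular ρ.1 :=
      m.ae_runLaw (measurable_fst measurableSet_regular)
        ((m.ae_regular none a _ ((m.ae_pos_residualLaw none a).mono fun _ h ↦ h.le)).mono
          fun c hc _ ↦ hc)
    refine measure_mono_ae ?_
    filter_upwards [hreg, m.ae_runLaw_state (none, a, j, w, h)] with ρ h1 h2 h3
    exact m.on_of_recovery (h2 ▸ hx) h1 (congrArg Prod.fst h2) h3
  · refine (min_le_left _ _).trans (le_trans ?_ le_self_add)
    have hRT : m.R ≤ m.Tmax := (le_max_left _ _).trans m.M_le_Tmax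
    have hj : j = m.R := hx.1
    have hB : MeasurableSet {c : Config ι | advance j c ∈ {c : Config ι | c.1 = some i}} :=
      measurable_advance_right j (measurableSet_state_eq (some i))
    calc β ≤ m.sojournLaw (some i) (Ioi m.Tmax) := hβ i
      _ ≤ m.sojournLaw (some i) (Ioi j) := measure_mono (Ioi_subset_Ioi (hj ▸ hRT))
      _ ≤ m.channelLaw (some i, a) {c | advance j c ∈ {c : Config ι | c.1 = some i}} :=
          m.configLaw_ge_of_stay fun r w _ ↦ rfl
      _ = m.runLaw (some i, a, j, w, h) {ρ | advance j ρ.1 ∈ {c : Config ι | c.1 = some i}} :=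
          (m.runLaw_channel (some i, a, j, w, h) hB).symm
      _ ≤ _ := by
          refine measure_mono_ae ?_
          filter_upwards [m.ae_runLaw_state (some i, a, j, w, h)] with ρ h1 h2
          have e : ρ.2.1.1 = j := congrArg (fun x ↦ x.2.2.1) h1
          have h3 : (advance ρ.2.1.1 ρ.1).1 = some i := by rw [e]; exact h2
          change (advance ρ.2.1.1 ρ.1).1 ≠ none
          rw [h3]
          simp

/-- The regeneration state can be reached in `n` as well as in `n + 1` attempts from itself, and in
`n + 2` attempts from every admissible state, with a probability that is bounded below. -/
theorem exists_minorization (i₁ : ι) {ε₀ ε₁ : ℝ} (hε₀ : 0 < ε₀) (hε₁ : 0 < ε₁)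
    (hmid : ∀ s : ℝ, 0 ≤ s → s ≤ m.R → ε₀ ≤ m.ν.real (Ioo (s + m.M) (s + 3 * m.M)))
    (hres : ∀ s : ℝ, 0 ≤ s → m.ν (Ici s) ≠ 0 →
      ε₁ ≤ (ProbabilityTheory.cond m.ν (Ici s)).real (Iic (s + 2 * m.M))) :
    ∃ n, m.reach i₁ n (m.regFull i₁) ≠ 0 ∧ m.reach i₁ (n + 1) (m.regFull i₁) ≠ 0 ∧
      ∃ δ : ℝ, 0 < δ ∧ δ < 1 ∧ ∀ x, m.Admissible x → ENNReal.ofReal δ ≤ m.reach i₁ (n + 2) x := by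
  obtain ⟨n, hn⟩ := m.exists_reach_ne_zero i₁ hε₀ hmid
  have hn' : ∀ i w h, (1 ≤ w ∧ w ≤ m.Wmax) → (1 ≤ h ∧ h ≤ m.Wmax) →
      m.reach i₁ (n + 1) (some i, 0, m.R, w, h) ≠ 0 := fun i w h hw hh ↦
    m.reach_succ_ne_zero_of_on_stay ⟨rfl, hw, hh⟩ fun w' h' hw' hh' ↦ hn i w' h' hw' hh'
  have h1 : 1 ≤ 1 ∧ 1 ≤ m.Wmax := ⟨le_rfl, m.Wmax_pos⟩
  refine ⟨n, hn i₁ 1 1 h1 h1, hn' i₁ 1 1 h1 h1, ?_⟩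
  obtain ⟨κ₁, hκ₁, hle₁⟩ := m.exists_le_reach hn'
  obtain ⟨κ₂, hκ₂, hle₂⟩ := m.exists_le_reach hn
  obtain ⟨δ, hδ, hle⟩ := m.exists_le_on hε₁ hres
  let D : ENNReal := min (min κ₁ κ₂ * δ / 2) (1 / 2)
  have hD0 : D ≠ 0 := by
    refine (lt_min (pos_iff_ne_zero.2 ?_) (by simp)).ne'
    refine (ENNReal.div_pos (mul_ne_zero (lt_min (pos_iff_ne_zero.2 hκ₁)
      (pos_iff_ne_zero.2 hκ₂)).ne' hδ) (by simp)).ne'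
  have hD1 : D ≤ 1 / 2 := min_le_right _ _
  have hDtop : D ≠ ⊤ := ne_top_of_le_ne_top (by simp) hD1
  refine ⟨D.toReal, ENNReal.toReal_pos hD0 hDtop, ?_, fun x hx ↦ ?_⟩
  · have := ENNReal.toReal_mono (by simp) hD1
    refine this.trans_lt ?_
    norm_num
  rw [ENNReal.ofReal_toReal hDtop]
  refine (min_le_left _ _).trans ?_
  rw [ENNReal.div_le_iff (by simp) (by simp), mul_two]
  calc min κ₁ κ₂ * δ ≤ min κ₁ κ₂ * (m.runLaw x {ρ | (state (m.next^[1] ρ)).1 ≠ none} +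
        m.runLaw x {ρ | (state (m.next^[2] ρ)).1 ≠ none}) := mul_le_mul_right (hle x hx) _
    _ ≤ κ₁ * m.runLaw x {ρ | (state (m.next^[1] ρ)).1 ≠ none} +
        κ₂ * m.runLaw x {ρ | (state (m.next^[2] ρ)).1 ≠ none} := by
        rw [mul_add]
        exact add_le_add (mul_le_mul_left (min_le_left _ _) _)
          (mul_le_mul_left (min_le_right _ _) _)
    _ ≤ _ := add_le_add (m.mul_le_reach_add hle₁ 0 hx) (m.mul_le_reach_add hle₂ 1 hx)

/-! ### The flow and its chain -/

theorem law_run_preimage (η : Measure (Full ι)) [SFinite η] {B : Set (Run ι)}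
    (hB : MeasurableSet B) : m.law η (run ⁻¹' B) = ∫⁻ x, m.runLaw x B ∂η := by
  rw [← lintegral_indicator_one (measurable_run hB)]
  refine (m.lintegral_law η (measurable_one.indicator hB)).trans ?_
  simp only [lintegral_indicator_one hB]

theorem law_run_univ {η : Measure (Full ι)} (hη : m.IsInitialLaw η) : m.law η univ = 1 := by
  have := hη.1
  have h1 := m.law_run_preimage η MeasurableSet.univ
  rw [preimage_univ] at h1
  rw [h1, lintegral_congr_ae (hη.2.mono fun x hx ↦ m.isMarkovShift.apply_univ x hx)]
  simp

/-- The flow is a function of the chain. -/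
theorem ae_proc_eq {η : Measure (Full ι)} (hη : m.IsInitialLaw η) :
    ∀ᵐ ω ∂m.law η, ∀ k, m.proc k ω = obs (state (m.next^[k] (run ω))) := by
  have := hη.1
  let B : Set (Run ι) := {ρ | Regular ρ.1} ∩ ({ρ | 0 < ρ.1.2.2.1} ∩ {ρ | 0 ≤ ρ.2.1.1})
  have h0 : MeasurableSet {ρ : Run ι | Regular ρ.1} := measurable_fst measurableSet_regular
  have h1 : MeasurableSet {ρ : Run ι | 0 < ρ.1.2.2.1} :=
    measurable_fst (measurableSet_lt_residual 0)
  have h2 : MeasurableSet {ρ : Run ι | 0 ≤ ρ.2.1.1} :=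
    measurableSet_le measurable_const measurable_snd.fst.fst
  have hB : MeasurableSet B := h0.inter (h1.inter h2)
  have hgood : m.law η (run ⁻¹' Bᶜ) = 0 := by
    rw [m.law_run_preimage η hB.compl]
    refine (lintegral_congr_ae (hη.2.mono fun x hx ↦ ?_)).trans lintegral_zero
    refine ae_iff.1 (m.ae_runLaw (p := fun ρ ↦ ρ ∈ B) hB ?_)
    have hpos := m.ae_pos_residualLaw x.1 x.2.1
    have hpos' : ∀ᵐ c ∂m.channelLaw (x.1, x.2.1), 0 < c.2.2.1 :=
      m.ae_configLaw _ _ _ (hpos.mono fun r hr ↦ Filter.Eventually.of_forall fun _ ↦ hr)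
        (measurableSet_lt_residual 0)
    filter_upwards [m.ae_regular x.1 x.2.1 _ (hpos.mono fun _ h ↦ h.le), hpos'] with c h1 h2 l
    exact ⟨h1, h2, (hx.gap_pos m).1.le⟩
  have hae : ∀ᵐ ω ∂m.law η, run ω ∈ B := by
    rw [ae_iff]
    exact hgood
  exact hae.mono fun ω hω k ↦ m.proc_eq hω.1 hω.2.1 hω.2.2 k

theorem map_proc_apply {η : Measure (Full ι)} (hη : m.IsInitialLaw η) (k : ℕ) {A : Set (Obs ι)}
    (hA : MeasurableSet A) : (m.law η).map (m.proc k) A =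
      ∫⁻ x, m.runLaw x {ρ | state (m.next^[k] ρ) ∈ obs ⁻¹' A} ∂η := by
  have := hη.1
  have hB : MeasurableSet {ρ : Run ι | state (m.next^[k] ρ) ∈ obs ⁻¹' A} :=
    m.isMarkovShift.measurable_iterate k (measurable_obs hA)
  rw [Measure.map_apply (m.measurable_proc k) hA, ← m.law_run_preimage η hB]
  refine measure_congr ((m.ae_proc_eq hη).mono fun ω hω ↦ ?_)
  change (m.proc k ω ∈ A) = (obs (state (m.next^[k] (run ω))) ∈ A)
  rw [hω k]

/-! ### Regeneration cycles -/

theorem isInitialLaw_dirac {x : Full ι} (hx : m.Admissible x) :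
    m.IsInitialLaw (Measure.dirac x) :=
  ⟨inferInstance, (ae_dirac_iff m.measurableSet_admissible).2 hx⟩

theorem measurePreserving_run (i₁ : ι) :
    MeasurePreserving run (m.regLaw i₁) (m.runLaw (m.regFull i₁)) := by
  refine ⟨measurable_run, Measure.ext fun B hB ↦ ?_⟩
  rw [Measure.map_apply measurable_run hB]
  refine (m.law_run_preimage _ hB).trans ?_
  rw [lintegral_dirac' _ (m.runLaw.measurable_coe hB)]
  rfl

theorem regLaw_univ (i₁ : ι) : m.regLaw i₁ univ = 1 :=
  m.law_run_univ (m.isInitialLaw_dirac (m.admissible_regFull i₁))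

/-- The length of a cycle of the chain. -/
noncomputable def cycle (i₁ : ι) : Run ι → ℕ∞ := returnTime m.next state (m.regFull i₁)

theorem ae_cycleLength_eq (i₁ : ι) : ∀ᵐ ω ∂m.regLaw i₁,
    m.cycleLength i₁ ω = m.cycle i₁ (run ω) ∧
      ∀ k, m.proc k ω = obs (state (m.next^[k] (run ω))) := by
  refine (m.ae_proc_eq (m.isInitialLaw_dirac (m.admissible_regFull i₁))).mono fun ω hω ↦ ⟨?_, hω⟩
  unfold cycleLength cycle returnTime
  refine iInf_congr fun k ↦ iInf_congr_Prop (and_congr_right fun hk ↦ ?_) fun _ ↦ rfl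
  obtain ⟨k, rfl⟩ := Nat.exists_eq_add_of_le' hk
  rw [hω, Function.iterate_succ_apply']
  exact m.obs_next_eq_regState _

/-- The integral in the numerator of the formula for the stationary law. -/
theorem lintegral_cycle_visits (i₁ : ι) {A : Set (Obs ι)} (hA : MeasurableSet A) :
    ∫⁻ ω, (∑' k : ℕ, {ω' | (k : ℕ∞) < m.cycleLength i₁ ω' ∧ m.proc k ω' ∈ A}.indicator 1 ω)
      ∂m.regLaw i₁ = occupation m.runLaw m.next state (m.regFull i₁) (obs ⁻¹' A) := by
  have hM := m.isMarkovShift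
  have hAo : MeasurableSet (obs (ι := ι) ⁻¹' A) := measurable_obs hA
  let T : ℕ → Set (Run ι) := taboo m.next state (m.regFull i₁)
  have hT : ∀ k, MeasurableSet (T k) := hM.measurableSet_taboo
  have hB : ∀ k, MeasurableSet {ρ | state (m.next^[k] ρ) ∈ obs ⁻¹' A} := fun k ↦
    hM.measurable_iterate k hAo
  have h1 : ∀ᵐ ω ∂m.regLaw i₁,
      (∑' k : ℕ, {ω' | (k : ℕ∞) < m.cycleLength i₁ ω' ∧ m.proc k ω' ∈ A}.indicator 1 ω) =
      ∑' k : ℕ, (T k ∩ {ρ | state (m.next^[k] ρ) ∈ obs ⁻¹' A}).indicator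
        (1 : Run ι → ENNReal) (run ω) := by
    filter_upwards [m.ae_cycleLength_eq i₁] with ω hω
    refine tsum_congr fun k ↦ ?_
    have hiff : (ω ∈ {ω' | (k : ℕ∞) < m.cycleLength i₁ ω' ∧ m.proc k ω' ∈ A}) ↔
        run ω ∈ T k ∩ {ρ | state (m.next^[k] ρ) ∈ obs ⁻¹' A} := by
      rw [mem_inter_iff, mem_taboo_iff_lt_returnTime, mem_ofPred_eq, hω.1, hω.2 k]
      rfl
    by_cases h : run ω ∈ T k ∩ {ρ | state (m.next^[k] ρ) ∈ obs ⁻¹' A}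
    · rw [indicator_of_mem h, indicator_of_mem (hiff.2 h)]
      rfl
    · rw [indicator_of_notMem h, indicator_of_notMem (fun h' ↦ h (hiff.1 h'))]
  have hm : ∀ k, Measurable ((T k ∩ {ρ | state (m.next^[k] ρ) ∈ obs ⁻¹' A}).indicator
      (1 : Run ι → ENNReal)) := fun k ↦ measurable_one.indicator ((hT k).inter (hB k))
  rw [lintegral_congr_ae h1]
  refine ((m.measurePreserving_run i₁).lintegral_comp (Measurable.tsum hm)).trans ?_
  rw [lintegral_tsum fun k ↦ (hm k).aemeasurable, occupation, Measure.sum_apply _ hAo]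
  refine tsum_congr fun k ↦ ?_
  rw [lintegral_indicator_one ((hT k).inter (hB k)),
    Measure.map_apply (hM.measurable_iterate k) hAo, inter_comm]
  exact (Measure.restrict_apply (hB k)).symm

theorem lintegral_cycleLength (i₁ : ι) : ∫⁻ ω, ((m.cycleLength i₁ ω : ℕ∞) : ENNReal) ∂m.regLaw i₁ =
    occupation m.runLaw m.next state (m.regFull i₁) univ := by
  rw [← preimage_univ (f := obs), ← m.lintegral_cycle_visits i₁ MeasurableSet.univ]
  refine lintegral_congr fun ω ↦ ?_
  rw [← tsum_indicator_lt]
  refine tsum_congr fun k ↦ ?_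
  by_cases h : (k : ℕ∞) < m.cycleLength i₁ ω
  · rw [indicator_of_mem (mem_Iio.2 h), indicator_of_mem (show ω ∈ {ω' | (k : ℕ∞) <
      m.cycleLength i₁ ω' ∧ m.proc k ω' ∈ univ} from ⟨h, mem_univ _⟩)]
    rfl
  · rw [indicator_of_notMem (fun h' ↦ h (mem_Iio.1 h')), indicator_of_notMem (fun h' : ω ∈ {ω' |
      (k : ℕ∞) < m.cycleLength i₁ ω' ∧ m.proc k ω' ∈ univ} ↦ h h'.1)]

/-! ### The stationary distribution -/

/-- The normalized occupation measure of a cycle. -/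
noncomputable def statLaw (i₁ : ι) : Measure (Full ι) :=
  (occupation m.runLaw m.next state (m.regFull i₁) univ)⁻¹ •
    occupation m.runLaw m.next state (m.regFull i₁)

theorem occupation_univ_ne_zero (i₁ : ι) :
    occupation m.runLaw m.next state (m.regFull i₁) univ ≠ 0 := by
  rw [← m.lintegral_cycleLength]
  refine (lt_of_lt_of_le one_pos ?_).ne'
  rw [← m.regLaw_univ i₁, ← lintegral_one]
  refine lintegral_mono_ae ((m.ae_cycleLength_eq i₁).mono fun ω hω ↦ ?_)
  rw [hω.1]
  exact_mod_cast one_le_returnTime m.next state (m.regFull i₁) (run ω)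

theorem isInitialLaw_statLaw {i₁ : ι}
    (hfin : occupation m.runLaw m.next state (m.regFull i₁) univ ≠ ⊤) :
    m.IsInitialLaw (m.statLaw i₁) := by
  have hM := m.isMarkovShift
  refine ⟨⟨?_⟩, ?_⟩
  · rw [statLaw, Measure.smul_apply, smul_eq_mul,
      ENNReal.inv_mul_cancel (m.occupation_univ_ne_zero i₁) hfin]
  · refine Measure.ae_smul_measure ?_ _
    rw [occupation, Measure.ae_sum_iff]
    intro k
    rw [ae_map_iff (hM.measurable_iterate k).aemeasurable m.measurableSet_admissible]
    exact ae_restrict_of_ae (hM.ae_iterate_mem k _ (m.admissible_regFull i₁))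

theorem isStationary_statLaw {i₁ : ι}
    (hfin : occupation m.runLaw m.next state (m.regFull i₁) univ ≠ ⊤)
    (hret : ∀ᵐ ρ ∂m.runLaw (m.regFull i₁), m.cycle i₁ ρ ≠ ⊤) :
    m.IsStationary (m.statLaw i₁) := by
  have hη := m.isInitialLaw_statLaw hfin
  have hM := m.isMarkovShift
  have := hη.1
  have hmeas : ∀ j, Measurable fun (ω : Sample ι) (k : ℕ) ↦ m.proc (k + j) ω := fun j ↦
    measurable_pi_lambda _ fun k ↦ m.measurable_proc (k + j)
  refine ⟨(hmeas 1).aemeasurable, (hmeas 0).aemeasurable, Measure.ext fun B hB ↦ ?_⟩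
  rw [Measure.map_apply (hmeas 1) hB]
  refine Eq.trans ?_ (Measure.map_apply (hmeas 0) hB).symm
  -- the runs whose observed path is in `B`
  let D : Set (Run ι) := {ρ | (fun k ↦ obs (state (m.next^[k] ρ))) ∈ B}
  have hD : MeasurableSet D := (measurable_pi_lambda (fun ρ k ↦ obs (state (m.next^[k] ρ)))
    fun k ↦ measurable_obs.comp (hM.measurable_iterate k)) hB
  have hshift : ∀ j, m.law (m.statLaw i₁) ((fun ω k ↦ m.proc (k + j) ω) ⁻¹' B) =
      ∫⁻ x, m.runLaw x (m.next^[j] ⁻¹' D) ∂m.statLaw i₁ := fun j ↦ by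
    rw [← m.law_run_preimage _ (m.measurable_next.iterate j hD)]
    refine measure_congr ((m.ae_proc_eq hη).mono fun ω hω ↦ ?_)
    change ((fun k ↦ m.proc (k + j) ω) ∈ B) =
      ((fun k ↦ obs (state (m.next^[k] (m.next^[j] (run ω))))) ∈ B)
    simp only [hω, Function.iterate_add_apply]
  refine (hshift 1).trans (Eq.trans ?_ (hshift 0).symm)
  have h1 : ∀ᵐ x ∂m.statLaw i₁, m.runLaw x (m.next^[1] ⁻¹' D) =
      ∫⁻ ρ, m.runLaw (state (m.next ρ)) D ∂m.runLaw x :=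
    hη.2.mono fun x hx ↦ hM.measure_iterate_preimage 1 hD hx
  rw [lintegral_congr_ae h1, statLaw, lintegral_smul_measure, lintegral_smul_measure,
    hM.lintegral_occupation_shift (m.admissible_regFull i₁) hret (m.runLaw.measurable_coe hD)]
  rfl

theorem map_proc_zero_statLaw {i₁ : ι}
    (hfin : occupation m.runLaw m.next state (m.regFull i₁) univ ≠ ⊤) :
    (m.law (m.statLaw i₁)).map (m.proc 0) = (m.statLaw i₁).map obs := by
  have hη := m.isInitialLaw_statLaw hfin
  refine Measure.ext fun A hA ↦ ?_
  rw [m.map_proc_apply hη 0 hA, Measure.map_apply measurable_obs hA,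
    ← lintegral_indicator_one (measurable_obs hA)]
  refine lintegral_congr_ae (hη.2.mono fun x hx ↦ ?_)
  by_cases h : x ∈ obs ⁻¹' A
  · rw [indicator_of_mem h, Pi.one_apply, ← m.isMarkovShift.apply_univ x hx]
    refine measure_congr ((m.ae_runLaw_state x).mono fun ρ hρ ↦ ?_)
    change (state ρ ∈ obs ⁻¹' A) = True
    simpa only [hρ, eq_iff_iff, iff_true] using h
  · rw [indicator_of_notMem h]
    refine measure_mono_null_ae ?_ measure_empty
    filter_upwards [m.ae_runLaw_state x] with ρ hρ hA'
    exact h (hρ ▸ hA')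

theorem IsStationary.map_proc {η : Measure (Full ι)} (hη : m.IsStationary η) (k : ℕ) :
    (m.law η).map (m.proc k) = (m.law η).map (m.proc 0) := by
  induction k with
  | zero => rfl
  | succ k ih => exact (hη.comp (measurable_pi_apply k)).map_eq.trans ih

/-- Bounds for all admissible initial states carry over to initial laws. -/
theorem map_proc_mem_Icc {η : Measure (Full ι)} (hη : m.IsInitialLaw η) (k : ℕ) {A : Set (Obs ι)}
    (hA : MeasurableSet A) {lo hi : ℝ} (h : ∀ x, m.Admissible x →
      lo ≤ (m.runLaw x).real {ρ | state (m.next^[k] ρ) ∈ obs ⁻¹' A} ∧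
        (m.runLaw x).real {ρ | state (m.next^[k] ρ) ∈ obs ⁻¹' A} ≤ hi) :
    ((m.law η).map (m.proc k)).real A ∈ Icc lo hi := by
  have := hη.1
  have hB : MeasurableSet {ρ : Run ι | state (m.next^[k] ρ) ∈ obs ⁻¹' A} :=
    m.isMarkovShift.measurable_iterate k (measurable_obs hA)
  have hf : Measurable fun x ↦ m.runLaw x {ρ | state (m.next^[k] ρ) ∈ obs ⁻¹' A} :=
    m.runLaw.measurable_coe hB
  have e : ((m.law η).map (m.proc k)).real A =
      ∫ x, (m.runLaw x).real {ρ | state (m.next^[k] ρ) ∈ obs ⁻¹' A} ∂η := by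
    rw [measureReal_def, m.map_proc_apply hη k hA]
    exact (integral_toReal hf.aemeasurable
      (Filter.Eventually.of_forall fun x ↦ measure_lt_top _ _)).symm
  have hint : Integrable (fun x ↦ (m.runLaw x).real {ρ | state (m.next^[k] ρ) ∈ obs ⁻¹' A}) η :=
    Integrable.of_bound hf.ennreal_toReal.aestronglyMeasurable (max |lo| |hi|)
      (hη.2.mono fun x hx ↦ abs_le_max_abs_abs (h x hx).1 (h x hx).2)
  rw [e]
  constructor
  · simpa using integral_mono_ae (integrable_const lo) hint (hη.2.mono fun x hx ↦ (h x hx).1)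
  · simpa using integral_mono_ae hint (integrable_const hi) (hη.2.mono fun x hx ↦ (h x hx).2)

theorem pow_div_le {q : ℝ} (hq0 : 0 < q) (hq1 : q < 1) {n : ℕ} (hn : 1 ≤ n) (k : ℕ) :
    q ^ (k / n) ≤ q⁻¹ * (q ^ (1 / (n : ℝ))) ^ k := by
  have hn0 : (0 : ℝ) < n := by exact_mod_cast hn
  have h1 : (k : ℝ) / n < ((k / n : ℕ) : ℝ) + 1 := by
    rw [div_lt_iff₀ hn0]
    exact_mod_cast Nat.lt_mul_of_div_lt (Nat.lt_succ_self (k / n)) hn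
  rw [← Real.rpow_natCast, ← Real.rpow_natCast, ← Real.rpow_mul hq0.le, ← Real.rpow_neg_one,
    ← Real.rpow_add hq0]
  refine Real.rpow_le_rpow_of_exponent_ge hq0 hq1.le ?_
  rw [one_div_mul_eq_div]
  linarith

end OnOffTCP

theorem proposition3 {ι : Type*} [Fintype ι] (m : OnOffTCP ι) (i₁ : ι)
    (ε₀ ε₁ : ℝ) (hε₀ : 0 < ε₀) (hε₁ : 0 < ε₁)
    (hmid : ∀ s : ℝ, 0 ≤ s → s ≤ m.R → ε₀ ≤ m.ν.real (Set.Ioo (s + m.M) (s + 3 * m.M)))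
    (hres : ∀ s : ℝ, 0 ≤ s → m.ν (Set.Ici s) ≠ 0 →
      ε₁ ≤ (ProbabilityTheory.cond m.ν (Set.Ici s)).real (Set.Iic (s + 2 * m.M))) :
    -- the cycle length is finite, with finite moments of all orders
    (∀ᵐ ω ∂(m.regLaw i₁), m.cycleLength i₁ ω ≠ ⊤) ∧
    (∀ a : ℝ, 0 < a →
      ∫⁻ ω, ((m.cycleLength i₁ ω : ℕ∞) : ENNReal) ^ a ∂(m.regLaw i₁) < ⊤) ∧
    -- its moment generating function is finite near zero
    (∃ δ : ℝ, 0 < δ ∧ ∀ t : ℝ, |t| < δ →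
      MeasureTheory.Integrable
        (fun ω ↦ Real.exp (t * ((m.cycleLength i₁ ω).toNat : ℝ))) (m.regLaw i₁)) ∧
    -- it is aperiodic
    (∀ d : ℕ, (∀ n : ℕ, m.regLaw i₁ {ω | m.cycleLength i₁ ω = n} ≠ 0 → d ∣ n) → d = 1) ∧
    -- the stationary distribution
    ∃ π : MeasureTheory.Measure (OnOffTCP.Obs ι), MeasureTheory.IsProbabilityMeasure π ∧
      (∀ A : Set (OnOffTCP.Obs ι), MeasurableSet A →
        π A = (∫⁻ ω, (∑' k : ℕ,
            {ω' | (k : ℕ∞) < m.cycleLength i₁ ω' ∧ m.proc k ω' ∈ A}.indicator 1 ω) ∂(m.regLaw i₁)) /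
          ∫⁻ ω, ((m.cycleLength i₁ ω : ℕ∞) : ENNReal) ∂(m.regLaw i₁)) ∧
      (∃ η : MeasureTheory.Measure (OnOffTCP.Full ι), m.IsInitialLaw η ∧ m.IsStationary η ∧
        (m.law η).map (m.proc 0) = π) ∧
      (∀ η : MeasureTheory.Measure (OnOffTCP.Full ι), m.IsInitialLaw η →
        (∀ k : ℕ, MeasureTheory.Measure.map (m.proc k) (m.law η) =
          MeasureTheory.Measure.map (m.proc 0) (m.law η)) →
        MeasureTheory.Measure.map (m.proc 0) (m.law η) = π) ∧
      -- exponential convergence in total variation from every initial distribution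
      ∃ C ρ : ℝ, 0 ≤ C ∧ 0 < ρ ∧ ρ < 1 ∧
        ∀ η : MeasureTheory.Measure (OnOffTCP.Full ι), m.IsInitialLaw η →
          ∀ (k : ℕ) (A : Set (OnOffTCP.Obs ι)), MeasurableSet A →
            |(MeasureTheory.Measure.map (m.proc k) (m.law η)).real A - π.real A| ≤ C * ρ ^ k := by
  have hM := m.isMarkovShift
  have hx₀ : m.regFull i₁ ∈ {x | m.Admissible x} := m.admissible_regFull i₁
  have hmp := m.measurePreserving_run i₁
  have hcyc := m.ae_cycleLength_eq i₁
  have : IsProbabilityMeasure (m.runLaw (m.regFull i₁)) := hM.isProbabilityMeasure hx₀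
  have : IsProbabilityMeasure (m.regLaw i₁) := ⟨m.regLaw_univ i₁⟩
  obtain ⟨n, hn0, hn1, δ, hδ0, hδ1, hmin⟩ := m.exists_minorization i₁ hε₀ hε₁ hmid hres
  have hq0 : 0 < 1 - δ := by linarith
  have hq1 : 1 - δ < 1 := by linarith
  have hn2 : 1 ≤ n + 2 := by omega
  have hNm : Measurable (m.cycle i₁) := hM.measurable_returnTime
  have hN1 : ∀ ρ, 1 ≤ m.cycle i₁ ρ := one_le_returnTime _ _ _
  have htail : ∀ j : ℕ, m.runLaw (m.regFull i₁) {ρ | ((j * (n + 2) : ℕ) : ℕ∞) < m.cycle i₁ ρ} ≤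
      ENNReal.ofReal ((1 - δ) ^ j) := fun j ↦ by
    have h1 := hM.measure_taboo_le hn2 hmin hx₀ j
    rw [ENNReal.ofReal_pow hq0.le, ENNReal.ofReal_sub _ hδ0.le, ENNReal.ofReal_one]
    refine le_of_eq_of_le (congrArg _ (ext fun ρ ↦ ?_)) h1
    exact mem_taboo_iff_lt_returnTime.symm
  have hfin := ae_ne_top_of_geometric_tail hq0 hq1 htail
  have hexp := exists_integrable_exp_of_geometric_tail hn2 hq0 hq1 hNm hN1 htail
  have hmom : ∀ a : ℝ, 0 < a →
      ∫⁻ ω, ((m.cycleLength i₁ ω : ℕ∞) : ENNReal) ^ a ∂(m.regLaw i₁) < ⊤ := fun a ha ↦ by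
    obtain ⟨r, hr, hexp⟩ := hexp
    refine lt_of_eq_of_lt ?_ (lintegral_rpow_lt_top_of_exp hfin hr hexp ha)
    refine (lintegral_congr_ae (hcyc.mono fun ω hω ↦ ?_)).trans
      (hmp.lintegral_comp (f := fun ρ ↦ ((m.cycle i₁ ρ : ℕ∞) : ENNReal) ^ a) ?_)
    · simp only [hω.1]
    · exact (measurable_of_countable fun k : ℕ∞ ↦ (k : ENNReal) ^ a).comp hNm
  have hocc : occupation m.runLaw m.next OnOffTCP.state (m.regFull i₁) univ ≠ ⊤ := by
    rw [← m.lintegral_cycleLength]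
    simpa only [ENNReal.rpow_one] using (hmom 1 one_pos).ne
  refine ⟨?_, hmom, ?_, ?_, (m.statLaw i₁).map OnOffTCP.obs, ?_, ?_, ?_, ?_⟩
  · filter_upwards [hcyc, hmp.quasiMeasurePreserving.ae hfin] with ω h1 h2
    rwa [h1.1]
  · obtain ⟨r, hr, hexp⟩ := hexp
    refine ⟨r, hr, fun t ht ↦ ((hmp.integrable_comp_of_integrable (hexp t ht)).congr
      (hcyc.mono fun ω hω ↦ ?_))⟩
    simp only [Function.comp_apply, hω.1]
  · intro d hd
    have hd' : ∀ k : ℕ, m.runLaw (m.regFull i₁) {ρ | m.cycle i₁ ρ = k} ≠ 0 → d ∣ k := by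
      intro k hk
      refine hd k ?_
      have hset : MeasurableSet {ρ | m.cycle i₁ ρ = k} := hNm (measurableSet_singleton _)
      rw [← hmp.measure_preimage hset.nullMeasurableSet] at hk
      convert hk using 1
      refine measure_congr (hcyc.mono fun ω hω ↦ ?_)
      change (m.cycleLength i₁ ω = k) = (m.cycle i₁ (OnOffTCP.run ω) = k)
      rw [hω.1]
    have h0 := hM.dvd_of_measure_ne_zero hx₀ hd' n hn0
    have h1 := hM.dvd_of_measure_ne_zero hx₀ hd' (n + 1) hn1
    exact Nat.dvd_one.1 ((Nat.dvd_add_right h0).1 h1)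
  · have := (m.isInitialLaw_statLaw hocc).1
    exact Measure.isProbabilityMeasure_map OnOffTCP.measurable_obs.aemeasurable
  · intro A hA
    rw [m.lintegral_cycle_visits i₁ hA, m.lintegral_cycleLength,
      Measure.map_apply OnOffTCP.measurable_obs hA, OnOffTCP.statLaw, Measure.smul_apply,
      smul_eq_mul, ENNReal.div_eq_inv_mul]
  · exact ⟨m.statLaw i₁, m.isInitialLaw_statLaw hocc, m.isStationary_statLaw hocc hfin,
      m.map_proc_zero_statLaw hocc⟩
  have hstat := m.isInitialLaw_statLaw hocc
  -- the law at attempt `k` of the stationary flow and of any other one are within the oscillation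
  -- of the transition probabilities
  have hconv : ∀ η, m.IsInitialLaw η → ∀ (k : ℕ) (A : Set (OnOffTCP.Obs ι)), MeasurableSet A →
      |(Measure.map (m.proc k) (m.law η)).real A - ((m.statLaw i₁).map OnOffTCP.obs).real A| ≤
        (1 - δ)⁻¹ * ((1 - δ) ^ (1 / ((n + 2 : ℕ) : ℝ))) ^ k := by
    intro η hη k A hA
    have hmin' : ∀ x ∈ {x | m.Admissible x}, δ ≤ (m.runLaw x).real
        {ρ | OnOffTCP.state (m.next^[n + 2] ρ) = m.regFull i₁} := fun x hx ↦
      (ENNReal.ofReal_le_iff_le_toReal (measure_ne_top _ _)).1 (hmin x hx)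
    obtain ⟨lo, hi, hosc, hb⟩ := hM.exists_bounds hn2 hx₀ hδ1.le hmin'
      (OnOffTCP.measurable_obs hA) k
    have h1 := m.map_proc_mem_Icc hη k hA hb
    have h2 := m.map_proc_mem_Icc hstat k hA hb
    rw [(m.isStationary_statLaw hocc hfin).map_proc, m.map_proc_zero_statLaw hocc] at h2
    refine (abs_sub_le_of_le_of_le h1.1 h1.2 h2.1 h2.2).trans (hosc.trans ?_)
    exact OnOffTCP.pow_div_le hq0 hq1 hn2 k
  have hρ0 : 0 < (1 - δ) ^ (1 / ((n + 2 : ℕ) : ℝ)) := Real.rpow_pos_of_pos hq0 _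
  have hρ1 : (1 - δ) ^ (1 / ((n + 2 : ℕ) : ℝ)) < 1 :=
    Real.rpow_lt_one hq0.le hq1 (by positivity)
  refine ⟨fun η hη hconst ↦ ?_, (1 - δ)⁻¹, (1 - δ) ^ (1 / ((n + 2 : ℕ) : ℝ)),
    (inv_pos.2 hq0).le, hρ0, hρ1, hconv⟩
  have := hη.1
  have hlaw : IsProbabilityMeasure (m.law η) := ⟨m.law_run_univ hη⟩
  have := hstat.1
  have : IsProbabilityMeasure ((m.law η).map (m.proc 0)) :=
    Measure.isProbabilityMeasure_map (m.measurable_proc 0).aemeasurable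
  have : IsProbabilityMeasure ((m.statLaw i₁).map OnOffTCP.obs) :=
    Measure.isProbabilityMeasure_map OnOffTCP.measurable_obs.aemeasurable
  refine Measure.ext fun A hA ↦ ?_
  have hlim : Filter.Tendsto (fun k : ℕ ↦ (1 - δ)⁻¹ * ((1 - δ) ^ (1 / ((n + 2 : ℕ) : ℝ))) ^ k)
      Filter.atTop (nhds 0) := by
    simpa only [mul_zero] using
      (tendsto_pow_atTop_nhds_zero_of_lt_one hρ0.le hρ1).const_mul (1 - δ)⁻¹
  have habs := ge_of_tendsto' hlim fun k ↦ by
    have := hconv η hη k A hA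
    rwa [hconst k] at this
  have hreal := sub_eq_zero.1 (abs_eq_zero.1 (le_antisymm habs (abs_nonneg _)))
  exact (measureReal_eq_measureReal_iff).1 hreal
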